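/- Let $N\ge 1$ be an integer and $\alpha>0$. Consider the star graph with one vertex and $N$ infinite edges, with Hilbert space $L^2(0,\infty)^N$, and let $H=-\frac{d^2}{dx^2}$ act edge by edge on the functions $u=(u_j)_{j=1}^N$ with $u_j\in L^2(0,\infty)$, $u_j,u_j'$ locally absolutely continuous on $[0,\infty)$, $u_j''\in L^2(0,\infty)$, that satisfy $u_i(0)=u_j(0)=:u(0)$ for all $i,j$ and $\sum_{j=1}^N u_j'(0)=\alpha u(0)$. Then $H$ has a spectral resolution, and its spectral projection $P(\lambda)$ onto $[0,\lambda]$, $\lambda\ge0$, is an integral operator with matrix kernel $P(\lambda,x,y)=\int_0^{\sqrt\lambda}\sigma(\omega,x,y)\,d\omega$, where $\sigma=(\sigma_j{}^l)$ is a continuous real matrix-valued function of $\omega,x,y\ge0$. For the spectral resolution of $H$ and its spectral density $\sigma$ the following hold. 1. (Global spectral density.) Define the distribution $\Delta\rho$ on $\mathbb R$ as the integral over the graph of the local spectral density with the Weyl term subtracted, $$\Delta\rho(\omega)=\int_0^\infty\sum_{j=1}^N\Big[\sigma_j{}^j(\omega,x,x)-\frac1\pi\Big]dx ,$$ where for each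 $x$ the integrand is regarded as a distribution in $\omega$ that vanishes for $\omega<0$, and the integral is taken in the sense of distributions: for every $\varphi\in C_c^\infty(\mathbb R)$ the function $x\mapsto\int_0^\infty\sum_j[\sigma_j{}^j(\omega,x,x)-\frac1\pi]\varphi(\omega)\,d\omega$ is absolutely integrable on $(0,\infty)$, and its integral is $\langle\Delta\rho,\varphi\rangle$. Then, with $\theta$ the unit step function ($\theta(\omega)=1$ for $\omega>0$ and $\theta(\omega)=0$ for $\omega\le 0$) and $\langle\delta,\varphi\rangle=\varphi(0)$, $$\Delta\rho(\omega)=\Big(\frac12-\frac N4\Big)\delta(\omega)+\Big[\frac{N\alpha/\pi}{\alpha^2+N^2\omega^2}\,\theta(\omega)-\frac12\delta(\omega)\Big]=-\frac N4\,\delta(\omega)+\frac{N\alpha/\pi}{\alpha^2+N^2\omega^2}\,\theta(\omega).$$ 2. (Counting function.) Let $$\Delta N(\omega)=\Big[-\frac N4+\frac1\pi\arctan\frac{N\omega}{\alpha}\Big]\theta(\omega).$$ This is the change that the vertex makes in the number of eigenvalues in $[0,\omega^2]$: for every $\omega\ge0$, $$\lim_{R\to\infty}\int_0^R\sum_{j=1}^N\Big[P_j{}^j(\omega^2,x,x)-\frac{\omega}{\pi}\Big]dx=\Delta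 N(\omega),$$ and $\Delta N(\omega)=0$ for $\omega<0$. Moreover $\Delta\rho$ is the distributional derivative of $\Delta N$. -/

import Mathlib

open MeasureTheory Set Filter Topology
open scoped ENNReal InnerProductSpace Distributions

noncomputable section

/-! ## Projection-valued measures and spectral measures of unbounded operators -/

/-- A projection-valued Borel measure on `ℝ`: orthogonal projections `P(B)`, with `P(ℝ) = 1`,
countably additive in the strong operator topology. -/
structure PVM (E : Type*) [NormedAddCommGroup E] [InnerProductSpace ℂ E] [CompleteSpace E] where
  proj : Set ℝ → E →L[ℂ] E
  isProj : ∀ B, MeasurableSet B → IsStarProjection (proj B)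
  univ' : proj univ = 1
  iUnion' : ∀ B : ℕ → Set ℝ, (∀ n, MeasurableSet (B n)) → Pairwise (Function.onFun Disjoint B) →
    ∀ u, HasSum (fun n => proj (B n) u) (proj (⋃ n, B n) u)

namespace PVM

variable {E : Type*} [NormedAddCommGroup E] [InnerProductSpace ℂ E] [CompleteSpace E] (P : PVM E)

theorem inner_proj {B : Set ℝ} (hB : MeasurableSet B) (u : E) :
    inner ℂ u (P.proj B u) = ((‖P.proj B u‖ ^ 2 : ℝ) : ℂ) := by
  have h := P.isProj B hB
  have h1 : P.proj B (P.proj B u) = P.proj B u := by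
    have := congrArg (fun T : E →L[ℂ] E => T u) h.isIdempotentElem.eq
    simpa using this
  have h2 := ContinuousLinearMap.isSelfAdjoint_iff_isSymmetric.1 h.isSelfAdjoint
  have h3 : inner ℂ (P.proj B u) (P.proj B u) = inner ℂ u (P.proj B (P.proj B u)) :=
    h2 u (P.proj B u)
  rw [h1] at h3
  rw [← h3, inner_self_eq_norm_sq_to_K]
  norm_cast

theorem proj_empty : P.proj ∅ = 0 := by
  ext u
  have h := P.iUnion' (fun _ => ∅) (fun _ => MeasurableSet.empty)
    (fun i j _ => by simp [Function.onFun]) u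
  simp only [iUnion_empty] at h
  have h2 := h.summable.tendsto_atTop_zero
  simpa using tendsto_nhds_unique tendsto_const_nhds h2

/-- The scalar spectral measure `μ_u(B) = ⟨u, P(B) u⟩ = ‖P(B) u‖²` of a vector `u`. -/
def scalarMeasure (u : E) : Measure ℝ :=
  Measure.ofMeasurable (fun B _ => ENNReal.ofReal (‖P.proj B u‖ ^ 2))
    (by simp [P.proj_empty])
    (by
      intro B hB hd
      have h := (P.iUnion' B hB hd u).mapL (innerSL ℂ u)
      simp only [innerSL_apply_apply, P.inner_proj (hB _), P.inner_proj (MeasurableSet.iUnion hB)] at h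
      have h' : HasSum (fun n => ‖P.proj (B n) u‖ ^ 2) (‖P.proj (⋃ n, B n) u‖ ^ 2) := by
        exact_mod_cast h
      rw [← h'.tsum_eq, ENNReal.ofReal_tsum_of_nonneg (fun _ => by positivity) h'.summable])

/-- `P` is the spectral measure of the (unbounded) operator `A`, i.e. `A = ∫ s dP(s)`:
the domain of `A` is `{u | ∫ s² d⟨u, P u⟩ < ∞}` and `⟨u, A u⟩ = ∫ s d⟨u, P u⟩` on it. -/
structure IsSpectralMeasureOf (A : E →ₗ.[ℂ] E) : Prop where
  mem_domain_iff : ∀ u, u ∈ A.domain ↔ Integrable (fun s : ℝ => s ^ 2) (P.scalarMeasure u)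
  inner_apply : ∀ u : A.domain,
    inner ℂ (u : E) (A u) = ((∫ s, s ∂(P.scalarMeasure (u : E)) : ℝ) : ℂ)

end PVM

/-! ## The infinite star graph and its Hamiltonian -/

/-- The Hilbert space `L²(0,∞)^N` of the star graph with `N` infinite edges. -/
abbrev StarL2 (N : ℕ) : Type :=
  PiLp 2 (fun _ : Fin N => Lp ℂ 2 (volume.restrict (Ioi (0 : ℝ))))

/-- `f` is a regular representative of `u`, with derivative `f'`, showing that `u` lies in the
domain of the Hamiltonian with `H u = w`: on every edge `f` is `C¹` on `[0,∞)`, its derivative `f'`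
is locally absolutely continuous with `f'' = - w ∈ L²` (both facts written in integrated form),
`f` is continuous at the vertex, and the outgoing derivatives satisfy
`∑ j, f_j'(0) = α f(0)`. -/
structure IsStarRep (N : ℕ) (α : ℝ) (u w : StarL2 N) (f f' : Fin N → ℝ → ℂ) : Prop where
  ae_eq : ∀ j, u j =ᵐ[volume.restrict (Ioi (0 : ℝ))] f j
  deriv_fst : ∀ j, ContinuousOn (f' j) (Ici 0) ∧
    ∀ x, 0 ≤ x → f j x = f j 0 + ∫ s in (0 : ℝ)..x, f' j s
  deriv_snd : ∀ j, ∀ x, 0 ≤ x → f' j x = f' j 0 - ∫ s in (0 : ℝ)..x, w j s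
  continuity : ∀ i j, f i 0 = f j 0
  vertex : ∀ i, ∑ j, f' j 0 = α * f i 0

theorem starL2_intervalIntegrable {N : ℕ} (w : StarL2 N) (j : Fin N) {a b : ℝ} (ha : 0 ≤ a)
    (hb : 0 ≤ b) : IntervalIntegrable (w j) volume a b := by
  rw [intervalIntegrable_iff]
  have h1 : MemLp (w j) 2 (volume.restrict (Ioi (0 : ℝ))) := Lp.memLp _
  have hs : uIoc a b ⊆ Ioi 0 := by
    intro x hx
    rw [uIoc, mem_Ioc] at hx
    exact lt_of_le_of_lt (le_min ha hb) hx.1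
  have h2 : MemLp (w j) 2 (volume.restrict (uIoc a b)) :=
    h1.mono_measure (Measure.restrict_mono hs le_rfl)
  have : IsFiniteMeasure (volume.restrict (uIoc a b)) :=
    ⟨by simp [uIoc]⟩
  exact h2.integrable (by norm_num)

theorem isStarRep_intervalIntegrable {g : ℝ → ℂ} (hg : ContinuousOn g (Ici 0)) {x : ℝ}
    (hx : 0 ≤ x) : IntervalIntegrable g volume 0 x := by
  apply ContinuousOn.intervalIntegrable
  apply hg.mono
  intro s hs
  rw [uIcc_of_le hx] at hs
  exact hs.1

/-- The graph `{(u, H u)}` of the Hamiltonian. -/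
def starGraph (N : ℕ) (α : ℝ) : Submodule ℂ (StarL2 N × StarL2 N) where
  carrier := {p | ∃ f f', IsStarRep N α p.1 p.2 f f'}
  zero_mem' := by
    refine ⟨fun _ _ => 0, fun _ _ => 0, ?_, ?_, ?_, ?_, ?_⟩
    · intro j
      exact Lp.coeFn_zero _ _ _
    · intro j
      exact ⟨continuousOn_const, by simp⟩
    · intro j x hx
      have : ∫ s in (0 : ℝ)..x, (0 : StarL2 N) j s = 0 := by
        rw [intervalIntegral.integral_of_le hx]
        apply integral_eq_zero_of_ae
        exact ae_mono (Measure.restrict_mono Ioc_subset_Ioi_self le_rfl)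
          (Lp.coeFn_zero ℂ 2 (volume.restrict (Ioi (0 : ℝ))))
      simpa using this
    · simp
    · simp
  add_mem' := by
    rintro p q ⟨f, f', hf⟩ ⟨g, g', hg⟩
    refine ⟨fun j x => f j x + g j x, fun j x => f' j x + g' j x, ?_, ?_, ?_, ?_, ?_⟩
    · intro j
      exact (Lp.coeFn_add (p.1 j) (q.1 j)).trans ((hf.ae_eq j).add (hg.ae_eq j))
    · intro j
      refine ⟨(hf.deriv_fst j).1.add (hg.deriv_fst j).1, fun x hx => ?_⟩
      rw [intervalIntegral.integral_add
        (isStarRep_intervalIntegrable (hf.deriv_fst j).1 hx)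
        (isStarRep_intervalIntegrable (hg.deriv_fst j).1 hx),
        (hf.deriv_fst j).2 x hx, (hg.deriv_fst j).2 x hx]
      ring
    · intro j x hx
      have : ∫ s in (0 : ℝ)..x, (p + q).2 j s
          = ∫ s in (0 : ℝ)..x, (p.2 j s + q.2 j s) := by
        rw [intervalIntegral.integral_of_le hx, intervalIntegral.integral_of_le hx]
        apply integral_congr_ae
        exact ae_mono (Measure.restrict_mono Ioc_subset_Ioi_self le_rfl)
          (Lp.coeFn_add (p.2 j) (q.2 j))
      rw [this, intervalIntegral.integral_add (starL2_intervalIntegrable _ _ le_rfl hx)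
        (starL2_intervalIntegrable _ _ le_rfl hx), hf.deriv_snd j x hx, hg.deriv_snd j x hx]
      ring
    · intro i j
      rw [hf.continuity i j, hg.continuity i j]
    · intro i
      rw [Finset.sum_add_distrib, hf.vertex i, hg.vertex i]
      ring
  smul_mem' := by
    rintro c p ⟨f, f', hf⟩
    refine ⟨fun j x => c * f j x, fun j x => c * f' j x, ?_, ?_, ?_, ?_, ?_⟩
    · intro j
      exact (Lp.coeFn_smul c (p.1 j)).trans ((hf.ae_eq j).const_smul c)
    · intro j
      refine ⟨continuousOn_const.mul (hf.deriv_fst j).1, fun x hx => ?_⟩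
      rw [intervalIntegral.integral_const_mul, (hf.deriv_fst j).2 x hx]
      ring
    · intro j x hx
      have : ∫ s in (0 : ℝ)..x, (c • p).2 j s = ∫ s in (0 : ℝ)..x, c * p.2 j s := by
        rw [intervalIntegral.integral_of_le hx, intervalIntegral.integral_of_le hx]
        apply integral_congr_ae
        exact ae_mono (Measure.restrict_mono Ioc_subset_Ioi_self le_rfl)
          (Lp.coeFn_smul c (p.2 j))
      rw [this, intervalIntegral.integral_const_mul, hf.deriv_snd j x hx]
      ring
    · intro i j
      rw [hf.continuity i j]
    · intro i
      rw [← Finset.mul_sum, hf.vertex i]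
      ring

/-- `H u` is determined by `u`. -/
theorem starGraph_single_valued (N : ℕ) (α : ℝ) (p : StarL2 N × StarL2 N)
    (hp : p ∈ starGraph N α) (h0 : p.1 = 0) : p.2 = 0 := by
  obtain ⟨f, f', hf⟩ := hp
  ext1
  ext1
  rename_i j
  have hcont : ContinuousOn (f j) (Ici 0) := by
    have hc : ContinuousOn (fun x => f j 0 + ∫ s in (0 : ℝ)..x, f' j s) (Ici 0) := by
      intro x hx
      have h1 : ContinuousOn (fun x => ∫ s in (0 : ℝ)..x, f' j s) (uIcc 0 (x + 1)) :=
        intervalIntegral.continuousOn_primitive_interval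
          (by
            have := isStarRep_intervalIntegrable (hf.deriv_fst j).1
              (add_nonneg (mem_Ici.1 hx) zero_le_one)
            rwa [intervalIntegrable_iff', ] at this)
      have hx0 : 0 ≤ x := hx
      rw [uIcc_of_le (by linarith)] at h1
      have h2 := (h1 x ⟨hx0, by linarith⟩).const_add (f j 0)
      refine h2.mono_of_mem_nhdsWithin ?_
      rw [← Ici_inter_Iic]
      exact inter_mem_nhdsWithin _ (Iic_mem_nhds (by linarith))
    exact hc.congr (fun x hx => (hf.deriv_fst j).2 x hx)
  have hae : f j =ᵐ[volume.restrict (Ioi (0 : ℝ))] fun _ => (0 : ℂ) := by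
    have h1 := hf.ae_eq j
    rw [h0] at h1
    exact h1.symm.trans (Lp.coeFn_zero ℂ 2 (volume.restrict (Ioi (0 : ℝ))))
  have hf0 : EqOn (f j) (fun _ => (0 : ℂ)) (Ioi 0) :=
    Measure.eqOn_open_of_ae_eq hae isOpen_Ioi (hcont.mono Ioi_subset_Ici_self)
      continuousOn_const
  have hf'0 : ∀ x, 0 < x → f' j x = 0 := by
    intro x hx
    have hd : HasDerivAt (fun y => ∫ s in (0 : ℝ)..y, f' j s) (f' j x) x := by
      apply intervalIntegral.integral_hasDerivAt_right
      · exact isStarRep_intervalIntegrable (hf.deriv_fst j).1 hx.le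
      · exact (((hf.deriv_fst j).1.mono Ioi_subset_Ici_self).stronglyMeasurableAtFilter
          isOpen_Ioi) x hx
      · exact (hf.deriv_fst j).1.continuousAt (Ici_mem_nhds hx)
    have hd2 : HasDerivAt (fun y => ∫ s in (0 : ℝ)..y, f' j s) 0 x := by
      refine (hasDerivAt_const x (- f j 0)).congr_of_eventuallyEq ?_
      filter_upwards [Ioi_mem_nhds hx] with y hy
      have h1 := (hf.deriv_fst j).2 y (le_of_lt hy)
      rw [hf0 hy] at h1
      linear_combination -h1
    exact hd.unique hd2
  have hw : ∀ x, 0 < x → ∫ s in (0 : ℝ)..x, p.2 j s = f' j 0 := by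
    intro x hx
    have h1 := hf.deriv_snd j x hx.le
    rw [hf'0 x hx] at h1
    linear_combination h1
  have hall : ∀ n : ℕ, ∀ᵐ x, x ∈ Ioo (0 : ℝ) n → p.2 j x = 0 := by
    intro n
    have h1 := (starL2_intervalIntegrable p.2 j le_rfl
      (Nat.cast_nonneg n)).ae_hasDerivAt_integral
    filter_upwards [h1] with x hx hxn
    have hx2 := hx (by rw [uIcc_of_le (Nat.cast_nonneg n)]; exact ⟨hxn.1.le, hxn.2.le⟩) 0
      (by rw [uIcc_of_le (Nat.cast_nonneg n)]; exact ⟨le_rfl, Nat.cast_nonneg n⟩)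
    refine hx2.unique ?_
    refine (hasDerivAt_const x (f' j 0)).congr_of_eventuallyEq ?_
    filter_upwards [Ioi_mem_nhds hxn.1] with y hy
    exact hw y hy
  refine Filter.EventuallyEq.trans ?_ (Lp.coeFn_zero ℂ 2 (volume.restrict (Ioi (0 : ℝ)))).symm
  rw [Filter.EventuallyEq, ae_restrict_iff' measurableSet_Ioi]
  filter_upwards [ae_all_iff.2 hall] with x hx hx0
  obtain ⟨n, hn⟩ := exists_nat_gt x
  exact hx n ⟨hx0, hn⟩

/-- The Hamiltonian `H = -d²/dx²` of the infinite star graph with `N` edges, with the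
Exner–Šeba (`δ`) condition of strength `α` at the vertex. -/
def starHamiltonian (N : ℕ) (α : ℝ) : StarL2 N →ₗ.[ℂ] StarL2 N :=
  (starGraph N α).toLinearPMap

theorem starHamiltonian_graph (N : ℕ) (α : ℝ) : (starHamiltonian N α).graph = starGraph N α :=
  Submodule.toLinearPMap_graph_eq _ (starGraph_single_valued N α)

/-! ## Spectral density -/

/-- The kernel `P(Λ,x,y) = ∫₀^{√Λ} σ(ω,x,y) dω`. -/
def projKernel {N : ℕ} (σ : ℝ → ℝ → ℝ → Matrix (Fin N) (Fin N) ℝ) (Λ x y : ℝ) :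
    Matrix (Fin N) (Fin N) ℝ :=
  Matrix.of fun j l => ∫ ω in (0 : ℝ)..√Λ, σ ω x y j l

/-- `σ` is the spectral density of the spectral resolution `P`: it is a continuous matrix-valued
function on `ω, x, y ≥ 0`, and for each `Λ ≥ 0` the spectral projection `P([0,Λ])` is the integral
operator with kernel `∫₀^{√Λ} σ(ω,x,y) dω`. The kernel is tested on the dense subspace of
compactly supported `u`, on which the integral converges absolutely. -/
structure IsSpectralDensity {N : ℕ} (P : PVM (StarL2 N))
    (σ : ℝ → ℝ → ℝ → Matrix (Fin N) (Fin N) ℝ) : Prop where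
  continuousOn : ContinuousOn (fun p : ℝ × ℝ × ℝ => σ p.1 p.2.1 p.2.2)
    (Ici 0 ×ˢ Ici 0 ×ˢ Ici 0)
  kernel : ∀ Λ : ℝ, 0 ≤ Λ → ∀ u : StarL2 N,
    (∃ R : ℝ, ∀ j, ∀ᵐ y ∂(volume.restrict (Ioi (0 : ℝ))), R < y → u j y = 0) →
    ∀ j, P.proj (Icc 0 Λ) u j =ᵐ[volume.restrict (Ioi (0 : ℝ))]
      fun x => ∑ l, ∫ y in Ioi (0 : ℝ), (projKernel σ Λ x y j l : ℂ) * u l y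

/-- The local spectral density, summed over edges, with the Weyl term `1/π` per edge subtracted. -/
def weylSubtractedDensity {N : ℕ} (σ : ℝ → ℝ → ℝ → Matrix (Fin N) (Fin N) ℝ) (ω x : ℝ) : ℝ :=
  ∑ j, (σ ω x x j j - 1 / Real.pi)

/-- The value on `φ` of the distribution `ω ↦ weylSubtractedDensity σ ω x` at fixed `x`.
(The spectrum is parametrised by `ω ≥ 0`; there is no density at `ω < 0`.) -/
def localDensityPairing {N : ℕ} (σ : ℝ → ℝ → ℝ → Matrix (Fin N) (Fin N) ℝ) (x : ℝ)
    (φ : ℝ → ℝ) : ℝ :=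
  ∫ ω in Ioi (0 : ℝ), weylSubtractedDensity σ ω x * φ ω

/-- The global spectral density `Δρ`: the integral over `0 < x < ∞` of the distribution-valued
function `x ↦ weylSubtractedDensity σ · x`, evaluated on a test function `φ`. -/
def globalDensity {N : ℕ} (σ : ℝ → ℝ → ℝ → Matrix (Fin N) (Fin N) ℝ) (φ : ℝ → ℝ) : ℝ :=
  ∫ x in Ioi (0 : ℝ), localDensityPairing σ x φ

/-- The contribution of the points at distance `x` from the vertex to the number of eigenvalues in
`[0, ω²]`, with the Weyl term `ω/π` per edge subtracted; zero for `ω < 0`. -/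
def weylSubtractedCounting {N : ℕ} (σ : ℝ → ℝ → ℝ → Matrix (Fin N) (Fin N) ℝ) (ω x : ℝ) : ℝ :=
  if 0 ≤ ω then ∑ j, (projKernel σ (ω ^ 2) x x j j - ω / Real.pi) else 0

/-- The function `[-N/4 + (1/π) arctan(Nω/α)] θ(ω)`. -/
def staircase (N : ℕ) (α ω : ℝ) : ℝ :=
  (-(N : ℝ) / 4 + 1 / Real.pi * Real.arctan (N * ω / α)) * (if 0 < ω then 1 else 0)

end

/-! Averaging over the edges decouples the vertex condition. The deviations of the edge functions
from their mean vanish at the vertex and sum to zero, so they form `N - 1` copies of the Dirichlet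
half-line. The mean satisfies `k f'(0) = f(0)` with `k = N/α`. Everything reduces to `-d²/dx²` on
the half-line with `k f'(0) = f(0)`, `k ≥ 0` (`k = 0` being Dirichlet), whose generalized
eigenfunctions `e_k` are the explicit `robinEigen`.

The half-line eigenfunction expansion is built by hand. The exponentials `exp(-ax)` and their
candidate transforms have the same Gram matrix `1/(a+b)` (`gram_integral`), and both families are
total, by uniqueness of the Laplace and of the Stieltjes transform; so they are matched by a unitary
(`exists_robinTransform`). Laplace transforming `-f'' = w` shows that this unitary carries the
operator to multiplication by `s²` (`exists_isRobinRep_iff`). Reassembling mean and deviations gives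
a spectral resolution with density `(δ_jl - 1/N) e_0(x) e_0(y) + (1/N) e_k(x) e_k(y)`.

The formulas are asserted for every admissible `P` and `σ`, so uniqueness is needed. Two spectral
measures of one operator agree on compact intervals (`PVM.IsSpectralMeasureOf.proj_Icc_eq`): on the
range of `P([c-r,c+r])` powers of `A - c` grow at most like `r^n`, while a component in `Q([b,∞))`,
`b > c + r`, grows at least like `(b-c)^n`. Continuity then recovers `σ` at positive arguments from
the projections (`IsSpectralDensity.eq_of_pos`).

The rest is calculus for the Weyl-subtracted trace `weylDefect`, a combination of `cos 2ωx` and `sin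
2ωx`. Integrated over `x ≤ R` and frequencies up to `ω`, the term `-N cos` becomes a sine integral
tending to `-N/4`, the sine term leaves `(1/π) arctan(kω)`, and the remainder dies by
Riemann–Lebesgue. For a test function, two integrations by parts give decay `x^(-2)`, hence absolute
integrability; dominated convergence identifies `Δρ` with the derivative of `ΔN`, whose jump at `0`
is the `δ` term. -/

/-! ### Calculus of projection-valued measures -/

namespace PVM

variable {E : Type*} [NormedAddCommGroup E] [InnerProductSpace ℂ E] [CompleteSpace E] (P : PVM E)

theorem scalarMeasure_apply (u : E) {B : Set ℝ} (hB : MeasurableSet B) :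
    P.scalarMeasure u B = ENNReal.ofReal (‖P.proj B u‖ ^ 2) :=
  Measure.ofMeasurable_apply B hB

theorem proj_union {B C : Set ℝ} (hB : MeasurableSet B) (hC : MeasurableSet C)
    (hd : Disjoint B C) (u : E) : P.proj (B ∪ C) u = P.proj B u + P.proj C u := by
  -- Finite additivity is countable additivity for a sequence padded with empty sets.
  have h := P.iUnion' (fun n => if n = 0 then B else if n = 1 then C else ∅)
    (by
      intro n
      split_ifs
      exacts [hB, hC, MeasurableSet.empty])
    (by
      intro i j hij
      simp only [Function.onFun]
      split_ifs with h1 h2 h3 h4 h5 h6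
      · omega
      · exact hd
      · simp
      · exact hd.symm
      · omega
      all_goals simp) u
  have hU : (⋃ n : ℕ, if n = 0 then B else if n = 1 then C else ∅) = B ∪ C := by
    ext x
    simp only [mem_iUnion, mem_union]
    constructor
    · rintro ⟨n, hn⟩
      split_ifs at hn
      · exact Or.inl hn
      · exact Or.inr hn
      · exact hn.elim
    · rintro (hx | hx)
      · exact ⟨0, by simpa using hx⟩
      · exact ⟨1, by simpa using hx⟩
  rw [hU] at h
  have h2 := hasSum_sum_of_ne_finset_zero (L := SummationFilter.unconditional ℕ) (s := {0, 1})
    (f := fun n => P.proj (if n = 0 then B else if n = 1 then C else ∅) u) (by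
      intro n hn
      simp only [Finset.mem_insert, Finset.mem_singleton, not_or] at hn
      simp [hn.1, hn.2, P.proj_empty])
  refine h.unique ?_
  simpa using h2

theorem proj_idem {B : Set ℝ} (hB : MeasurableSet B) (u : E) :
    P.proj B (P.proj B u) = P.proj B u := by
  have := congrArg (fun T : E →L[ℂ] E => T u) (P.isProj B hB).isIdempotentElem.eq
  simpa using this

theorem inner_proj_left {B : Set ℝ} (hB : MeasurableSet B) (u v : E) :
    inner ℂ (P.proj B u) v = inner ℂ u (P.proj B v) :=
  ContinuousLinearMap.isSelfAdjoint_iff_isSymmetric.1 (P.isProj B hB).isSelfAdjoint u v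

/-- Since `P(B) + P(C) = P(B ∪ C)` is idempotent, `P(B)` and `P(C)` anticommute. Multiplying by
`P(B)` shows that they also commute, so `2 P(B) P(C) = 0`. -/
theorem proj_proj_of_disjoint {B C : Set ℝ} (hB : MeasurableSet B) (hC : MeasurableSet C)
    (hd : Disjoint B C) (u : E) : P.proj B (P.proj C u) = 0 := by
  have key : ∀ v, P.proj B (P.proj C v) + P.proj C (P.proj B v) = 0 := by
    intro v
    have h := P.proj_idem (hB.union hC) v
    rw [P.proj_union hB hC hd, P.proj_union hB hC hd v, map_add, map_add, P.proj_idem hB,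
      P.proj_idem hC] at h
    have h2 : P.proj B (P.proj C v) + P.proj C (P.proj B v)
      = (P.proj B v + P.proj B (P.proj C v) + (P.proj C (P.proj B v) + P.proj C v))
        - (P.proj B v + P.proj C v) := by abel
    rw [h2, h, sub_self]
  have h1 := congrArg (P.proj B) (key u)
  rw [map_add, map_zero, P.proj_idem hB] at h1
  have h2 := key (P.proj B u)
  rw [P.proj_idem hB] at h2
  have h3 := key u
  have e1 : P.proj B (P.proj C u) = - P.proj B (P.proj C (P.proj B u)) :=
    eq_neg_of_add_eq_zero_left h1
  have e2 : P.proj B (P.proj C (P.proj B u)) = - P.proj C (P.proj B u) :=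
    eq_neg_of_add_eq_zero_left h2
  have e3 : P.proj B (P.proj C u) = P.proj C (P.proj B u) := by rw [e1, e2, neg_neg]
  rw [← e3, ← two_smul ℂ] at h3
  exact (smul_eq_zero.1 h3).resolve_left two_ne_zero

theorem proj_proj {B C : Set ℝ} (hB : MeasurableSet B) (hC : MeasurableSet C) (u : E) :
    P.proj B (P.proj C u) = P.proj (B ∩ C) u := by
  have hBC := P.proj_union (hB.inter hC) (hB.diff hC) disjoint_inf_sdiff
  rw [inter_union_sdiff] at hBC
  have hCB := P.proj_union (hC.inter hB) (hC.diff hB) disjoint_inf_sdiff u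
  rw [inter_union_sdiff] at hCB
  rw [hCB, map_add, P.proj_proj_of_disjoint hB (hC.diff hB) disjoint_sdiff_right, add_zero, hBC,
    inter_comm C B, P.proj_idem (hB.inter hC),
    P.proj_proj_of_disjoint (hB.diff hC) (hB.inter hC)
      (disjoint_sdiff_left.mono_right inter_subset_right), add_zero]

theorem proj_add_compl {B : Set ℝ} (hB : MeasurableSet B) (u : E) :
    P.proj B u + P.proj Bᶜ u = u := by
  rw [← P.proj_union hB hB.compl disjoint_compl_right, union_compl_self, P.univ']
  rfl

theorem norm_sq_proj_add_compl {B : Set ℝ} (hB : MeasurableSet B) (u : E) :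
    ‖P.proj B u‖ ^ 2 + ‖P.proj Bᶜ u‖ ^ 2 = ‖u‖ ^ 2 := by
  have h0 : inner ℂ (P.proj B u) (P.proj Bᶜ u) = 0 := by
    rw [P.inner_proj_left hB, P.proj_proj_of_disjoint hB hB.compl disjoint_compl_right,
      inner_zero_right]
  have := norm_add_sq_eq_norm_sq_add_norm_sq_of_inner_eq_zero _ _ h0
  rw [P.proj_add_compl hB] at this
  nlinarith

theorem norm_proj_le {B : Set ℝ} (hB : MeasurableSet B) (u : E) : ‖P.proj B u‖ ≤ ‖u‖ := by
  have := P.norm_sq_proj_add_compl hB u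
  exact le_of_sq_le_sq (by nlinarith [sq_nonneg ‖P.proj Bᶜ u‖]) (norm_nonneg _)

theorem scalarMeasure_univ (u : E) : P.scalarMeasure u univ = ENNReal.ofReal (‖u‖ ^ 2) := by
  rw [P.scalarMeasure_apply u MeasurableSet.univ, P.univ']
  rfl

instance (u : E) : IsFiniteMeasure (P.scalarMeasure u) :=
  ⟨by rw [P.scalarMeasure_univ]; exact ENNReal.ofReal_lt_top⟩

theorem measureReal_scalarMeasure_univ (u : E) : (P.scalarMeasure u).real univ = ‖u‖ ^ 2 := by
  rw [Measure.real, P.scalarMeasure_univ, ENNReal.toReal_ofReal (by positivity)]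

theorem scalarMeasure_proj {B : Set ℝ} (hB : MeasurableSet B) (u : E) :
    P.scalarMeasure (P.proj B u) = (P.scalarMeasure u).restrict B := by
  ext C hC
  rw [P.scalarMeasure_apply _ hC, Measure.restrict_apply hC, P.scalarMeasure_apply _ (hC.inter hB),
    P.proj_proj hC hB]

/-- Continuity from below of the scalar measure gives convergence of the norms; as the projections
are nested, Pythagoras turns this into norm convergence of the vectors. -/
theorem tendsto_proj_iUnion {B : ℕ → Set ℝ} (hB : ∀ n, MeasurableSet (B n)) (hm : Monotone B)
    (u : E) : Tendsto (fun n => P.proj (B n) u) atTop (𝓝 (P.proj (⋃ n, B n) u)) := by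
  have hU := MeasurableSet.iUnion hB
  have h1 : Tendsto (fun n => P.scalarMeasure u (B n)) atTop (𝓝 (P.scalarMeasure u (⋃ n, B n))) :=
    tendsto_measure_iUnion_atTop hm
  simp only [P.scalarMeasure_apply _ (hB _), P.scalarMeasure_apply _ hU] at h1
  have h2 := (ENNReal.tendsto_toReal ENNReal.ofReal_ne_top).comp h1
  simp only [Function.comp_def, ENNReal.toReal_ofReal (sq_nonneg _)] at h2
  rw [tendsto_iff_norm_sub_tendsto_zero]
  have h3 : ∀ n, ‖P.proj (B n) u - P.proj (⋃ n, B n) u‖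
      = √(‖P.proj (⋃ n, B n) u‖ ^ 2 - ‖P.proj (B n) u‖ ^ 2) := by
    intro n
    have hs : B n ⊆ ⋃ n, B n := subset_iUnion B n
    have h4 := P.proj_proj (hB n) hU u
    rw [inter_eq_left.2 hs] at h4
    have h5 := P.norm_sq_proj_add_compl (hB n) (P.proj (⋃ n, B n) u)
    have h6 := P.proj_add_compl (hB n) (P.proj (⋃ n, B n) u)
    rw [h4] at h5 h6
    rw [← h5, add_sub_cancel_left, Real.sqrt_sq (norm_nonneg _), norm_sub_rev]
    congr 1
    rw [← h6]
    abel_nf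
    rw [h6]
  simp only [h3]
  have h7 := ((tendsto_const_nhds (x := ‖P.proj (⋃ n, B n) u‖ ^ 2)).sub h2).sqrt
  rwa [sub_self, Real.sqrt_zero] at h7

end PVM

/-! ### The operator commutes with its spectral projections -/

namespace PVM.IsSpectralMeasureOf

variable {E : Type*} [NormedAddCommGroup E] [InnerProductSpace ℂ E] [CompleteSpace E] {P : PVM E}
  {A : E →ₗ.[ℂ] E}

theorem integrable_id (h : P.IsSpectralMeasureOf A) {u : E} (hu : u ∈ A.domain) :
    Integrable (fun s : ℝ => s) (P.scalarMeasure u) := by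
  have h2 := (h.mem_domain_iff u).1 hu
  refine (h2.add (integrable_const (1 : ℝ))).mono' (by fun_prop) (ae_of_all _ fun s => ?_)
  simp only [Real.norm_eq_abs, Pi.add_apply]
  nlinarith [sq_abs s, sq_nonneg (|s| - 1), abs_nonneg s]

theorem proj_mem_domain (h : P.IsSpectralMeasureOf A) {B : Set ℝ} (hB : MeasurableSet B)
    {u : E} (hu : u ∈ A.domain) : P.proj B u ∈ A.domain := by
  rw [h.mem_domain_iff] at hu ⊢
  rw [P.scalarMeasure_proj hB]
  exact hu.restrict

theorem proj_mem_domain_of_bounded (h : P.IsSpectralMeasureOf A) {a b : ℝ} (u : E) :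
    P.proj (Icc a b) u ∈ A.domain := by
  rw [h.mem_domain_iff, P.scalarMeasure_proj measurableSet_Icc]
  exact ((continuous_pow 2).continuousOn).integrableOn_compact isCompact_Icc

theorem tendsto_proj_Icc (P : PVM E) (u : E) :
    Tendsto (fun n : ℕ => P.proj (Icc (-(n : ℝ)) n) u) atTop (𝓝 u) := by
  have h := P.tendsto_proj_iUnion (B := fun n : ℕ => Icc (-(n : ℝ)) n)
    (fun n => measurableSet_Icc) (fun m n hmn => by
      have : (m : ℝ) ≤ n := by exact_mod_cast hmn
      exact Icc_subset_Icc (by linarith) this) u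
  have hU : (⋃ n : ℕ, Icc (-(n : ℝ)) n) = univ := by
    rw [eq_univ_iff_forall]
    intro x
    obtain ⟨n, hn⟩ := exists_nat_ge |x|
    exact mem_iUnion.2 ⟨n, abs_le.1 hn⟩
  rwa [hU, P.univ'] at h

/-- The scalar measure of `x + c y` restricts to that of `x` on `B` and to that of `c y` on `Bᶜ`, so
the quadratic form is additive and its cross terms cancel. The values `c = 1` and `c = i` separate
the two cross terms. -/
theorem inner_proj_compl (h : P.IsSpectralMeasureOf A) {B : Set ℝ} (hB : MeasurableSet B)
    (x y : A.domain) (hx : P.proj B x = x) (hy : P.proj Bᶜ y = y) :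
    inner ℂ (x : E) (A y) = 0 := by
  have hx' : P.proj Bᶜ x = 0 := by
    rw [← hx]
    exact P.proj_proj_of_disjoint hB.compl hB disjoint_compl_left _
  have hy' : P.proj B y = 0 := by
    rw [← hy]
    exact P.proj_proj_of_disjoint hB hB.compl disjoint_compl_right _
  have key : ∀ c : ℂ, c * inner ℂ (x : E) (A y) + (starRingEnd ℂ) c * inner ℂ (y : E) (A x) = 0 := by
    intro c
    have hxi := h.inner_apply x
    have hyi := h.inner_apply (c • y)
    have hsum := h.inner_apply (x + c • y)
    have e1 : P.proj B ((x + c • y : A.domain) : E) = x := by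
      simp [hx, hy']
    have e2 : P.proj Bᶜ ((x + c • y : A.domain) : E) = (c • y : A.domain) := by
      simp [hx', hy]
    have m1 := P.scalarMeasure_proj hB ((x + c • y : A.domain) : E)
    have m2 := P.scalarMeasure_proj hB.compl ((x + c • y : A.domain) : E)
    rw [e1] at m1
    rw [e2] at m2
    rw [m1] at hxi
    rw [m2] at hyi
    have m3 := integral_add_compl hB (h.integrable_id (x + c • y).2)
    rw [← m3, Complex.ofReal_add, ← hxi, ← hyi] at hsum
    simp only [Submodule.coe_add, Submodule.coe_smul, inner_add_left,
      inner_add_right, inner_smul_left, inner_smul_right, LinearPMap.map_add,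
      LinearPMap.map_smul] at hsum
    linear_combination hsum
  have k1 := key 1
  have k2 := key Complex.I
  simp only [map_one, one_mul, Complex.conj_I] at k1 k2
  have : (2 * Complex.I) * inner ℂ (x : E) (A y) = 0 := by linear_combination k2 + Complex.I * k1
  exact (mul_eq_zero.1 this).resolve_left (by simp)

theorem proj_apply_proj_compl (h : P.IsSpectralMeasureOf A) {B : Set ℝ} (hB : MeasurableSet B)
    -- The vector `z = P(B) A y` need not lie in the domain, but its truncations do and converge to
    -- it; each is orthogonal to `z`, so `z` is orthogonal to itself.
    (y : A.domain) (hy : P.proj Bᶜ y = y) : P.proj B (A y) = 0 := by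
  set z := P.proj B (A y) with hz
  have h1 : ∀ n : ℕ, inner ℂ (P.proj (Icc (-(n : ℝ)) n) z) z = 0 := by
    intro n
    have hm : P.proj (Icc (-(n : ℝ)) n) z ∈ A.domain := h.proj_mem_domain_of_bounded z
    have h2 := h.inner_proj_compl hB ⟨_, h.proj_mem_domain hB hm⟩ y (P.proj_idem hB _) hy
    rw [hz, ← P.inner_proj_left hB]
    exact h2
  have h2 := ((tendsto_proj_Icc P z).inner (tendsto_const_nhds (x := z))).congr h1
  have h3 := tendsto_nhds_unique h2 tendsto_const_nhds
  exact inner_self_eq_zero.1 h3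

theorem map_proj (h : P.IsSpectralMeasureOf A) {B : Set ℝ} (hB : MeasurableSet B) (y : A.domain) :
    A ⟨P.proj B y, h.proj_mem_domain hB y.2⟩ = P.proj B (A y) := by
  have hs : y = (⟨P.proj B y, h.proj_mem_domain hB y.2⟩ : A.domain)
      + ⟨P.proj Bᶜ y, h.proj_mem_domain hB.compl y.2⟩ := by
    ext
    exact (P.proj_add_compl hB _).symm
  have h1 : P.proj B (A ⟨P.proj Bᶜ y, h.proj_mem_domain hB.compl y.2⟩) = 0 :=
    h.proj_apply_proj_compl hB _ (P.proj_idem hB.compl _)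
  have h2 : P.proj Bᶜ (A ⟨P.proj B y, h.proj_mem_domain hB y.2⟩) = 0 := by
    apply h.proj_apply_proj_compl hB.compl
    rw [compl_compl]
    exact P.proj_idem hB _
  have h3 := P.proj_add_compl hB (A ⟨P.proj B y, h.proj_mem_domain hB y.2⟩)
  rw [h2, add_zero] at h3
  conv_rhs => rw [hs, LinearPMap.map_add, map_add, h1, add_zero]
  exact h3.symm

end PVM.IsSpectralMeasureOf

/-! ### Uniqueness of the spectral measure on compact intervals -/

namespace PVM.IsSpectralMeasureOf

variable {E : Type*} [NormedAddCommGroup E] [InnerProductSpace ℂ E] [CompleteSpace E] {P Q : PVM E}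
  {A : E →ₗ.[ℂ] E}

theorem re_inner_apply_sub (h : P.IsSpectralMeasureOf A) (y : A.domain) (c : ℝ) :
    inner ℂ (y : E) (A y - (c : ℂ) • (y : E)) = ((∫ s, (s - c) ∂(P.scalarMeasure (y : E)) : ℝ) : ℂ) := by
  rw [inner_sub_right, h.inner_apply, inner_smul_right, integral_sub (h.integrable_id y.2)
    (integrable_const _), integral_const, P.measureReal_scalarMeasure_univ,
    inner_self_eq_norm_sq_to_K]
  push_cast [smul_eq_mul]
  simp only [Complex.coe_algebraMap]
  ring

/-- `(A - c) P([c-r,c+r])`. -/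
noncomputable def shiftTrunc (h : P.IsSpectralMeasureOf A) (c r : ℝ) : E →ₗ[ℂ] E :=
  A.toFun.comp ((P.proj (Icc (c - r) (c + r))).toLinearMap.codRestrict A.domain
    fun u => h.proj_mem_domain_of_bounded u) - (c : ℂ) • (P.proj (Icc (c - r) (c + r))).toLinearMap

theorem shiftTrunc_apply (h : P.IsSpectralMeasureOf A) (c r : ℝ) (u : E) :
    h.shiftTrunc c r u = A ⟨P.proj (Icc (c - r) (c + r)) u, h.proj_mem_domain_of_bounded u⟩
      - (c : ℂ) • P.proj (Icc (c - r) (c + r)) u := rfl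

theorem proj_shiftTrunc (h : P.IsSpectralMeasureOf A) (c r : ℝ) (u : E) :
    P.proj (Icc (c - r) (c + r)) (h.shiftTrunc c r u) = h.shiftTrunc c r u := by
  have h1 := h.map_proj (measurableSet_Icc (a := c - r) (b := c + r))
    ⟨P.proj (Icc (c - r) (c + r)) u, h.proj_mem_domain_of_bounded u⟩
  simp only [P.proj_idem measurableSet_Icc] at h1
  rw [shiftTrunc_apply, map_sub, map_smul, P.proj_idem measurableSet_Icc, ← h1]

theorem inner_shiftTrunc_self (h : P.IsSpectralMeasureOf A) (c r : ℝ) (u : E) :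
    inner ℂ u (h.shiftTrunc c r u)
      = ((∫ s in Icc (c - r) (c + r), (s - c) ∂(P.scalarMeasure u) : ℝ) : ℂ) := by
  rw [← h.proj_shiftTrunc, ← P.inner_proj_left measurableSet_Icc,
    ← P.scalarMeasure_proj measurableSet_Icc, shiftTrunc_apply]
  exact h.re_inner_apply_sub ⟨_, h.proj_mem_domain_of_bounded u⟩ c

theorem abs_integral_le (P : PVM E) (c r : ℝ) (hr : 0 ≤ r) (u : E) :
    |∫ s in Icc (c - r) (c + r), (s - c) ∂(P.scalarMeasure u)| ≤ r * ‖u‖ ^ 2 := by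
  have h1 := norm_setIntegral_le_of_norm_le_const (μ := P.scalarMeasure u)
    (s := Icc (c - r) (c + r)) (C := r) (f := fun s => s - c) (measure_lt_top _ _)
    (fun s hs => by
      rw [Real.norm_eq_abs, abs_le]
      constructor <;> linarith [hs.1, hs.2])
  refine h1.trans (mul_le_mul_of_nonneg_left ?_ hr)
  rw [← P.measureReal_scalarMeasure_univ]
  exact measureReal_mono (subset_univ _)

/-- The quadratic form is real, so the operator is symmetric, and its norm is then controlled by the
quadratic form through polarization and the parallelogram law. -/
theorem norm_shiftTrunc_le (h : P.IsSpectralMeasureOf A) (c r : ℝ) (hr : 0 ≤ r) (u : E) :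
    ‖h.shiftTrunc c r u‖ ≤ r * ‖u‖ := by
  set S := h.shiftTrunc c r with hS
  have hsym : S.IsSymmetric := by
    rw [LinearMap.isSymmetric_iff_inner_map_self_real]
    intro v
    rw [← inner_conj_symm, hS, h.inner_shiftTrunc_self, Complex.conj_ofReal, Complex.conj_ofReal]
  have hq : ∀ v, |(inner ℂ v (S v)).re| ≤ r * ‖v‖ ^ 2 := by
    intro v
    rw [hS, h.inner_shiftTrunc_self, Complex.ofReal_re]
    exact abs_integral_le P c r hr v
  have hpol : ∀ v w, 4 * (inner ℂ v (S w)).re ≤ 2 * r * (‖v‖ ^ 2 + ‖w‖ ^ 2) := by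
    intro v w
    have h1 := hq (v + w)
    have h2 := hq (v - w)
    have h3 : (inner ℂ w (S v)).re = (inner ℂ v (S w)).re := by
      rw [← hsym v w, ← inner_conj_symm (S v) w, Complex.conj_re]
    have h4 := parallelogram_law_with_norm ℂ v w
    simp only [map_add, map_sub, inner_add_left, inner_add_right, inner_sub_left, inner_sub_right,
      Complex.add_re, Complex.sub_re, h3] at h1 h2
    rw [abs_le] at h1 h2
    nlinarith [h1.1, h1.2, h2.1, h2.2]
  by_cases hu : ‖S u‖ = 0
  · rw [hu]; positivity
  have hu0 : ‖u‖ ≠ 0 := by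
    intro h0
    rw [norm_eq_zero.1 h0] at hu
    simp at hu
  -- This scaling gives `t • S u` and `u` the same norm, which makes the polarized estimate sharp.
  set t : ℝ := ‖u‖ / ‖S u‖
  have h1 := hpol ((t : ℂ) • S u) u
  rw [inner_smul_left, inner_self_eq_norm_sq_to_K, norm_smul] at h1
  have h2 : ((starRingEnd ℂ) (t : ℂ) * ((‖S u‖ : ℝ) : ℂ) ^ 2).re = ‖u‖ * ‖S u‖ := by
    rw [Complex.conj_ofReal, ← Complex.ofReal_pow, ← Complex.ofReal_mul, Complex.ofReal_re]
    simp only [t]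
    field_simp
  have h3 : ‖(t : ℂ)‖ * ‖S u‖ = ‖u‖ := by
    rw [Complex.norm_real, Real.norm_of_nonneg (by positivity)]
    simp only [t]
    field_simp
  rw [h3] at h1
  erw [h2] at h1
  have hpos : 0 < ‖u‖ := lt_of_le_of_ne (norm_nonneg _) (Ne.symm hu0)
  have h5 : ‖u‖ * ‖S u‖ ≤ ‖u‖ * (r * ‖u‖) := by nlinarith
  exact le_of_mul_le_mul_left h5 hpos

/-- Each application of `A - c` stretches vectors in the range of `P([c-r,c+r])` by at most `r`, but
stretches their `Q([b,∞))` component by at least `b - c > r`. After `n` applications, `(b-c)^n ‖Q x‖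
≤ r^n ‖x‖`, which forces `Q x = 0`. -/
theorem proj_Ici_proj_Icc (hP : P.IsSpectralMeasureOf A) (hQ : Q.IsSpectralMeasureOf A)
    {c r b : ℝ} (hr : 0 ≤ r) (hb : c + r < b) (u : E) :
    Q.proj (Ici b) (P.proj (Icc (c - r) (c + r)) u) = 0 := by
  set S := hP.shiftTrunc c r with hS
  -- Cauchy–Schwarz applied to `(b - c) ‖Q x‖² ≤ ⟨Q x, (A - c) Q x⟩ = ⟨Q x, Q S x⟩`.
  have step : ∀ x, P.proj (Icc (c - r) (c + r)) x = x →
      (b - c) * ‖Q.proj (Ici b) x‖ ≤ ‖Q.proj (Ici b) (S x)‖ := by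
    intro x hx
    have hxd : x ∈ A.domain := by
      rw [← hx]
      exact hP.proj_mem_domain_of_bounded x
    have hyd := hQ.proj_mem_domain (measurableSet_Ici (a := b)) hxd
    have h1 : A ⟨_, hyd⟩ - (c : ℂ) • Q.proj (Ici b) x = Q.proj (Ici b) (S x) := by
      rw [hS, shiftTrunc_apply, map_sub, map_smul, hQ.map_proj measurableSet_Ici ⟨x, hxd⟩]
      simp only [hx]
    have h2 := hQ.re_inner_apply_sub ⟨_, hyd⟩ c
    simp only [h1] at h2
    have h3 : (b - c) * ‖Q.proj (Ici b) x‖ ^ 2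
        ≤ ∫ s, (s - c) ∂(Q.scalarMeasure (Q.proj (Ici b) x)) := by
      have hi : Integrable (fun s : ℝ => s - c) (Q.scalarMeasure (Q.proj (Ici b) x)) :=
        (hQ.integrable_id hyd).sub (integrable_const _)
      have h4 : ∫ s, (b - c) ∂(Q.scalarMeasure (Q.proj (Ici b) x))
          ≤ ∫ s, (s - c) ∂(Q.scalarMeasure (Q.proj (Ici b) x)) := by
        apply integral_mono_ae (integrable_const _) hi
        rw [Q.scalarMeasure_proj measurableSet_Ici]
        filter_upwards [ae_restrict_mem measurableSet_Ici] with s hs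
        have : b ≤ s := hs
        linarith
      rwa [integral_const, Q.measureReal_scalarMeasure_univ, smul_eq_mul, mul_comm] at h4
    have h5 := norm_inner_le_norm (𝕜 := ℂ) (Q.proj (Ici b) x) (Q.proj (Ici b) (S x))
    rw [h2, Complex.norm_real] at h5
    have h6 := h3.trans ((le_abs_self _).trans h5)
    rcases eq_or_lt_of_le (norm_nonneg (Q.proj (Ici b) x)) with h7 | h7
    · rw [← h7]; simp
    · refine le_of_mul_le_mul_left ?_ h7
      linarith
  set x := P.proj (Icc (c - r) (c + r)) u with hx
  have hSn : ∀ n : ℕ, P.proj (Icc (c - r) (c + r)) ((S ^ n) x) = (S ^ n) x ∧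
      ‖(S ^ n) x‖ ≤ r ^ n * ‖x‖ ∧
      (b - c) ^ n * ‖Q.proj (Ici b) x‖ ≤ ‖Q.proj (Ici b) ((S ^ n) x)‖ := by
    intro n
    induction n with
    | zero => simpa using P.proj_idem measurableSet_Icc u
    | succ n ih =>
      rw [pow_succ', Module.End.mul_apply]
      refine ⟨hP.proj_shiftTrunc c r _, ?_, ?_⟩
      · refine (hP.norm_shiftTrunc_le c r hr _).trans ?_
        rw [pow_succ', mul_assoc]
        exact mul_le_mul_of_nonneg_left ih.2.1 hr
      · refine le_trans ?_ (step _ ih.1)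
        rw [pow_succ', mul_assoc]
        exact mul_le_mul_of_nonneg_left ih.2.2 (by linarith)
  have hbc : 0 < b - c := by linarith
  have hle : ∀ n : ℕ, ‖Q.proj (Ici b) x‖ ≤ (r / (b - c)) ^ n * ‖x‖ := by
    intro n
    obtain ⟨-, h1, h2⟩ := hSn n
    have h3 := h2.trans ((Q.norm_proj_le measurableSet_Ici _).trans h1)
    rw [div_pow, div_mul_eq_mul_div, le_div_iff₀ (by positivity)]
    linarith
  have hlim : Tendsto (fun n : ℕ => (r / (b - c)) ^ n * ‖x‖) atTop (𝓝 (0 * ‖x‖)) :=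
    (tendsto_pow_atTop_nhds_zero_of_lt_one (by positivity)
      (by rw [div_lt_one hbc]; linarith)).mul_const _
  rw [zero_mul] at hlim
  exact norm_le_zero_iff.1 (ge_of_tendsto' hlim hle)

theorem proj_Ioi_proj_Iic (hP : P.IsSpectralMeasureOf A) (hQ : Q.IsSpectralMeasureOf A)
    (a : ℝ) (u : E) : Q.proj (Ioi a) (P.proj (Iic a) u) = 0 := by
  have h1 : ∀ b, a < b → Q.proj (Ici b) (P.proj (Iic a) u) = 0 := by
    intro b hb
    have h2 := P.tendsto_proj_iUnion (B := fun n : ℕ => Icc (a - n) a)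
      (fun n => measurableSet_Icc) (fun m n hmn => by
        have : (m : ℝ) ≤ n := by exact_mod_cast hmn
        exact Icc_subset_Icc (by linarith) le_rfl) u
    have hU : (⋃ n : ℕ, Icc (a - n) a) = Iic a := by
      ext x
      simp only [mem_iUnion, mem_Icc, mem_Iic, exists_and_right, and_iff_right_iff_imp]
      intro _
      obtain ⟨n, hn⟩ := exists_nat_ge (a - x)
      exact ⟨n, by linarith⟩
    rw [hU] at h2
    have h3 := ((Q.proj (Ici b)).continuous.tendsto _).comp h2
    refine tendsto_nhds_unique (h3.congr fun n => ?_) tendsto_const_nhds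
    -- The interval `[a - n, a]` has centre `a - n/2` and radius `n/2`.
    have h4 := hP.proj_Ici_proj_Icc hQ (c := a - n / 2) (r := n / 2) (b := b) (by positivity)
      (by linarith) u
    have e1 : a - (n : ℝ) / 2 - n / 2 = a - n := by ring
    have e2 : a - (n : ℝ) / 2 + n / 2 = a := by ring
    rwa [e1, e2] at h4
  have h2 := Q.tendsto_proj_iUnion (B := fun n : ℕ => Ici (a + 1 / ((n : ℝ) + 1)))
    (fun n => measurableSet_Ici) (fun m n hmn => by
      refine Ici_subset_Ici.2 (add_le_add le_rfl ?_)
      exact one_div_le_one_div_of_le (by positivity) (by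
        have : (m : ℝ) ≤ n := by exact_mod_cast hmn
        linarith)) (P.proj (Iic a) u)
  have hU : (⋃ n : ℕ, Ici (a + 1 / ((n : ℝ) + 1))) = Ioi a := by
    ext x
    simp only [mem_iUnion, mem_Ici, mem_Ioi]
    constructor
    · rintro ⟨n, hn⟩
      have : 0 < 1 / ((n : ℝ) + 1) := by positivity
      linarith
    · intro hx
      obtain ⟨n, hn⟩ := exists_nat_one_div_lt (sub_pos.2 hx)
      exact ⟨n, by linarith⟩
  rw [hU] at h2
  refine tendsto_nhds_unique (h2.congr fun n => h1 _ ?_) tendsto_const_nhds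
  have : 0 < 1 / ((n : ℝ) + 1) := by positivity
  linarith

/-- From `Q(>a) P(≤a) = 0` follows `Q(≤a) P(≤a) = P(≤a)`. Exchanging the roles and taking adjoints
gives `Q(≤a) P(>a) = 0`, and the two relations add up to the claim. -/
theorem proj_Iic_eq (hP : P.IsSpectralMeasureOf A) (hQ : Q.IsSpectralMeasureOf A) (a : ℝ) (u : E) :
    P.proj (Iic a) u = Q.proj (Iic a) u := by
  have h1 : Q.proj (Iic a) (P.proj (Iic a) u) = P.proj (Iic a) u := by
    have := Q.proj_add_compl (measurableSet_Iic (a := a)) (P.proj (Iic a) u)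
    rwa [compl_Iic, hP.proj_Ioi_proj_Iic hQ, add_zero] at this
  have h2 : Q.proj (Iic a) (P.proj (Ioi a) u) = 0 := by
    refine ext_inner_left ℂ fun v => ?_
    rw [← Q.inner_proj_left measurableSet_Iic, ← P.inner_proj_left measurableSet_Ioi,
      hQ.proj_Ioi_proj_Iic hP, inner_zero_left, inner_zero_right]
  have h3 := congrArg (Q.proj (Iic a)) (P.proj_add_compl (measurableSet_Iic (a := a)) u)
  rw [map_add, compl_Iic, h1, h2, add_zero] at h3
  exact h3

/-- The spectral measure of an operator is unique on compact intervals. -/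
theorem proj_Icc_eq (hP : P.IsSpectralMeasureOf A) (hQ : Q.IsSpectralMeasureOf A) {a b : ℝ}
    (hab : a ≤ b) : P.proj (Icc a b) = Q.proj (Icc a b) := by
  ext u
  have hU : (⋃ n : ℕ, Iic (a - 1 / ((n : ℝ) + 1))) = Iio a := by
    ext x
    simp only [mem_iUnion, mem_Iic, mem_Iio]
    constructor
    · rintro ⟨n, hn⟩
      have : 0 < 1 / ((n : ℝ) + 1) := by positivity
      linarith
    · intro hx
      obtain ⟨n, hn⟩ := exists_nat_one_div_lt (sub_pos.2 hx)
      exact ⟨n, by linarith⟩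
  have hmono : Monotone fun n : ℕ => Iic (a - 1 / ((n : ℝ) + 1)) := fun m n hmn => by
    refine Iic_subset_Iic.2 (sub_le_sub le_rfl ?_)
    exact one_div_le_one_div_of_le (by positivity) (by
      have : (m : ℝ) ≤ n := by exact_mod_cast hmn
      linarith)
  have hIio : P.proj (Iio a) u = Q.proj (Iio a) u := by
    have h1 := P.tendsto_proj_iUnion (fun n => measurableSet_Iic) hmono u
    have h2 := Q.tendsto_proj_iUnion (fun n => measurableSet_Iic) hmono u
    rw [hU] at h1 h2
    exact tendsto_nhds_unique (h1.congr fun n => hP.proj_Iic_eq hQ _ u) h2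
  have hsplit : ∀ R : PVM E, R.proj (Iic b) u = R.proj (Iio a) u + R.proj (Icc a b) u := by
    intro R
    rw [← R.proj_union measurableSet_Iio measurableSet_Icc, Iio_union_Icc_eq_Iic hab]
    rw [Set.disjoint_left]
    intro x hx hx'
    exact absurd hx'.1 (not_le.2 hx)
  have h1 := hsplit P
  rw [hP.proj_Iic_eq hQ, hIio, hsplit Q] at h1
  exact (add_left_cancel h1).symm

end PVM.IsSpectralMeasureOf

/-! ## Totality of exponentials and of Stieltjes kernels -/

theorem denseRange_linearCombination_of_orthogonal {ι F : Type*}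
    [NormedAddCommGroup F] [InnerProductSpace ℂ F] [CompleteSpace F]
    (z : ι → F) (hz : ∀ f : F, (∀ i, inner ℂ (z i) f = 0) → f = 0) :
    DenseRange (Finsupp.linearCombination ℂ z) := by
  have h1 : (Submodule.span ℂ (range z)).topologicalClosure = ⊤ := by
    rw [Submodule.topologicalClosure_eq_top_iff, Submodule.eq_bot_iff]
    intro f hf
    refine hz f fun i => ?_
    exact (Submodule.mem_orthogonal _ _).1 hf _ (Submodule.subset_span (mem_range_self i))
  rw [← Finsupp.range_linearCombination, ← Submodule.dense_iff_topologicalClosure_eq_top] at h1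
  exact h1

/-- Equal Gram matrices make corresponding linear combinations equal in norm; totality on both sides
lets this correspondence extend to a unitary. -/
theorem exists_linearIsometryEquiv_of_inner_eq {ι H K : Type*}
    [NormedAddCommGroup H] [InnerProductSpace ℂ H] [CompleteSpace H]
    [NormedAddCommGroup K] [InnerProductSpace ℂ K] [CompleteSpace K]
    (v : ι → H) (w : ι → K) (hvw : ∀ i j, inner ℂ (v i) (v j) = inner ℂ (w i) (w j))
    (hv : ∀ f : H, (∀ i, inner ℂ (v i) f = 0) → f = 0)
    (hw : ∀ f : K, (∀ i, inner ℂ (w i) f = 0) → f = 0) :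
    ∃ U : H ≃ₗᵢ[ℂ] K, ∀ i, U (v i) = w i := by
  have dense := denseRange_linearCombination_of_orthogonal v hv
  have dense' := denseRange_linearCombination_of_orthogonal w hw
  have hnorm : ∀ c : ι →₀ ℂ, ‖Finsupp.linearCombination ℂ w (LinearEquiv.refl ℂ _ c)‖
      = ‖Finsupp.linearCombination ℂ v c‖ := by
    intro c
    have : inner ℂ (Finsupp.linearCombination ℂ w c) (Finsupp.linearCombination ℂ w c)
        = inner ℂ (Finsupp.linearCombination ℂ v c) (Finsupp.linearCombination ℂ v c) := by
      simp only [Finsupp.linearCombination_apply, Finsupp.sum, sum_inner, inner_sum,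
        inner_smul_left, inner_smul_right, hvw]
    rw [inner_self_eq_norm_sq_to_K, inner_self_eq_norm_sq_to_K] at this
    have h2 : ‖Finsupp.linearCombination ℂ w c‖ ^ 2 = ‖Finsupp.linearCombination ℂ v c‖ ^ 2 := by
      exact_mod_cast this
    exact (sq_eq_sq₀ (norm_nonneg _) (norm_nonneg _)).1 h2
  refine ⟨(LinearEquiv.refl ℂ (ι →₀ ℂ)).extendOfIsometry _ _ dense dense' hnorm,
    fun i => ?_⟩
  have := LinearEquiv.extendOfIsometry_eq (LinearEquiv.refl ℂ (ι →₀ ℂ))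
    (Finsupp.linearCombination ℂ v) (Finsupp.linearCombination ℂ w) dense dense' hnorm
    (Finsupp.single i 1)
  simpa using this

/-- A function on `(0,∞)` all of whose moments in a bounded coordinate vanish is zero. -/
theorem ae_eq_zero_of_moments {G : ℝ → ℂ} (hG : IntegrableOn G (Ioi 0)) {T : ℝ} {t s : ℝ → ℝ}
    (ht : ∀ x, 0 < x → t x ∈ Ioo 0 T)
    (hst : ∀ x, 0 < x → s (t x) = x) (hts : ∀ y ∈ Ioo 0 T, t (s y) = y)
    (htc : ContinuousOn t (Ioi 0)) (hsc : ContinuousOn s (Ioo 0 T))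
    (h : ∀ n : ℕ, ∫ x in Ioi (0 : ℝ), ((t x) ^ n : ℝ) * G x = 0) :
    ∀ᵐ x ∂(volume.restrict (Ioi (0 : ℝ))), G x = 0 := by
  have hmul : ∀ f : ℝ → ℝ, Continuous f →
      IntegrableOn (fun x => (f (t x) : ℂ) * G x) (Ioi 0) := by
    intro f hf
    obtain ⟨C, hC⟩ := (isCompact_Icc (a := (0 : ℝ)) (b := T)).exists_bound_of_continuousOn
      hf.continuousOn
    refine Integrable.bdd_mul (c := C) hG ?_ ?_
    · exact (Complex.continuous_ofReal.comp_continuousOn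
        (hf.comp_continuousOn htc)).aestronglyMeasurable measurableSet_Ioi
    · filter_upwards [ae_restrict_mem measurableSet_Ioi] with x hx
      rw [Complex.norm_real]
      exact hC _ (Ioo_subset_Icc_self (ht x hx))
  have hpoly : ∀ p : Polynomial ℝ, ∫ x in Ioi (0 : ℝ), ((p.eval (t x) : ℝ) : ℂ) * G x = 0 := by
    intro p
    induction p using Polynomial.induction_on' with
    | add p q hp hq =>
      simp only [Polynomial.eval_add, Complex.ofReal_add, add_mul]
      rw [integral_add (hmul _ p.continuous) (hmul _ q.continuous), hp, hq, add_zero]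
    | monomial n c =>
      simp only [Polynomial.eval_monomial, Complex.ofReal_mul, mul_assoc]
      rw [integral_const_mul, h n, mul_zero]
  -- Weierstrass approximation on `[0, T]` passes from polynomials in `t` to continuous functions of
  -- `t`.
  have hcont : ∀ f : ℝ → ℝ, Continuous f → ∫ x in Ioi (0 : ℝ), (f (t x) : ℂ) * G x = 0 := by
    intro f hf
    rw [← norm_le_zero_iff]
    refine le_of_forall_pos_le_add fun ε hε => ?_
    set M := ∫ x in Ioi (0 : ℝ), ‖G x‖
    have hM : 0 ≤ M := integral_nonneg fun _ => norm_nonneg _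
    obtain ⟨p, hp⟩ := exists_polynomial_near_of_continuousOn 0 T f hf.continuousOn
      (ε / (M + 1)) (by positivity)
    have h1 : ∫ x in Ioi (0 : ℝ), (f (t x) : ℂ) * G x
        = ∫ x in Ioi (0 : ℝ), ((f (t x) - p.eval (t x) : ℝ) : ℂ) * G x := by
      simp only [Complex.ofReal_sub, sub_mul]
      rw [integral_sub (hmul _ hf) (hmul _ p.continuous), hpoly, sub_zero]
    rw [h1, zero_add]
    calc ‖∫ x in Ioi (0 : ℝ), ((f (t x) - p.eval (t x) : ℝ) : ℂ) * G x‖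
        ≤ ∫ x in Ioi (0 : ℝ), (ε / (M + 1)) * ‖G x‖ := by
          refine norm_integral_le_of_norm_le (hG.norm.const_mul _) ?_
          filter_upwards [ae_restrict_mem measurableSet_Ioi] with x hx
          rw [norm_mul, Complex.norm_real, Real.norm_eq_abs, abs_sub_comm]
          exact mul_le_mul_of_nonneg_right (hp _ (Ioo_subset_Icc_self (ht x hx))).le
            (norm_nonneg _)
      _ = ε / (M + 1) * M := by rw [integral_const_mul]
      _ ≤ ε := by
          rw [div_mul_eq_mul_div, div_le_iff₀ (by positivity)]
          nlinarith
  have key := isOpen_Ioi.ae_eq_zero_of_integral_contDiff_smul_eq_zero (f := G)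
    (μ := volume) (U := Ioi (0 : ℝ)) hG.locallyIntegrableOn (by
      intro g hg _ hgU
      have hgc := hg.continuous
      -- The test function is rewritten in the coordinate `t`. The image of its compact support is a
      -- compact subset of `(0, T)`, so extension by zero stays continuous.
      set f : ℝ → ℝ := (Ioo 0 T).indicator (g ∘ s) with hf
      have hK : IsCompact (t '' tsupport g) :=
        (‹HasCompactSupport g›).isCompact.image_of_continuousOn (htc.mono hgU)
      have hfc : Continuous f := by
        rw [continuous_iff_continuousAt]
        intro y
        by_cases hy : y ∈ Ioo 0 T
        · have h1 : ContinuousAt (g ∘ s) y :=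
            hgc.continuousAt.comp (hsc.continuousAt (isOpen_Ioo.mem_nhds hy))
          refine h1.congr ?_
          filter_upwards [isOpen_Ioo.mem_nhds hy] with z hz
          rw [hf, indicator_of_mem hz]
        · have hy' : y ∉ t '' tsupport g := by
            rintro ⟨x, hx, rfl⟩
            exact hy (ht x (hgU hx))
          refine (continuousAt_const (y := (0 : ℝ))).congr ?_
          filter_upwards [hK.isClosed.isOpen_compl.mem_nhds hy'] with z hz
          by_cases hzI : z ∈ Ioo 0 T
          · rw [hf, indicator_of_mem hzI]
            by_contra hne
            exact hz ⟨s z, subset_tsupport g (Ne.symm hne), hts z hzI⟩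
          · rw [hf, indicator_of_notMem hzI]
      rw [← hcont f hfc, ← integral_indicator measurableSet_Ioi]
      congr 1
      ext x
      by_cases hx : x ∈ Ioi (0 : ℝ)
      · rw [indicator_of_mem hx, hf, indicator_of_mem (ht x hx), Function.comp, hst x hx,
          Complex.real_smul]
      · rw [indicator_of_notMem hx]
        have : g x = 0 := by
          by_contra hne
          exact hx (hgU (subset_tsupport g hne))
        rw [this, zero_smul])
  rwa [ae_restrict_iff' measurableSet_Ioi]

/-- Uniqueness for the Laplace transform. -/
theorem ae_eq_zero_of_laplace {F : ℝ → ℂ} {a₀ : ℝ}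
    (hF : ∀ a, a₀ < a → IntegrableOn (fun x => (Real.exp (-(a * x)) : ℂ) * F x) (Ioi 0))
    (h : ∀ a, a₀ < a → ∫ x in Ioi (0 : ℝ), (Real.exp (-(a * x)) : ℂ) * F x = 0) :
    ∀ᵐ x ∂(volume.restrict (Ioi (0 : ℝ))), F x = 0 := by
  -- In the coordinate `exp(-x)`, the moments of `exp(-(a₀+1)x) F` are the Laplace transforms of `F`
  -- at `a₀ + 1 + n`.
  have h1 := ae_eq_zero_of_moments (hF (a₀ + 1) (by linarith)) (T := 1)
    (t := fun x => Real.exp (-x)) (s := fun y => -Real.log y)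
    (fun x hx => ⟨Real.exp_pos _, by rw [Real.exp_lt_one_iff]; linarith⟩)
    (fun x _ => by rw [Real.log_exp, neg_neg])
    (fun y hy => by rw [neg_neg, Real.exp_log hy.1])
    (by fun_prop)
    (fun y hy => (Real.continuousAt_log hy.1.ne').neg.continuousWithinAt)
    (fun n => by
      have hn : (0 : ℝ) ≤ n := n.cast_nonneg
      rw [← h (a₀ + 1 + n) (by linarith)]
      congr 1
      ext x
      rw [← mul_assoc, ← Complex.ofReal_mul, ← Real.exp_nat_mul, ← Real.exp_add]
      congr 3
      ring)
  filter_upwards [h1] with x hx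
  refine (mul_eq_zero.1 hx).resolve_left ?_
  exact_mod_cast (Real.exp_pos _).ne'

/-- Uniqueness for the Stieltjes transform. -/
theorem ae_eq_zero_of_stieltjes {F : ℝ → ℂ} {c₀ : ℝ} (hc₀ : 1 ≤ c₀)
    (hm : AEStronglyMeasurable F (volume.restrict (Ioi (0 : ℝ))))
    (hF : IntegrableOn (fun x => (((1 + x ^ 2)⁻¹ : ℝ) : ℂ) * F x) (Ioi 0))
    (h : ∀ c, c₀ < c → ∫ x in Ioi (0 : ℝ), (((c + x ^ 2)⁻¹ : ℝ) : ℂ) * F x = 0) :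
    ∀ᵐ x ∂(volume.restrict (Ioi (0 : ℝ))), F x = 0 := by
  have hpos : ∀ c x : ℝ, c₀ < c → 0 < c + x ^ 2 := fun c x hc => by
    nlinarith [sq_nonneg x]
  have hmeas : ∀ (c : ℝ) (n : ℕ), AEStronglyMeasurable
      (fun x => ((((c + x ^ 2)⁻¹) ^ (n + 1) : ℝ) : ℂ) * F x) (volume.restrict (Ioi (0 : ℝ))) := by
    intro c n
    refine AEStronglyMeasurable.mul ?_ hm
    exact (by fun_prop : Measurable fun x : ℝ => ((((c + x ^ 2)⁻¹) ^ (n + 1) : ℝ) : ℂ)).aestronglyMeasurable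
  have hbd : ∀ (c : ℝ) (n : ℕ) (x : ℝ), c₀ < c →
      ‖((((c + x ^ 2)⁻¹) ^ (n + 1) : ℝ) : ℂ) * F x‖ ≤ ‖(((1 + x ^ 2)⁻¹ : ℝ) : ℂ) * F x‖ := by
    intro c n x hc
    have h1 := hpos c x hc
    have h3 : (c + x ^ 2)⁻¹ ≤ (1 + x ^ 2)⁻¹ := inv_anti₀ (by positivity) (by linarith)
    have h4 : (c + x ^ 2)⁻¹ ≤ 1 := inv_le_one_of_one_le₀ (by nlinarith [sq_nonneg x])
    rw [norm_mul, norm_mul, Complex.norm_real, Complex.norm_real, Real.norm_of_nonneg (by positivity),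
      Real.norm_of_nonneg (by positivity)]
    refine mul_le_mul_of_nonneg_right ?_ (norm_nonneg _)
    rw [pow_succ]
    exact (mul_le_of_le_one_left (by positivity) (pow_le_one₀ (by positivity) h4)).trans h3
  have hint : ∀ (c : ℝ) (n : ℕ), c₀ < c →
      IntegrableOn (fun x => ((((c + x ^ 2)⁻¹) ^ (n + 1) : ℝ) : ℂ) * F x) (Ioi 0) :=
    fun c n hc => hF.norm.mono' (hmeas c n) (ae_of_all _ fun x => hbd c n x hc)
  -- Differentiation in `c` raises the power of the kernel, so all integrals against `(c +
  -- x²)^(-(n+1))` vanish; these are moments in the coordinate `(c + x²)⁻¹`.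
  have hpow : ∀ (n : ℕ) (c : ℝ), c₀ < c →
      ∫ x in Ioi (0 : ℝ), ((((c + x ^ 2)⁻¹) ^ (n + 1) : ℝ) : ℂ) * F x = 0 := by
    intro n
    induction n with
    | zero => simpa using h
    | succ n ih =>
      intro c hc
      have hd := (hasDerivAt_integral_of_dominated_loc_of_deriv_le (μ := volume.restrict (Ioi (0 : ℝ)))
        (F := fun c x => ((((c + x ^ 2)⁻¹) ^ (n + 1) : ℝ) : ℂ) * F x)
        (F' := fun c x => -((n + 1 : ℝ) : ℂ) * (((((c + x ^ 2)⁻¹) ^ (n + 1 + 1) : ℝ) : ℂ) * F x))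
        (bound := fun x => (n + 1 : ℝ) * ‖(((1 + x ^ 2)⁻¹ : ℝ) : ℂ) * F x‖)
        (x₀ := c) (s := Ioi c₀) (Ioi_mem_nhds hc) (Eventually.of_forall fun c => hmeas c n)
        (hint c n hc) ((hmeas c (n + 1)).const_mul _)
        (ae_of_all _ fun x c hc => by
          rw [norm_mul, norm_neg, Complex.norm_real, Real.norm_of_nonneg (by positivity)]
          exact mul_le_mul_of_nonneg_left (hbd c (n + 1) x hc) (by positivity))
        (hF.norm.const_mul _)
        (ae_of_all _ fun x c hc => by
          have h1 := (hpos c x hc).ne'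
          have h2 : HasDerivAt (fun c : ℝ => ((c + x ^ 2)⁻¹) ^ (n + 1))
              (-(n + 1) * ((c + x ^ 2)⁻¹) ^ (n + 1 + 1)) c := by
            refine ((((hasDerivAt_id c).add_const (x ^ 2)).inv h1).pow (n + 1)).congr_deriv ?_
            simp only [id, Nat.add_sub_cancel, Pi.inv_apply]
            rw [pow_succ _ (n + 1), pow_succ _ n]
            push_cast
            field_simp
          have h3 := (h2.ofReal_comp).mul_const (F x)
          refine h3.congr_deriv ?_
          push_cast
          ring)).2
      have h0 : HasDerivAt (fun c => ∫ x in Ioi (0 : ℝ), ((((c + x ^ 2)⁻¹) ^ (n + 1) : ℝ) : ℂ) * F x)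
          0 c := by
        refine (hasDerivAt_const c (0 : ℂ)).congr_of_eventuallyEq ?_
        filter_upwards [Ioi_mem_nhds hc] with c' hc'
        exact ih c' hc'
      have h1 := hd.unique h0
      rw [integral_const_mul] at h1
      refine (mul_eq_zero.1 h1).resolve_left ?_
      exact neg_ne_zero.2 (Complex.ofReal_ne_zero.2 (by positivity))
  set c := c₀ + 1 with hc
  have hcc : c₀ < c := by linarith
  have h0 : 0 < c := by linarith
  have h1 := ae_eq_zero_of_moments (T := c⁻¹) (t := fun x => (c + x ^ 2)⁻¹)
    (s := fun y => √(y⁻¹ - c)) (hint c 0 hcc)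
    (fun x hx => ⟨by positivity, inv_strictAnti₀ h0 (by
      have : 0 < x ^ 2 := by positivity
      linarith)⟩)
    (fun x hx => by
      rw [inv_inv, add_sub_cancel_left]
      exact Real.sqrt_sq hx.le)
    (fun y hy => by
      have := (lt_inv_comm₀ hy.1 h0).1 hy.2
      rw [Real.sq_sqrt (by linarith), add_sub_cancel, inv_inv])
    (fun x _ => by
      have : c + x ^ 2 ≠ 0 := by positivity
      fun_prop (disch := assumption))
    (fun y hy => by
      have : y ≠ 0 := hy.1.ne'
      fun_prop (disch := assumption))
    (fun n => by
      rw [← hpow n c hcc]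
      congr 1
      ext x
      rw [← mul_assoc, ← Complex.ofReal_mul]
      congr 3
      ring)
  filter_upwards [h1] with x hx
  refine (mul_eq_zero.1 hx).resolve_left ?_
  have : (c + x ^ 2)⁻¹ ≠ 0 := by positivity
  exact_mod_cast (pow_ne_zero _ this)

/-! ## The Gram matrix -/

theorem tendsto_mul_arctan_mul (k : ℝ) (hk : 0 ≤ k) :
    Tendsto (fun w : ℝ => k * Real.arctan (k * w)) atTop (𝓝 (k * (Real.pi / 2))) := by
  rcases hk.eq_or_lt with rfl | hk
  · simp
  · refine Tendsto.const_mul _ ?_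
    exact (tendsto_nhds_of_tendsto_nhdsWithin Real.tendsto_arctan_atTop).comp
      (tendsto_id.const_mul_atTop hk)

theorem tendsto_arctan_div (a : ℝ) (ha : 0 < a) :
    Tendsto (fun w : ℝ => Real.arctan (w / a)) atTop (𝓝 (Real.pi / 2)) :=
  (tendsto_nhds_of_tendsto_nhdsWithin Real.tendsto_arctan_atTop).comp
    (tendsto_id.atTop_div_const ha)

theorem hasDerivAt_arctan_div {a : ℝ} (ha : 0 < a) (w : ℝ) :
    HasDerivAt (fun w : ℝ => Real.arctan (w / a)) (a / (a ^ 2 + w ^ 2)) w := by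
  refine (((hasDerivAt_id w).div_const a).arctan).congr_deriv ?_
  simp only [id]
  field_simp

theorem hasDerivAt_arctan_mul (k : ℝ) (w : ℝ) :
    HasDerivAt (fun w : ℝ => Real.arctan (k * w)) (k / (1 + k ^ 2 * w ^ 2)) w := by
  refine (((hasDerivAt_id w).const_mul k).arctan).congr_deriv ?_
  simp only [id, mul_one]
  field_simp

/-- Partial fractions in `w²` give an explicit primitive made of arctangents, with a rational term
when `a = b`. The conditions `k a ≠ 1` and `k b ≠ 1` keep the factor `1 + k² w²` from sharing a root
with the other two. -/
theorem gram_integral {k a b : ℝ} (hk : 0 ≤ k) (ha : 0 < a) (hb : 0 < b) (hka : k * a ≠ 1)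
    (hkb : k * b ≠ 1) :
    IntegrableOn (fun w : ℝ => w ^ 2 / ((a ^ 2 + w ^ 2) * (b ^ 2 + w ^ 2) * (1 + k ^ 2 * w ^ 2)))
      (Ioi 0) ∧
    ∫ w in Ioi (0 : ℝ), w ^ 2 / ((a ^ 2 + w ^ 2) * (b ^ 2 + w ^ 2) * (1 + k ^ 2 * w ^ 2))
      = Real.pi / (2 * (a + b) * (1 + k * a) * (1 + k * b)) := by
  have hka' : 1 - k ^ 2 * a ^ 2 ≠ 0 := by
    have h1 : 0 < 1 + k * a := by positivity
    have : 1 - k ^ 2 * a ^ 2 = (1 - k * a) * (1 + k * a) := by ring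
    rw [this]
    exact mul_ne_zero (sub_ne_zero.2 hka.symm) h1.ne'
  have hkb' : 1 - k ^ 2 * b ^ 2 ≠ 0 := by
    have h1 : 0 < 1 + k * b := by positivity
    have : 1 - k ^ 2 * b ^ 2 = (1 - k * b) * (1 + k * b) := by ring
    rw [this]
    exact mul_ne_zero (sub_ne_zero.2 hkb.symm) h1.ne'
  suffices H : ∃ f : ℝ → ℝ, (∀ w, HasDerivAt f
      (w ^ 2 / ((a ^ 2 + w ^ 2) * (b ^ 2 + w ^ 2) * (1 + k ^ 2 * w ^ 2))) w) ∧ f 0 = 0 ∧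
      Tendsto f atTop (𝓝 (Real.pi / (2 * (a + b) * (1 + k * a) * (1 + k * b)))) by
    obtain ⟨f, hf, hf0, hlim⟩ := H
    have hi := integrableOn_Ioi_deriv_of_nonneg' (a := 0) (fun w _ => hf w)
      (fun w _ => by positivity) hlim
    refine ⟨hi, ?_⟩
    rw [integral_Ioi_of_hasDerivAt_of_tendsto' (fun w _ => hf w) hi hlim, hf0, sub_zero]
  -- The denominators are made atoms, so that clearing fractions leaves a polynomial identity into
  -- which their values are substituted.
  obtain ⟨D, hD⟩ : ∃ D, D = 1 - k ^ 2 * a ^ 2 := ⟨_, rfl⟩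
  obtain ⟨D', hD'⟩ : ∃ D, D = 1 - k ^ 2 * b ^ 2 := ⟨_, rfl⟩
  rw [← hD] at hka'
  rw [← hD'] at hkb'
  by_cases hab : a = b
  · subst hab
    refine ⟨fun w => 1 / (a * (D) ^ 2) * Real.arctan (w / a)
      - 1 / (D) * (w / (2 * (a ^ 2 + w ^ 2)) + 1 / (2 * a) * Real.arctan (w / a))
      - 1 / (D) ^ 2 * (k * Real.arctan (k * w)), ?_, ?_, ?_⟩
    · intro w
      have hd : HasDerivAt (fun w : ℝ => w / (2 * (a ^ 2 + w ^ 2)))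
          ((2 * (a ^ 2 + w ^ 2) - w * (2 * (2 * w))) / (2 * (a ^ 2 + w ^ 2)) ^ 2) w := by
        have := (hasDerivAt_id w).div ((((hasDerivAt_id w).pow 2).const_add (a ^ 2)).const_mul 2)
          (by simp only [id, Pi.pow_apply]; positivity)
        refine this.congr_deriv ?_
        simp
      refine ((((hasDerivAt_arctan_div ha w).const_mul _).sub
        ((hd.add ((hasDerivAt_arctan_div ha w).const_mul _)).const_mul _)).sub
        (((hasDerivAt_arctan_mul k w).const_mul k).const_mul _)).congr_deriv ?_
      have h1 : a ^ 2 + w ^ 2 ≠ 0 := by positivity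
      have h2 : 1 + k ^ 2 * w ^ 2 ≠ 0 := by positivity
      field_simp
      rw [hD]
      ring
    · simp
    · have hw : Tendsto (fun w : ℝ => w / (2 * (a ^ 2 + w ^ 2))) atTop (𝓝 0) := by
        have h1 : Tendsto (fun w : ℝ => w⁻¹) atTop (𝓝 0) := tendsto_inv_atTop_zero
        refine squeeze_zero' ?_ ?_ h1
        · filter_upwards [eventually_gt_atTop 0] with w hw
          positivity
        · filter_upwards [eventually_gt_atTop 0] with w hw
          rw [div_le_iff₀ (by positivity), inv_mul_eq_div, le_div_iff₀ hw]
          nlinarith [sq_nonneg a, sq_nonneg w]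
      have h3 := (((tendsto_arctan_div a ha).const_mul (1 / (a * (D) ^ 2))).sub
        ((hw.add ((tendsto_arctan_div a ha).const_mul (1 / (2 * a)))).const_mul
          (1 / (D)))).sub
        ((tendsto_mul_arctan_mul k hk).const_mul (1 / (D) ^ 2))
      convert h3 using 2
      have h1 : 1 + k * a ≠ 0 := by positivity
      field_simp
      rw [hD]
      ring
  · have hab' : b ^ 2 - a ^ 2 ≠ 0 := by
      have h1 : b ^ 2 - a ^ 2 = (b - a) * (a + b) := by ring
      rw [h1]
      exact mul_ne_zero (sub_ne_zero.2 (Ne.symm hab)) (by positivity)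
    obtain ⟨M, hM⟩ : ∃ M, M = b ^ 2 - a ^ 2 := ⟨_, rfl⟩
    rw [← hM] at hab'
    refine ⟨fun w => -(a / (M * (D))) * Real.arctan (w / a)
      + b / (M * (D')) * Real.arctan (w / b)
      - 1 / ((D) * (D')) * (k * Real.arctan (k * w)), ?_, ?_, ?_⟩
    · intro w
      refine ((((hasDerivAt_arctan_div ha w).const_mul _).add
        ((hasDerivAt_arctan_div hb w).const_mul _)).sub
        (((hasDerivAt_arctan_mul k w).const_mul k).const_mul _)).congr_deriv ?_
      have h1 : a ^ 2 + w ^ 2 ≠ 0 := by positivity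
      have h3 : b ^ 2 + w ^ 2 ≠ 0 := by positivity
      have h2 : 1 + k ^ 2 * w ^ 2 ≠ 0 := by positivity
      field_simp
      rw [hD, hD', hM]
      ring
    · simp
    · have h3 := (((tendsto_arctan_div a ha).const_mul
        (-(a / (M * (D))))).add
        ((tendsto_arctan_div b hb).const_mul (b / (M * (D'))))).sub
        ((tendsto_mul_arctan_mul k hk).const_mul (1 / ((D) * (D'))))
      convert h3 using 2
      have h1 : 1 + k * a ≠ 0 := by positivity
      have h2 : 1 + k * b ≠ 0 := by positivity
      field_simp
      rw [hD, hD', hM]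
      ring

/-! ## The half-line transform -/

/-- The Hilbert space `L²(0,∞)`. -/
abbrev HalfL2 : Type := Lp ℂ 2 (volume.restrict (Ioi (0 : ℝ)))

theorem memLp_two_ofReal_of_sq {f : ℝ → ℝ} (hm : Measurable f)
    (hf : IntegrableOn (fun x => f x ^ 2) (Ioi 0)) :
    MemLp (fun x => (f x : ℂ)) 2 (volume.restrict (Ioi (0 : ℝ))) := by
  rw [memLp_two_iff_integrable_sq_norm
    (by fun_prop : Measurable fun x => (f x : ℂ)).aestronglyMeasurable]
  simp only [Complex.norm_real, Real.norm_eq_abs, sq_abs]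
  exact hf

theorem inner_toLp_ofReal {f : ℝ → ℝ}
    (hf : MemLp (fun x => (f x : ℂ)) 2 (volume.restrict (Ioi (0 : ℝ)))) (g : HalfL2) :
    inner ℂ (hf.toLp _) g = ∫ x in Ioi (0 : ℝ), (f x : ℂ) * g x := by
  rw [L2.inner_def]
  refine integral_congr_ae ?_
  filter_upwards [hf.coeFn_toLp] with x hx
  rw [hx, RCLike.inner_apply, Complex.conj_ofReal, mul_comm]

theorem integrable_ofReal_mul {f : ℝ → ℝ}
    (hf : MemLp (fun x => (f x : ℂ)) 2 (volume.restrict (Ioi (0 : ℝ)))) (g : HalfL2) :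
    IntegrableOn (fun x => (f x : ℂ) * g x) (Ioi 0) :=
  MemLp.integrable_mul hf (Lp.memLp g)

theorem integrableOn_exp_neg_mul {a : ℝ} (ha : 0 < a) :
    IntegrableOn (fun x : ℝ => Real.exp (-(a * x))) (Ioi 0) := by
  simpa only [neg_mul] using integrableOn_exp_mul_Ioi (neg_lt_zero.2 ha) 0

theorem integral_exp_neg_mul_Ioi {a : ℝ} (ha : 0 < a) (c : ℝ) :
    ∫ x in Ioi c, Real.exp (-(a * x)) = Real.exp (-(a * c)) / a := by
  have := integral_exp_mul_Ioi (neg_lt_zero.2 ha) c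
  simp only [neg_mul, neg_div_neg_eq] at this
  exact this

theorem memLp_exp {a : ℝ} (ha : 0 < a) :
    MemLp (fun x : ℝ => (Real.exp (-(a * x)) : ℂ)) 2 (volume.restrict (Ioi (0 : ℝ))) := by
  refine memLp_two_ofReal_of_sq (by fun_prop) ?_
  refine (integrableOn_exp_neg_mul (a := 2 * a) (by positivity)).congr_fun (fun x _ => ?_)
    measurableSet_Ioi
  simp only
  rw [← Real.exp_nat_mul]
  congr 1
  push_cast
  ring

/-- The generalized eigenfunctions of `-d²/dx²` on the half-line with `k f'(0) = f(0)`. -/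
noncomputable def robinEigen (k w x : ℝ) : ℝ :=
  √(2 / Real.pi) * ((k * w * Real.cos (w * x) + Real.sin (w * x)) / √(1 + k ^ 2 * w ^ 2))

theorem continuous_robinEigen (k : ℝ) : Continuous fun p : ℝ × ℝ => robinEigen k p.1 p.2 := by
  unfold robinEigen
  have : ∀ p : ℝ × ℝ, √(1 + k ^ 2 * p.1 ^ 2) ≠ 0 := fun p => by positivity
  fun_prop (disch := assumption)

theorem abs_robinEigen_le (k w x : ℝ) :
    |robinEigen k w x| ≤ √(2 / Real.pi) * 2 := by
  unfold robinEigen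
  have hs : 0 < √(1 + k ^ 2 * w ^ 2) := by positivity
  rw [abs_mul, abs_of_nonneg (Real.sqrt_nonneg _)]
  refine mul_le_mul_of_nonneg_left ?_ (Real.sqrt_nonneg _)
  rw [abs_div, abs_of_pos hs, div_le_iff₀ hs]
  have h1 : |k * w| ≤ √(1 + k ^ 2 * w ^ 2) := Real.abs_le_sqrt (by nlinarith)
  have h2 : 1 ≤ √(1 + k ^ 2 * w ^ 2) := Real.one_le_sqrt.2 (by nlinarith [sq_nonneg (k * w)])
  calc |k * w * Real.cos (w * x) + Real.sin (w * x)|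
      ≤ |k * w| * |Real.cos (w * x)| + |Real.sin (w * x)| := by
        rw [← abs_mul]
        exact abs_add_le _ _
    _ ≤ |k * w| * 1 + 1 := by
        gcongr
        · exact Real.abs_cos_le_one _
        · exact Real.abs_sin_le_one _
    _ ≤ 2 * √(1 + k ^ 2 * w ^ 2) := by linarith

/-- The transform of `exp (-a x)`. -/
noncomputable def expTransform (k a w : ℝ) : ℝ :=
  √(2 / Real.pi) * (w * (1 + k * a) / ((a ^ 2 + w ^ 2) * √(1 + k ^ 2 * w ^ 2)))

theorem integral_exp_mul_cos_add_sin {a : ℝ} (ha : 0 < a) (w A B : ℝ) :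
    ∫ x in Ioi (0 : ℝ), Real.exp (-(a * x)) * (A * Real.cos (w * x) + B * Real.sin (w * x))
      = (A * a + B * w) / (a ^ 2 + w ^ 2) := by
  have haw : a ^ 2 + w ^ 2 ≠ 0 := by positivity
  have hbound : ∀ C D x : ℝ, ‖C * Real.cos (w * x) + D * Real.sin (w * x)‖ ≤ |C| * 1 + |D| * 1 := by
    intro C D x
    refine (abs_add_le _ _).trans ?_
    rw [abs_mul, abs_mul]
    gcongr
    · exact Real.abs_cos_le_one _
    · exact Real.abs_sin_le_one _
  set f : ℝ → ℝ := fun x => Real.exp (-(a * x)) *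
    (-(a * A + w * B) / (a ^ 2 + w ^ 2) * Real.cos (w * x)
      + (w * A - a * B) / (a ^ 2 + w ^ 2) * Real.sin (w * x)) with hf
  have hd : ∀ x ∈ Ici (0 : ℝ), HasDerivAt f (Real.exp (-(a * x)) *
      (A * Real.cos (w * x) + B * Real.sin (w * x))) x := by
    intro x _
    have h1 : HasDerivAt (fun x => Real.exp (-(a * x))) (Real.exp (-(a * x)) * (-(a * 1))) x :=
      (((hasDerivAt_id x).const_mul a).neg).exp
    have h2 : HasDerivAt (fun x => Real.cos (w * x)) (-Real.sin (w * x) * (w * 1)) x :=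
      ((hasDerivAt_id x).const_mul w).cos
    have h3 : HasDerivAt (fun x => Real.sin (w * x)) (Real.cos (w * x) * (w * 1)) x :=
      ((hasDerivAt_id x).const_mul w).sin
    refine (h1.mul ((h2.const_mul _).add (h3.const_mul _))).congr_deriv ?_
    rw [Pi.add_apply]
    field_simp
    ring
  have hlim : Tendsto f atTop (𝓝 0) := by
    have h1 : Tendsto (fun x : ℝ => Real.exp (-(a * x))) atTop (𝓝 0) :=
      Real.tendsto_exp_neg_atTop_nhds_zero.comp (tendsto_id.const_mul_atTop ha)
    exact h1.zero_mul_isBoundedUnder_le (isBoundedUnder_of ⟨_, fun x => hbound _ _ x⟩)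
  have hi : IntegrableOn (fun x => Real.exp (-(a * x)) *
      (A * Real.cos (w * x) + B * Real.sin (w * x))) (Ioi 0) :=
    Integrable.mul_bdd (integrableOn_exp_neg_mul ha)
      (by fun_prop : Continuous fun x : ℝ =>
        A * Real.cos (w * x) + B * Real.sin (w * x)).aestronglyMeasurable
      (ae_of_all _ fun x => hbound _ _ x)
  rw [integral_Ioi_of_hasDerivAt_of_tendsto' hd hi hlim, hf]
  simp only [mul_zero, neg_zero, Real.exp_zero, Real.cos_zero, Real.sin_zero]
  field_simp
  ring

theorem integral_exp_mul_robinEigen (k : ℝ) {a : ℝ} (ha : 0 < a) (w : ℝ) :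
    ∫ x in Ioi (0 : ℝ), Real.exp (-(a * x)) * robinEigen k w x = expTransform k a w := by
  have h1 : ∀ x, Real.exp (-(a * x)) * robinEigen k w x = √(2 / Real.pi) / √(1 + k ^ 2 * w ^ 2) *
      (Real.exp (-(a * x)) * (k * w * Real.cos (w * x) + 1 * Real.sin (w * x))) := by
    intro x
    rw [robinEigen]
    ring
  simp only [h1]
  rw [integral_const_mul, integral_exp_mul_cos_add_sin ha, expTransform]
  simp only [div_eq_mul_inv, mul_inv]
  ring

theorem measurable_expTransform (k a : ℝ) : Measurable (expTransform k a) := by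
  unfold expTransform
  fun_prop

theorem expTransform_mul (k a b w : ℝ) :
    expTransform k a w * expTransform k b w = (2 / Real.pi) * ((1 + k * a) * (1 + k * b)) *
      (w ^ 2 / ((a ^ 2 + w ^ 2) * (b ^ 2 + w ^ 2) * (1 + k ^ 2 * w ^ 2))) := by
  have hs : √(1 + k ^ 2 * w ^ 2) ≠ 0 := by positivity
  have h1 : √(1 + k ^ 2 * w ^ 2) ^ 2 = 1 + k ^ 2 * w ^ 2 := Real.sq_sqrt (by positivity)
  have h2 : √(2 / Real.pi) ^ 2 = 2 / Real.pi := Real.sq_sqrt (by positivity)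
  calc expTransform k a w * expTransform k b w
      = √(2 / Real.pi) ^ 2 * ((1 + k * a) * (1 + k * b)) *
      (w ^ 2 / ((a ^ 2 + w ^ 2) * (b ^ 2 + w ^ 2) * √(1 + k ^ 2 * w ^ 2) ^ 2)) := by
        unfold expTransform
        simp only [div_eq_mul_inv, mul_inv]
        ring
    _ = _ := by rw [h1, h2]

theorem memLp_expTransform {k a : ℝ} (hk : 0 ≤ k) (ha : 0 < a) (hka : k * a ≠ 1) :
    MemLp (fun w => (expTransform k a w : ℂ)) 2 (volume.restrict (Ioi (0 : ℝ))) := by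
  refine memLp_two_ofReal_of_sq (measurable_expTransform k a) ?_
  simp only [sq (expTransform _ _ _), expTransform_mul]
  exact (gram_integral hk ha ha hka hka).1.const_mul _

/-- The right side is also the integral of `exp(-(a+b)x)`, so the exponentials and their transforms
have the same Gram matrix, whatever `k ≥ 0` is. -/
theorem integral_expTransform_mul {k a b : ℝ} (hk : 0 ≤ k) (ha : 0 < a) (hb : 0 < b)
    (hka : k * a ≠ 1) (hkb : k * b ≠ 1) :
    ∫ w in Ioi (0 : ℝ), expTransform k a w * expTransform k b w = 1 / (a + b) := by
  simp only [expTransform_mul]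
  rw [integral_const_mul, (gram_integral hk ha hb hka hkb).2]
  have h1 : 1 + k * a ≠ 0 := by positivity
  have h2 : 1 + k * b ≠ 0 := by positivity
  have h3 : a + b ≠ 0 := by positivity
  field_simp

theorem pos_of_lt {k a : ℝ} (hk : 0 ≤ k) (ha : 1 + k⁻¹ < a) : 1 < a := by
  have : 0 ≤ k⁻¹ := inv_nonneg.2 hk
  linarith

/-- The threshold `1 + k⁻¹` keeps `a` beyond the excluded value `1/k`. For `k = 0` the convention
`0⁻¹ = 0` makes it `1`, and `0 ≠ 1` settles the claim. -/
theorem mul_ne_one_of_lt {k a : ℝ} (hk : 0 ≤ k) (ha : 1 + k⁻¹ < a) : k * a ≠ 1 := by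
  rcases hk.eq_or_lt with rfl | hk
  · simp
  · have h1 := mul_lt_mul_of_pos_left ha hk
    rw [mul_add, mul_inv_cancel₀ hk.ne'] at h1
    exact (by linarith : 1 < k * a).ne'

/-- `w / ((1 + w²) √(1 + k² w²))` times an `L²` function: the integrability used for transforms. -/
theorem memLp_div_one_add_sq : MemLp (fun w : ℝ => ((w / (1 + w ^ 2) : ℝ) : ℂ)) 2
    (volume.restrict (Ioi (0 : ℝ))) := by
  refine memLp_two_ofReal_of_sq (by fun_prop) ?_
  refine (integrable_inv_one_add_sq.integrableOn).mono'
    (by fun_prop : Measurable fun w : ℝ => (w / (1 + w ^ 2)) ^ 2).aestronglyMeasurable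
    (ae_of_all _ fun w => ?_)
  rw [Real.norm_of_nonneg (by positivity), div_pow, div_le_iff₀ (by positivity), sq (1 + w ^ 2),
    ← mul_assoc, inv_mul_cancel₀ (by positivity)]
  linarith

/-- With `c = a²` this is a Stieltjes transform of `F` times the weight `w / √(1 + k² w²)`, which
vanishes nowhere on `w > 0`. -/
theorem ae_eq_zero_of_expTransform {k c₀ : ℝ} (hc : 1 ≤ c₀) {F : ℝ → ℂ}
    (hm : AEStronglyMeasurable F (volume.restrict (Ioi (0 : ℝ))))
    (hF : IntegrableOn (fun w => ((w / (1 + w ^ 2) : ℝ) : ℂ) * F w) (Ioi 0))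
    (h : ∀ a, c₀ < a → ∫ w in Ioi (0 : ℝ),
      ((w / ((a ^ 2 + w ^ 2) * √(1 + k ^ 2 * w ^ 2)) : ℝ) : ℂ) * F w = 0) :
    ∀ᵐ w ∂(volume.restrict (Ioi (0 : ℝ))), F w = 0 := by
  have h1 := ae_eq_zero_of_stieltjes (F := fun w => ((w / √(1 + k ^ 2 * w ^ 2) : ℝ) : ℂ) * F w)
    (c₀ := c₀ ^ 2) (by nlinarith)
    (((by fun_prop : Measurable fun w : ℝ => ((w / √(1 + k ^ 2 * w ^ 2) : ℝ) : ℂ)).aestronglyMeasurable).mul hm)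
    (by
      refine hF.norm.mono' ?_ (ae_of_all _ fun w => ?_)
      · refine ((by fun_prop : Measurable fun w : ℝ => (((1 + w ^ 2)⁻¹ : ℝ) : ℂ)).aestronglyMeasurable).mul ?_
        exact ((by fun_prop : Measurable fun w : ℝ => ((w / √(1 + k ^ 2 * w ^ 2) : ℝ) : ℂ)).aestronglyMeasurable).mul hm
      · rw [← mul_assoc, ← Complex.ofReal_mul, norm_mul, norm_mul, Complex.norm_real,
          Complex.norm_real]
        refine mul_le_mul_of_nonneg_right ?_ (norm_nonneg _)
        have hs : 1 ≤ √(1 + k ^ 2 * w ^ 2) :=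
          Real.one_le_sqrt.2 (by nlinarith [sq_nonneg (k * w)])
        rw [norm_mul, norm_div, norm_div, norm_inv, inv_mul_eq_div]
        gcongr
        refine div_le_self (norm_nonneg _) ?_
        rwa [Real.norm_of_nonneg (Real.sqrt_nonneg _)])
    (by
      intro c hc'
      have h0 : 0 ≤ c := by nlinarith [sq_nonneg c₀]
      rw [← h (√c) (Real.lt_sqrt_of_sq_lt hc')]
      congr 1
      ext w
      rw [← mul_assoc, ← Complex.ofReal_mul, Real.sq_sqrt h0]
      congr 2
      simp only [div_eq_mul_inv, mul_inv]
      ring)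
  filter_upwards [h1, ae_restrict_mem measurableSet_Ioi] with w hw hw0
  refine (mul_eq_zero.1 hw).resolve_left ?_
  have : w / √(1 + k ^ 2 * w ^ 2) ≠ 0 := by
    have : 0 < w := hw0
    positivity
  exact_mod_cast this

/-- Equality of the Gram matrices gives the isometry. Totality of the exponentials (Laplace) defines
it everywhere, and totality of their transforms (Stieltjes) makes it onto. -/
theorem exists_robinTransform {k : ℝ} (hk : 0 ≤ k) : ∃ U : HalfL2 ≃ₗᵢ[ℂ] HalfL2,
    ∀ (a : ℝ) (ha : 0 < a) (hka : k * a ≠ 1), 1 + k⁻¹ < a →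
      U ((memLp_exp ha).toLp _) = (memLp_expTransform hk ha hka).toLp _ := by
  have hk' : 0 ≤ k⁻¹ := inv_nonneg.2 hk
  have hpos : ∀ a : {a : ℝ // 1 + k⁻¹ < a}, 0 < a.1 := fun a => by linarith [pos_of_lt hk a.2]
  obtain ⟨U, hU⟩ := exists_linearIsometryEquiv_of_inner_eq (ι := {a : ℝ // 1 + k⁻¹ < a})
    (H := HalfL2) (K := HalfL2)
    (fun a => (memLp_exp (hpos a)).toLp _)
    (fun a => (memLp_expTransform hk (hpos a) (mul_ne_one_of_lt hk a.2)).toLp _)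
    (by
      intro a b
      rw [inner_toLp_ofReal (memLp_exp (hpos a)), inner_toLp_ofReal]
      have e1 : ∫ x in Ioi (0 : ℝ), (Real.exp (-(a.1 * x)) : ℂ)
          * (memLp_exp (hpos b)).toLp _ x = ((1 / (a.1 + b.1) : ℝ) : ℂ) := by
        have h3 := integral_exp_neg_mul_Ioi (add_pos (hpos a) (hpos b)) 0
        rw [mul_zero, neg_zero, Real.exp_zero] at h3
        rw [← h3, ← integral_complex_ofReal]
        refine integral_congr_ae ?_
        filter_upwards [(memLp_exp (hpos b)).coeFn_toLp] with x hx
        rw [hx, ← Complex.ofReal_mul, ← Real.exp_add]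
        congr 2
        ring
      rw [e1, ← integral_expTransform_mul hk (hpos a) (hpos b) (mul_ne_one_of_lt hk a.2)
        (mul_ne_one_of_lt hk b.2), ← integral_complex_ofReal]
      refine integral_congr_ae ?_
      filter_upwards [(memLp_expTransform hk (hpos b) (mul_ne_one_of_lt hk b.2)).coeFn_toLp]
        with x hx
      rw [hx, Complex.ofReal_mul])
    (by
      intro f hf
      rw [Lp.eq_zero_iff_ae_eq_zero]
      refine ae_eq_zero_of_laplace (a₀ := 1 + k⁻¹)
        (fun a ha => integrable_ofReal_mul (memLp_exp (hpos ⟨a, ha⟩)) f) fun a ha => ?_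
      rw [← hf ⟨a, ha⟩, inner_toLp_ofReal (memLp_exp (hpos ⟨a, ha⟩))])
    (by
      intro f hf
      rw [Lp.eq_zero_iff_ae_eq_zero]
      refine ae_eq_zero_of_expTransform (k := k) (c₀ := 1 + k⁻¹) (by linarith)
        (Lp.aestronglyMeasurable f) (integrable_ofReal_mul memLp_div_one_add_sq f) fun a ha => ?_
      have h1 := hf ⟨a, ha⟩
      rw [inner_toLp_ofReal] at h1
      have hne : ((√(2 / Real.pi) * (1 + k * a) : ℝ) : ℂ) ≠ 0 := by
        have := hpos ⟨a, ha⟩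
        simp only at this
        have : √(2 / Real.pi) * (1 + k * a) ≠ 0 := by positivity
        exact_mod_cast this
      refine (mul_eq_zero.1 (?_ : ((√(2 / Real.pi) * (1 + k * a) : ℝ) : ℂ) * _ = 0)).resolve_left hne
      rw [← h1, ← integral_const_mul]
      congr 1
      ext w
      rw [← mul_assoc, ← Complex.ofReal_mul, expTransform]
      congr 2
      simp only [div_eq_mul_inv]
      ring)
  exact ⟨U, fun a ha hka h => hU ⟨a, h⟩⟩

/-- The unitary transform diagonalizing `-d²/dx²` on the half-line with `k f'(0) = f(0)`. -/
noncomputable def robinTransform {k : ℝ} (hk : 0 ≤ k) : HalfL2 ≃ₗᵢ[ℂ] HalfL2 :=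
  Classical.choose (exists_robinTransform hk)

/-- Apart from unitarity, this is the only property of the chosen transform that is used later. -/
theorem integral_exp_mul_eq {k : ℝ} (hk : 0 ≤ k) {a : ℝ} (h : 1 + k⁻¹ < a) (u : HalfL2) :
    ∫ x in Ioi (0 : ℝ), (Real.exp (-(a * x)) : ℂ) * u x
      = ∫ w in Ioi (0 : ℝ), (expTransform k a w : ℂ) * robinTransform hk u w := by
  have ha : 0 < a := by linarith [pos_of_lt hk h]
  rw [← inner_toLp_ofReal (memLp_exp ha), ← inner_toLp_ofReal (memLp_expTransform hk ha
    (mul_ne_one_of_lt hk h)), ← Classical.choose_spec (exists_robinTransform hk) a ha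
    (mul_ne_one_of_lt hk h) h]
  exact ((robinTransform hk).inner_map_map _ _).symm

/-- The inverse transform of an integrable function. -/
theorem robinTransform_symm_ae_eq {k : ℝ} (hk : 0 ≤ k) (h : HalfL2)
    (hi : IntegrableOn h (Ioi 0)) :
    (robinTransform hk).symm h =ᵐ[volume.restrict (Ioi (0 : ℝ))]
      fun x => ∫ w in Ioi (0 : ℝ), (robinEigen k w x : ℂ) * h w := by
  -- The eigenfunctions are bounded and `h` is integrable, so Fubini applies; both candidates for
  -- the inverse transform then have the same Laplace transform.
  have hprod : ∀ a, 1 + k⁻¹ < a → Integrable (fun p : ℝ × ℝ =>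
      (Real.exp (-(a * p.1)) : ℂ) * ((robinEigen k p.2 p.1 : ℂ) * h p.2))
      ((volume.restrict (Ioi (0 : ℝ))).prod (volume.restrict (Ioi (0 : ℝ)))) := by
    intro a ha
    have ha0 : 0 < a := by linarith [pos_of_lt hk ha]
    have h1 := (integrableOn_exp_neg_mul ha0).ofReal (𝕜 := ℂ) |>.mul_prod hi
    have h2 := h1.bdd_mul (c := √(2 / Real.pi) * 2)
      (f := fun p : ℝ × ℝ => (robinEigen k p.2 p.1 : ℂ))
      ((Complex.continuous_ofReal.comp ((continuous_robinEigen k).comp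
        continuous_swap)).aestronglyMeasurable)
      (ae_of_all _ fun p => by
        rw [Complex.norm_real]
        exact abs_robinEigen_le k _ _)
    refine h2.congr (ae_of_all _ fun p => ?_)
    simp only [RCLike.ofReal_eq_complex_ofReal]
    ring
  have hsub : ∀ a, 1 + k⁻¹ < a → IntegrableOn (fun x => (Real.exp (-(a * x)) : ℂ) *
      ∫ w in Ioi (0 : ℝ), (robinEigen k w x : ℂ) * h w) (Ioi 0) ∧
      ∫ x in Ioi (0 : ℝ), (Real.exp (-(a * x)) : ℂ) *
        ∫ w in Ioi (0 : ℝ), (robinEigen k w x : ℂ) * h w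
      = ∫ w in Ioi (0 : ℝ), (expTransform k a w : ℂ) * h w := by
    intro a ha
    have ha0 : 0 < a := by linarith [pos_of_lt hk ha]
    have h1 := (hprod a ha).integral_prod_left
    have h2 := integral_integral_swap (f := fun x w => (Real.exp (-(a * x)) : ℂ) *
      ((robinEigen k w x : ℂ) * h w)) (hprod a ha)
    simp only [integral_const_mul] at h1 h2
    refine ⟨h1, h2.trans ?_⟩
    refine integral_congr_ae (ae_of_all _ fun w => ?_)
    simp only [← mul_assoc]
    rw [integral_mul_const, ← integral_exp_mul_robinEigen k ha0, ← integral_complex_ofReal]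
    simp only [Complex.ofReal_mul]
  have key := ae_eq_zero_of_laplace (a₀ := 1 + k⁻¹)
    (F := fun x => (robinTransform hk).symm h x - ∫ w in Ioi (0 : ℝ), (robinEigen k w x : ℂ) * h w)
    (by
      intro a ha
      simp only [mul_sub]
      exact (integrable_ofReal_mul (memLp_exp (by linarith [pos_of_lt hk ha])) _).sub
        (hsub a ha).1)
    (by
      intro a ha
      simp only [mul_sub]
      rw [integral_sub (integrable_ofReal_mul (memLp_exp (by linarith [pos_of_lt hk ha])) _)
        (hsub a ha).1, (hsub a ha).2, integral_exp_mul_eq hk ha, LinearIsometryEquiv.apply_symm_apply,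
        sub_self])
  filter_upwards [key] with x hx
  exact sub_eq_zero.1 hx

/-! ## The half-line operator -/

/-- The Laplace transform of a primitive. -/
theorem laplace_primitive {a : ℝ} (ha : 0 < a) {p q : ℝ → ℂ} {c : ℂ}
    (hp : IntegrableOn (fun x => (Real.exp (-(a * x)) : ℂ) * p x) (Ioi 0))
    (hq : ∀ x, 0 ≤ x → q x = c + ∫ s in (0 : ℝ)..x, p s) :
    IntegrableOn (fun x => (Real.exp (-(a * x)) : ℂ) * q x) (Ioi 0) ∧
    a * ∫ x in Ioi (0 : ℝ), (Real.exp (-(a * x)) : ℂ) * q x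
      = c + ∫ x in Ioi (0 : ℝ), (Real.exp (-(a * x)) : ℂ) * p x := by
  have hexp : ∀ s : ℝ, ((Real.exp (-(a * s)) : ℝ) : ℂ) ≠ 0 := fun s => by
    exact_mod_cast (Real.exp_pos _).ne'
  have ha' : (a : ℂ) ≠ 0 := by exact_mod_cast ha.ne'
  have hpm : AEStronglyMeasurable p (volume.restrict (Ioi (0 : ℝ))) := by
    have h1 : AEStronglyMeasurable (fun x : ℝ => (Real.exp (a * x) : ℂ))
        (volume.restrict (Ioi (0 : ℝ))) := by
      exact (by fun_prop : Continuous fun x : ℝ => (Real.exp (a * x) : ℂ)).aestronglyMeasurable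
    refine (h1.mul hp.aestronglyMeasurable).congr (ae_of_all _ fun x => ?_)
    simp only [Pi.mul_apply]
    rw [← mul_assoc, ← Complex.ofReal_mul, ← Real.exp_add]
    simp
  -- The integrand `exp(-ax) p(s)` on the region `s ≤ x`: integrating in `s` first gives the
  -- primitive, and integrating in `x` first gives `exp(-as) p(s) / a`.
  set Φ : ℝ → ℝ → ℂ := fun s x => (Ici s).indicator (fun x => (Real.exp (-(a * x)) : ℂ)) x * p s
    with hΦ
  have hin : ∀ s : ℝ, IntegrableOn (fun x : ℝ => Real.exp (-(a * x))) (Ioi s) := fun s => by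
    simpa only [neg_mul] using integrableOn_exp_mul_Ioi (neg_lt_zero.2 ha) s
  have hindr : ∀ s x : ℝ, (Ici s).indicator (fun x => (Real.exp (-(a * x)) : ℂ)) x
      = (((Ici s).indicator (fun x => Real.exp (-(a * x))) x : ℝ) : ℂ) := by
    intro s x
    by_cases hx : x ∈ Ici s
    · rw [indicator_of_mem hx, indicator_of_mem hx]
    · rw [indicator_of_notMem hx, indicator_of_notMem hx, Complex.ofReal_zero]
  have hint : ∀ s : ℝ, 0 < s → ∫ x in Ioi (0 : ℝ), (Ici s).indicator
      (fun x => Real.exp (-(a * x))) x = Real.exp (-(a * s)) / a := by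
    intro s hs
    rw [setIntegral_indicator measurableSet_Ici, inter_eq_right.2 (Ici_subset_Ioi.2 hs),
      integral_Ici_eq_integral_Ioi, integral_exp_neg_mul_Ioi ha]
  have hmeas : AEStronglyMeasurable (fun z : ℝ × ℝ => Φ z.1 z.2)
      ((volume.restrict (Ioi (0 : ℝ))).prod (volume.restrict (Ioi (0 : ℝ)))) := by
    refine AEStronglyMeasurable.mul ?_ hpm.comp_fst
    have h1 : (fun z : ℝ × ℝ => (Ici z.1).indicator (fun x : ℝ => (Real.exp (-(a * x)) : ℂ)) z.2)
        = {z : ℝ × ℝ | z.1 ≤ z.2}.indicator fun z => (Real.exp (-(a * z.2)) : ℂ) := by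
      ext z
      simp only [indicator, mem_Ici, mem_ofPred_eq]
    rw [h1]
    refine Measurable.aestronglyMeasurable ?_
    exact (by fun_prop : Measurable fun z : ℝ × ℝ => (Real.exp (-(a * z.2)) : ℂ)).indicator
      (measurableSet_le measurable_fst measurable_snd)
  have hprod : Integrable (fun z : ℝ × ℝ => Φ z.1 z.2)
      ((volume.restrict (Ioi (0 : ℝ))).prod (volume.restrict (Ioi (0 : ℝ)))) := by
    rw [integrable_prod_iff hmeas]
    constructor
    · filter_upwards [ae_restrict_mem measurableSet_Ioi] with s hs
      refine Integrable.mul_const ?_ _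
      exact ((integrableOn_exp_neg_mul ha).ofReal (𝕜 := ℂ)).indicator measurableSet_Ici
    · refine (hp.norm.div_const a).congr ?_
      filter_upwards [ae_restrict_mem measurableSet_Ioi] with s hs
      have h1 : ∀ x, ‖Φ s x‖ = (Ici s).indicator (fun x => Real.exp (-(a * x))) x * ‖p s‖ := by
        intro x
        rw [hΦ]
        simp only
        rw [norm_mul, hindr, Complex.norm_real, Real.norm_of_nonneg]
        exact indicator_nonneg (fun _ _ => (Real.exp_pos _).le) _
      simp only [h1]
      rw [integral_mul_const, hint s hs, norm_mul, Complex.norm_real,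
        Real.norm_of_nonneg (Real.exp_pos _).le]
      ring
  have hx : ∀ x, 0 < x → ∫ s in Ioi (0 : ℝ), Φ s x
      = (Real.exp (-(a * x)) : ℂ) * ∫ s in (0 : ℝ)..x, p s := by
    intro x hx
    have h1 : (fun s => Φ s x) = (Iic x).indicator fun s => (Real.exp (-(a * x)) : ℂ) * p s := by
      ext s
      simp only [hΦ, indicator, mem_Ici, mem_Iic]
      split_ifs <;> simp
    rw [h1, setIntegral_indicator measurableSet_Iic, Ioi_inter_Iic, integral_const_mul,
      intervalIntegral.integral_of_le hx.le]
  have hs : ∀ s, 0 < s → ∫ x in Ioi (0 : ℝ), Φ s x = (Real.exp (-(a * s)) : ℂ) * p s / a := by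
    intro s hs
    simp only [hΦ, hindr]
    rw [integral_mul_const, integral_complex_ofReal, hint s hs]
    push_cast
    ring
  have hi1 : IntegrableOn (fun x => (Real.exp (-(a * x)) : ℂ) * ∫ s in (0 : ℝ)..x, p s) (Ioi 0) := by
    refine hprod.integral_prod_right.congr ?_
    filter_upwards [ae_restrict_mem measurableSet_Ioi] with x hx'
    exact hx x hx'
  have hswap := integral_integral_swap (f := Φ) hprod
  rw [setIntegral_congr_fun measurableSet_Ioi (fun s hs' => hs s hs'),
    setIntegral_congr_fun measurableSet_Ioi (fun x hx' => hx x hx'), integral_div] at hswap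
  have hc : IntegrableOn (fun x => (Real.exp (-(a * x)) : ℂ) * c) (Ioi 0) :=
    ((integrableOn_exp_neg_mul ha).ofReal (𝕜 := ℂ)).mul_const c
  have hqe : EqOn (fun x => (Real.exp (-(a * x)) : ℂ) * q x)
      (fun x => (Real.exp (-(a * x)) : ℂ) * c
        + (Real.exp (-(a * x)) : ℂ) * ∫ s in (0 : ℝ)..x, p s) (Ioi 0) := by
    intro x hx'
    simp only
    rw [hq x (le_of_lt hx'), mul_add]
  refine ⟨(hc.add hi1).congr_fun hqe.symm measurableSet_Ioi, ?_⟩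
  rw [setIntegral_congr_fun measurableSet_Ioi hqe, integral_add hc hi1, ← hswap,
    integral_mul_const, integral_complex_ofReal, integral_exp_neg_mul_Ioi ha]
  simp only [mul_zero, neg_zero, Real.exp_zero]
  push_cast
  field_simp

/-- `f` is a regular representative of `u`, with `-f'' = w`. -/
structure IsHalfRep (u w : HalfL2) (f f' : ℝ → ℂ) : Prop where
  ae_eq : u =ᵐ[volume.restrict (Ioi (0 : ℝ))] f
  continuousOn : ContinuousOn f' (Ici 0)
  deriv_fst : ∀ x, 0 ≤ x → f x = f 0 + ∫ s in (0 : ℝ)..x, f' s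
  deriv_snd : ∀ x, 0 ≤ x → f' x = f' 0 - ∫ s in (0 : ℝ)..x, w s

/-- `f` is a regular representative of `u`, showing that `u` lies in the domain of
`-d²/dx²` on the half-line with `k f'(0) = f(0)`, with image `w`. -/
structure IsRobinRep (k : ℝ) (u w : HalfL2) (f f' : ℝ → ℂ) : Prop extends
    IsHalfRep u w f f' where
  boundary : k * f' 0 = f 0

theorem laplace_second {a : ℝ} (ha : 0 < a) {w : HalfL2} {f f' : ℝ → ℂ}
    (h1 : ∀ x, 0 ≤ x → f x = f 0 + ∫ s in (0 : ℝ)..x, f' s)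
    (h2 : ∀ x, 0 ≤ x → f' x = f' 0 - ∫ s in (0 : ℝ)..x, w s) :
    IntegrableOn (fun x => (Real.exp (-(a * x)) : ℂ) * f x) (Ioi 0) ∧
    a ^ 2 * ∫ x in Ioi (0 : ℝ), (Real.exp (-(a * x)) : ℂ) * f x
      = f' 0 + a * f 0 - ∫ x in Ioi (0 : ℝ), (Real.exp (-(a * x)) : ℂ) * w x := by
  have hw := (integrable_ofReal_mul (memLp_exp ha) w).neg
  have h3 := laplace_primitive ha (p := fun x => - w x) (q := f') (c := f' 0)
    (hw.congr (ae_of_all _ fun x => by simp)) (fun x hx => by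
      rw [h2 x hx, intervalIntegral.integral_neg, sub_eq_add_neg])
  have h4 := laplace_primitive ha h3.1 h1
  refine ⟨h4.1, ?_⟩
  have h5 := h3.2
  simp only [mul_neg, integral_neg] at h5
  linear_combination (a : ℂ) * h4.2 + h5

theorem halfL2_intervalIntegrable (w : HalfL2) {a b : ℝ} (ha : 0 ≤ a) (hb : 0 ≤ b) :
    IntervalIntegrable w volume a b := by
  rw [intervalIntegrable_iff]
  have hs : uIoc a b ⊆ Ioi 0 := by
    intro x hx
    rw [uIoc, mem_Ioc] at hx
    exact lt_of_le_of_lt (le_min ha hb) hx.1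
  have h2 : MemLp w 2 (volume.restrict (uIoc a b)) :=
    (Lp.memLp w).mono_measure (Measure.restrict_mono hs le_rfl)
  have : IsFiniteMeasure (volume.restrict (uIoc a b)) := ⟨by simp [uIoc]⟩
  exact h2.integrable (by norm_num)

theorem continuousOn_primitive_halfL2 (w : HalfL2) :
    ContinuousOn (fun x => ∫ s in (0 : ℝ)..x, w s) (Ici 0) := by
  intro x hx
  have hx0 : 0 ≤ x := hx
  have h1 : ContinuousOn (fun x => ∫ s in (0 : ℝ)..x, w s) (uIcc 0 (x + 1)) :=
    intervalIntegral.continuousOn_primitive_interval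
      (by
        have := halfL2_intervalIntegrable w le_rfl (add_nonneg hx0 zero_le_one)
        rwa [intervalIntegrable_iff'] at this)
  rw [uIcc_of_le (by linarith)] at h1
  refine (h1 x ⟨hx0, by linarith⟩).mono_of_mem_nhdsWithin ?_
  rw [← Ici_inter_Iic]
  exact inter_mem_nhdsWithin _ (Iic_mem_nhds (by linarith))

theorem expTransform_eq (k a w : ℝ) : expTransform k a w
    = √(2 / Real.pi) * (1 + k * a) * (w / ((a ^ 2 + w ^ 2) * √(1 + k ^ 2 * w ^ 2))) := by
  rw [expTransform]
  simp only [div_eq_mul_inv]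
  ring

theorem integrable_resolvent_mul (k : ℝ) {a : ℝ} (ha : 1 < a) (g : HalfL2) :
    IntegrableOn (fun w => ((w / ((a ^ 2 + w ^ 2) * √(1 + k ^ 2 * w ^ 2)) : ℝ) : ℂ) * g w)
      (Ioi 0) := by
  refine (integrable_ofReal_mul memLp_div_one_add_sq g).norm.mono'
    ((by fun_prop : Measurable fun w : ℝ =>
      ((w / ((a ^ 2 + w ^ 2) * √(1 + k ^ 2 * w ^ 2)) : ℝ) : ℂ)).aestronglyMeasurable.mul
      (Lp.aestronglyMeasurable g)) (ae_of_all _ fun w => ?_)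
  rw [norm_mul, norm_mul, Complex.norm_real, Complex.norm_real]
  refine mul_le_mul_of_nonneg_right ?_ (norm_nonneg _)
  rw [norm_div, norm_div]
  refine div_le_div_of_nonneg_left (norm_nonneg _) (norm_pos_iff.2 (by positivity)) ?_
  rw [Real.norm_of_nonneg (by positivity), Real.norm_of_nonneg (by positivity)]
  have hs : 1 ≤ √(1 + k ^ 2 * w ^ 2) := Real.one_le_sqrt.2 (by nlinarith [sq_nonneg (k * w)])
  have h1 : 1 + w ^ 2 ≤ a ^ 2 + w ^ 2 := by nlinarith
  calc 1 + w ^ 2 ≤ (a ^ 2 + w ^ 2) * 1 := by linarith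
    _ ≤ _ := mul_le_mul_of_nonneg_left hs (by positivity)

/-- If `-f'' = w` for a representative `f` of `u`, the left side is `f'(0) + a f(0)`, which is `(1 +
ka) f'(0)` under the boundary condition; the identity expresses this in the transformed picture. -/
theorem laplace_add_eq {k : ℝ} (hk : 0 ≤ k) (u w : HalfL2) {a : ℝ} (ha : 1 + k⁻¹ < a) :
    (∫ x in Ioi (0 : ℝ), (Real.exp (-(a * x)) : ℂ) * w x)
      + a ^ 2 * ∫ x in Ioi (0 : ℝ), (Real.exp (-(a * x)) : ℂ) * u x
    = (√(2 / Real.pi) * (1 + k * a) : ℝ) * ∫ s in Ioi (0 : ℝ),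
      ((s / ((a ^ 2 + s ^ 2) * √(1 + k ^ 2 * s ^ 2)) : ℝ) : ℂ) *
        (robinTransform hk w s + a ^ 2 * robinTransform hk u s) := by
  have hi := fun g => integrable_resolvent_mul k (pos_of_lt hk ha) g
  rw [integral_exp_mul_eq hk ha, integral_exp_mul_eq hk ha]
  simp only [expTransform_eq, mul_add, Complex.ofReal_mul, mul_left_comm _ ((a : ℂ) ^ 2) _]
  simp only [mul_assoc]
  rw [integral_add (hi _) ((hi _).const_mul _), integral_const_mul, integral_const_mul,
    integral_const_mul]
  ring

/-- Both sides say that the Laplace combination of `laplace_add_eq`, divided by `1 + ka`, does not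
depend on `a`. The constant value is `f'(0)`. -/
theorem exists_isRobinRep_iff {k : ℝ} (hk : 0 ≤ k) (u w : HalfL2) :
    (∃ f f', IsRobinRep k u w f f') ↔ ∀ᵐ s ∂(volume.restrict (Ioi (0 : ℝ))),
      robinTransform hk w s = ((s ^ 2 : ℝ) : ℂ) * robinTransform hk u s := by
  set U := robinTransform hk with hU
  have hk' : 0 ≤ k⁻¹ := inv_nonneg.2 hk
  have hfac : ∀ a, 1 + k⁻¹ < a → ((1 + k * a : ℝ) : ℂ) ≠ 0 := by
    intro a ha
    have h0 : 0 < a := by linarith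
    have : 1 + k * a ≠ 0 := by positivity
    exact_mod_cast this
  have hpi : ((√(2 / Real.pi) : ℝ) : ℂ) ≠ 0 := by
    have : √(2 / Real.pi) ≠ 0 := by positivity
    exact_mod_cast this
  constructor
  · rintro ⟨f, f', hf⟩
    have hD : ∀ a, 1 + k⁻¹ < a → f' 0 = (√(2 / Real.pi) : ℂ) * ∫ s in Ioi (0 : ℝ),
        ((s / ((a ^ 2 + s ^ 2) * √(1 + k ^ 2 * s ^ 2)) : ℝ) : ℂ) * (U w s + a ^ 2 * U u s) := by
      intro a ha
      have h0 : 0 < a := by linarith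
      have h1 := laplace_add_eq hk u w ha
      have h2 := (laplace_second h0 hf.deriv_fst hf.deriv_snd).2
      have h3 : ∫ x in Ioi (0 : ℝ), (Real.exp (-(a * x)) : ℂ) * u x
          = ∫ x in Ioi (0 : ℝ), (Real.exp (-(a * x)) : ℂ) * f x := by
        refine integral_congr_ae ?_
        filter_upwards [hf.ae_eq] with x hx
        rw [hx]
      rw [h3, h2, ← hf.boundary] at h1
      refine mul_left_cancel₀ (hfac a ha) ?_
      rw [hU]
      push_cast at h1 ⊢
      linear_combination h1
    set b := 1 + k⁻¹ + 1 with hb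
    have hb0 : 1 + k⁻¹ < b := by linarith
    have hb1 : 1 < b := by linarith
    have hbpos : 0 < b := by linarith
    -- This is `(U w - s² U u) / (b² + s²)`. Subtracting the expressions for `f'(0)` at `a` and at
    -- the fixed `b` leaves `b² - a²` times the Stieltjes-type integral of `F`; the denominator
    -- keeps `F` in `L²`.
    set F : ℝ → ℂ := fun s => (((b ^ 2 + s ^ 2)⁻¹ : ℝ) : ℂ) * U w s
      - ((s ^ 2 / (b ^ 2 + s ^ 2) : ℝ) : ℂ) * U u s with hF
    have hm : ∀ φ : ℝ → ℝ, Measurable φ → (∀ s, |φ s| ≤ 1) → ∀ g : HalfL2,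
        MemLp (fun s => (φ s : ℂ) * g s) 2 (volume.restrict (Ioi (0 : ℝ))) := by
      intro φ hφ hφ1 g
      refine (Lp.memLp g).mono ((by fun_prop : Measurable fun s =>
        (φ s : ℂ)).aestronglyMeasurable.mul (Lp.aestronglyMeasurable g)) (ae_of_all _ fun s => ?_)
      rw [norm_mul, Complex.norm_real]
      exact mul_le_of_le_one_left (norm_nonneg _) (hφ1 s)
    have hFm : MemLp F 2 (volume.restrict (Ioi (0 : ℝ))) := by
      refine (hm _ (by fun_prop) (fun s => ?_) (U w)).sub (hm _ (by fun_prop) (fun s => ?_) (U u))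
      · rw [abs_of_nonneg (by positivity)]
        exact inv_le_one_of_one_le₀ (by nlinarith [sq_nonneg s])
      · rw [abs_of_nonneg (by positivity)]
        exact div_le_one_of_le₀ (by nlinarith) (by positivity)
    have key := ae_eq_zero_of_expTransform (k := k) (c₀ := b) hb1.le hFm.aestronglyMeasurable
      (MemLp.integrable_mul memLp_div_one_add_sq hFm) (by
        intro a ha
        have ha1 : 1 + k⁻¹ < a := by linarith
        have ha0 : 0 < a := by linarith
        have hi : ∀ c, 1 < c → IntegrableOn (fun s => ((s / ((c ^ 2 + s ^ 2) *
            √(1 + k ^ 2 * s ^ 2)) : ℝ) : ℂ) * (U w s + c ^ 2 * U u s)) (Ioi 0) := by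
          intro c hc
          refine ((integrable_resolvent_mul k hc (U w)).add
            ((integrable_resolvent_mul k hc (U u)).const_mul ((c : ℂ) ^ 2))).congr
            (ae_of_all _ fun s => ?_)
          simp only [Pi.add_apply]
          ring
        have h1 := (hD a ha1).symm.trans (hD b hb0)
        have h2 := sub_eq_zero.2 (mul_left_cancel₀ hpi h1)
        rw [← integral_sub (hi a (by linarith)) (hi b hb1)] at h2
        have hne : ((b ^ 2 - a ^ 2 : ℝ) : ℂ) ≠ 0 := by
          have : b ^ 2 - a ^ 2 ≠ 0 := by nlinarith
          exact_mod_cast this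
        refine (mul_eq_zero.1 (?_ : ((b ^ 2 - a ^ 2 : ℝ) : ℂ) * _ = 0)).resolve_left hne
        rw [← integral_const_mul, ← h2]
        refine integral_congr_ae (ae_of_all _ fun s => ?_)
        simp only [hF]
        have e1 : ((a : ℂ) ^ 2 + (s : ℂ) ^ 2) ≠ 0 := by
          have : a ^ 2 + s ^ 2 ≠ 0 := by positivity
          exact_mod_cast this
        have e2 : ((b : ℂ) ^ 2 + (s : ℂ) ^ 2) ≠ 0 := by
          have : b ^ 2 + s ^ 2 ≠ 0 := by positivity
          exact_mod_cast this
        have e3 : ((√(1 + k ^ 2 * s ^ 2) : ℝ) : ℂ) ≠ 0 := by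
          have : √(1 + k ^ 2 * s ^ 2) ≠ 0 := by positivity
          exact_mod_cast this
        push_cast
        field_simp
        ring)
    filter_upwards [key] with s hs
    have e2 : ((b : ℂ) ^ 2 + (s : ℂ) ^ 2) ≠ 0 := by
      have : b ^ 2 + s ^ 2 ≠ 0 := by positivity
      exact_mod_cast this
    simp only [hF] at hs
    push_cast at hs ⊢
    field_simp at hs
    rw [mul_zero] at hs
    exact sub_eq_zero.1 hs
  · intro h
    -- The value forced on `f'(0)`: formal differentiation of the eigenfunction expansion at `x =
    -- 0`. A representative is then built by integrating `-w` twice with data `k D` and `D`.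
    set D : ℂ := (√(2 / Real.pi) : ℂ) * ∫ s in Ioi (0 : ℝ), ((s / √(1 + k ^ 2 * s ^ 2) : ℝ) : ℂ) * U u s
      with hD
    have hDa : ∀ a, 1 + k⁻¹ < a → (∫ x in Ioi (0 : ℝ), (Real.exp (-(a * x)) : ℂ) * w x)
      + a ^ 2 * ∫ x in Ioi (0 : ℝ), (Real.exp (-(a * x)) : ℂ) * u x = (1 + k * a : ℝ) * D := by
      intro a ha
      have h0 : 0 < a := by linarith
      rw [laplace_add_eq hk u w ha, hD]
      have h1 : ∫ s in Ioi (0 : ℝ), ((s / ((a ^ 2 + s ^ 2) * √(1 + k ^ 2 * s ^ 2)) : ℝ) : ℂ) *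
          (U w s + a ^ 2 * U u s)
          = ∫ s in Ioi (0 : ℝ), ((s / √(1 + k ^ 2 * s ^ 2) : ℝ) : ℂ) * U u s := by
        refine integral_congr_ae ?_
        filter_upwards [h] with s hs
        rw [hs]
        have e1 : ((a : ℂ) ^ 2 + (s : ℂ) ^ 2) ≠ 0 := by
          have : a ^ 2 + s ^ 2 ≠ 0 := by positivity
          exact_mod_cast this
        have e3 : ((√(1 + k ^ 2 * s ^ 2) : ℝ) : ℂ) ≠ 0 := by
          have : √(1 + k ^ 2 * s ^ 2) ≠ 0 := by positivity
          exact_mod_cast this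
        push_cast
        field_simp
        ring
      rw [← hU, h1]
      push_cast
      ring
    set f' : ℝ → ℂ := fun x => D - ∫ s in (0 : ℝ)..x, w s with hf'
    set f : ℝ → ℂ := fun x => k * D + ∫ s in (0 : ℝ)..x, f' s with hf
    have hf'0 : f' 0 = D := by simp [hf']
    have hf0 : f 0 = k * D := by simp [hf]
    have h1 : ∀ x, 0 ≤ x → f x = f 0 + ∫ s in (0 : ℝ)..x, f' s := fun x _ => by rw [hf0]
    have h2 : ∀ x, 0 ≤ x → f' x = f' 0 - ∫ s in (0 : ℝ)..x, w s := fun x _ => by rw [hf'0]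
    refine ⟨f, f', ⟨?_, continuousOn_const.sub (continuousOn_primitive_halfL2 w), h1, h2⟩,
      by rw [hf'0, hf0]⟩
    have key := ae_eq_zero_of_laplace (a₀ := 1 + k⁻¹) (F := fun x => u x - f x)
      (by
        intro a ha
        have h0 : 0 < a := by linarith
        simp only [mul_sub]
        exact (integrable_ofReal_mul (memLp_exp h0) u).sub (laplace_second h0 h1 h2).1)
      (by
        intro a ha
        have h0 : 0 < a := by linarith
        have hne : (a : ℂ) ^ 2 ≠ 0 := by exact_mod_cast (pow_pos h0 2).ne'
        simp only [mul_sub]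
        rw [integral_sub (integrable_ofReal_mul (memLp_exp h0) u) (laplace_second h0 h1 h2).1]
        refine (mul_eq_zero.1 (?_ : (a : ℂ) ^ 2 * _ = 0)).resolve_left hne
        rw [mul_sub, (laplace_second h0 h1 h2).2, hf'0, hf0]
        have h3 := hDa a ha
        push_cast at h3 ⊢
        linear_combination h3)
    filter_upwards [key] with x hx
    exact sub_eq_zero.1 hx

/-! ### Linear operations on half-line representatives -/

namespace IsHalfRep

theorem add {u w v z : HalfL2} {f f' g g' : ℝ → ℂ} (hf : IsHalfRep u w f f')
    (hg : IsHalfRep v z g g') :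
    IsHalfRep (u + v) (w + z) (fun x => f x + g x) (fun x => f' x + g' x) := by
  refine ⟨(Lp.coeFn_add u v).trans (hf.ae_eq.add hg.ae_eq), hf.continuousOn.add hg.continuousOn,
    fun x hx => ?_, fun x hx => ?_⟩
  · rw [intervalIntegral.integral_add (isStarRep_intervalIntegrable hf.continuousOn hx)
      (isStarRep_intervalIntegrable hg.continuousOn hx), hf.deriv_fst x hx, hg.deriv_fst x hx]
    ring
  · have : ∫ s in (0 : ℝ)..x, (w + z : HalfL2) s = ∫ s in (0 : ℝ)..x, (w s + z s) := by
      rw [intervalIntegral.integral_of_le hx, intervalIntegral.integral_of_le hx]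
      exact integral_congr_ae (ae_mono (Measure.restrict_mono Ioc_subset_Ioi_self le_rfl)
        (Lp.coeFn_add w z))
    rw [this, intervalIntegral.integral_add (halfL2_intervalIntegrable w le_rfl hx)
      (halfL2_intervalIntegrable z le_rfl hx), hf.deriv_snd x hx, hg.deriv_snd x hx]
    ring

theorem smul {u w : HalfL2} {f f' : ℝ → ℂ} (c : ℂ) (hf : IsHalfRep u w f f') :
    IsHalfRep (c • u) (c • w) (fun x => c * f x) (fun x => c * f' x) := by
  refine ⟨(Lp.coeFn_smul c u).trans (hf.ae_eq.const_smul c),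
    continuousOn_const.mul hf.continuousOn, fun x hx => ?_, fun x hx => ?_⟩
  · rw [intervalIntegral.integral_const_mul, hf.deriv_fst x hx]
    ring
  · have : ∫ s in (0 : ℝ)..x, (c • w : HalfL2) s = ∫ s in (0 : ℝ)..x, c * w s := by
      rw [intervalIntegral.integral_of_le hx, intervalIntegral.integral_of_le hx]
      exact integral_congr_ae (ae_mono (Measure.restrict_mono Ioc_subset_Ioi_self le_rfl)
        (Lp.coeFn_smul c w))
    rw [this, intervalIntegral.integral_const_mul, hf.deriv_snd x hx]
    ring

theorem zero : IsHalfRep 0 0 (fun _ => 0) (fun _ => 0) := by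
  refine ⟨Lp.coeFn_zero _ _ _, continuousOn_const, by simp, fun x hx => ?_⟩
  have : ∫ s in (0 : ℝ)..x, (0 : HalfL2) s = 0 := by
    rw [intervalIntegral.integral_of_le hx]
    exact integral_eq_zero_of_ae (ae_mono (Measure.restrict_mono Ioc_subset_Ioi_self le_rfl)
      (Lp.coeFn_zero ℂ 2 (volume.restrict (Ioi (0 : ℝ)))))
  rw [this, sub_zero]

theorem sum {ι : Type*} (s : Finset ι) {u w : ι → HalfL2} {f f' : ι → ℝ → ℂ}
    (h : ∀ i, IsHalfRep (u i) (w i) (f i) (f' i)) :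
    IsHalfRep (∑ i ∈ s, u i) (∑ i ∈ s, w i) (fun x => ∑ i ∈ s, f i x)
      (fun x => ∑ i ∈ s, f' i x) := by
  classical
  induction s using Finset.induction_on with
  | empty => simpa using zero
  | insert i s hi ih =>
    simp only [Finset.sum_insert hi]
    exact (h i).add ih

theorem sub {u w v z : HalfL2} {f f' g g' : ℝ → ℂ} (hf : IsHalfRep u w f f')
    (hg : IsHalfRep v z g g') :
    IsHalfRep (u - v) (w - z) (fun x => f x - g x) (fun x => f' x - g' x) := by
  have h := hf.add (hg.smul (-1))
  simp only [neg_smul, one_smul, ← sub_eq_add_neg, neg_mul, one_mul] at h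
  exact h

/-- Both Laplace transforms vanish, so the second-order identity at `a = 1` leaves only `f'(0)`. -/
theorem deriv_zero_eq_zero {f f' : ℝ → ℂ} (h : IsHalfRep 0 0 f f') (h0 : f 0 = 0) :
    f' 0 = 0 := by
  have h1 := (laplace_second one_pos h.deriv_fst h.deriv_snd).2
  have h2 : ∫ x in Ioi (0 : ℝ), (Real.exp (-(1 * x)) : ℂ) * f x = 0 := by
    refine integral_eq_zero_of_ae ?_
    filter_upwards [h.ae_eq, Lp.coeFn_zero ℂ 2 (volume.restrict (Ioi (0 : ℝ)))] with x h3 h4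
    rw [← h3, h4]
    simp
  have h3 : ∫ x in Ioi (0 : ℝ), (Real.exp (-(1 * x)) : ℂ) * (0 : HalfL2) x = 0 := by
    refine integral_eq_zero_of_ae ?_
    filter_upwards [Lp.coeFn_zero ℂ 2 (volume.restrict (Ioi (0 : ℝ)))] with x h4
    rw [h4]
    simp
  rw [h2, h3, h0] at h1
  simpa using h1.symm

end IsHalfRep

/-! ## Multiplication by indicator functions -/

open Classical in
/-- Multiplication by the indicator function of `S` on `L²(0,∞)`. -/
noncomputable def indOp (S : Set ℝ) : HalfL2 →L[ℂ] HalfL2 :=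
  if hS : MeasurableSet S then
    LinearMap.mkContinuous
      { toFun := fun v => ((Lp.memLp v).indicator hS).toLp _
        map_add' := fun v w => by
          rw [← MemLp.toLp_add]
          refine MemLp.toLp_congr _ _ ?_
          filter_upwards [Lp.coeFn_add v w] with x hx
          by_cases h : x ∈ S
          · simp only [Pi.add_apply, indicator_of_mem h, hx]
          · simp only [Pi.add_apply, indicator_of_notMem h, add_zero]
        map_smul' := fun c v => by
          rw [RingHom.id_apply, ← MemLp.toLp_const_smul]
          refine MemLp.toLp_congr _ _ ?_
          filter_upwards [Lp.coeFn_smul c v] with x hx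
          by_cases h : x ∈ S
          · simp only [Pi.smul_apply, indicator_of_mem h, hx]
          · simp only [Pi.smul_apply, indicator_of_notMem h, smul_zero] } 1
      (fun v => by
        rw [one_mul]
        refine Lp.norm_le_norm_of_ae_le ?_
        filter_upwards [((Lp.memLp v).indicator hS).coeFn_toLp] with x hx
        simp only [LinearMap.coe_mk, AddHom.coe_mk]
        rw [hx]
        exact norm_indicator_le_norm_self _ _)
  else 0

theorem indOp_ae {S : Set ℝ} (hS : MeasurableSet S) (v : HalfL2) :
    indOp S v =ᵐ[volume.restrict (Ioi (0 : ℝ))] S.indicator v := by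
  rw [indOp, dif_pos hS]
  exact ((Lp.memLp v).indicator hS).coeFn_toLp

theorem indOp_univ (v : HalfL2) : indOp univ v = v := by
  refine Lp.ext ?_
  filter_upwards [indOp_ae MeasurableSet.univ v] with x hx
  rw [hx, indicator_univ]

theorem indOp_idem {S : Set ℝ} (hS : MeasurableSet S) (v : HalfL2) :
    indOp S (indOp S v) = indOp S v := by
  refine Lp.ext ?_
  filter_upwards [indOp_ae hS v, indOp_ae hS (indOp S v)] with x h1 h2
  rw [h2]
  by_cases h : x ∈ S
  · rw [indicator_of_mem h]
  · rw [indicator_of_notMem h, h1, indicator_of_notMem h]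

theorem inner_indOp_left {S : Set ℝ} (hS : MeasurableSet S) (v w : HalfL2) :
    inner ℂ (indOp S v) w = inner ℂ v (indOp S w) := by
  rw [L2.inner_def, L2.inner_def]
  refine integral_congr_ae ?_
  filter_upwards [indOp_ae hS v, indOp_ae hS w] with x h1 h2
  rw [h1, h2]
  by_cases h : x ∈ S
  · rw [indicator_of_mem h, indicator_of_mem h]
  · rw [indicator_of_notMem h, indicator_of_notMem h, inner_zero_left, inner_zero_right]

theorem integrable_norm_sq (v : HalfL2) : IntegrableOn (fun x => ‖v x‖ ^ 2) (Ioi 0) :=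
  (memLp_two_iff_integrable_sq_norm (Lp.aestronglyMeasurable v)).1 (Lp.memLp v)

theorem norm_sq_eq_integral (v : HalfL2) : ‖v‖ ^ 2 = ∫ x in Ioi (0 : ℝ), ‖v x‖ ^ 2 := by
  have h : inner ℂ v v = ((∫ x in Ioi (0 : ℝ), ‖v x‖ ^ 2 : ℝ) : ℂ) := by
    rw [L2.inner_def, ← integral_complex_ofReal]
    refine integral_congr_ae (ae_of_all _ fun x => ?_)
    simp only
    rw [inner_self_eq_norm_sq_to_K]
    push_cast
    rfl
  rw [inner_self_eq_norm_sq_to_K] at h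
  apply Complex.ofReal_injective
  rw [← h, Complex.ofReal_pow]
  rfl

theorem norm_sq_indOp {S : Set ℝ} (hS : MeasurableSet S) (v : HalfL2) :
    ‖indOp S v‖ ^ 2 = ∫ x in S ∩ Ioi (0 : ℝ), ‖v x‖ ^ 2 := by
  rw [norm_sq_eq_integral, ← Measure.restrict_restrict hS, ← integral_indicator hS]
  refine integral_congr_ae ?_
  filter_upwards [indOp_ae hS v] with x h1
  rw [h1]
  by_cases h : x ∈ S
  · rw [indicator_of_mem h, indicator_of_mem h]
  · rw [indicator_of_notMem h, indicator_of_notMem h]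
    simp

theorem indOp_union {S T : Set ℝ} (hS : MeasurableSet S) (hT : MeasurableSet T)
    (hd : Disjoint S T) (v : HalfL2) : indOp (S ∪ T) v = indOp S v + indOp T v := by
  refine Lp.ext ?_
  filter_upwards [indOp_ae hS v, indOp_ae hT v, indOp_ae (hS.union hT) v,
    Lp.coeFn_add (indOp S v) (indOp T v)] with x h1 h2 h3 h4
  rw [h3, h4, Pi.add_apply, h1, h2, indicator_union_of_disjoint hd]

theorem indOp_empty (v : HalfL2) : indOp ∅ v = 0 := by
  have := indOp_union MeasurableSet.empty MeasurableSet.empty (disjoint_empty _) v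
  rw [union_empty] at this
  simpa using this

theorem indOp_biUnion {S : ℕ → Set ℝ} (hS : ∀ n, MeasurableSet (S n))
    (hd : Pairwise (Function.onFun Disjoint S)) (s : Finset ℕ) (v : HalfL2) :
    indOp (⋃ n ∈ s, S n) v = ∑ n ∈ s, indOp (S n) v := by
  induction s using Finset.induction_on with
  | empty => simp [indOp_empty]
  | insert i s hi ih =>
    rw [Finset.sum_insert hi, Finset.set_biUnion_insert, indOp_union (hS i)
      (s.measurableSet_biUnion fun n _ => hS n), ih]
    refine disjoint_iUnion₂_right.2 fun n hn => hd ?_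
    rintro rfl
    exact hi hn

/-- Countable additivity of the integral of `‖v‖²` gives the convergence of squared norms; the
remainder lives on a disjoint set, so its norm is the square root of the missing mass. -/
theorem hasSum_indOp {S : ℕ → Set ℝ} (hS : ∀ n, MeasurableSet (S n))
    (hd : Pairwise (Function.onFun Disjoint S)) (v : HalfL2) :
    HasSum (fun n => indOp (S n) v) (indOp (⋃ n, S n) v) := by
  have hU := MeasurableSet.iUnion hS
  have h1 := hasSum_integral_iUnion (μ := volume.restrict (Ioi (0 : ℝ))) hS hd
    (f := fun x => ‖v x‖ ^ 2) (integrable_norm_sq v).integrableOn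
  simp only [Measure.restrict_restrict hU, Measure.restrict_restrict (hS _),
    ← norm_sq_indOp hU, ← norm_sq_indOp (hS _)] at h1
  rw [HasSum, SummationFilter.unconditional_filter] at h1 ⊢
  rw [tendsto_iff_norm_sub_tendsto_zero]
  have h2 : ∀ s : Finset ℕ, ‖∑ n ∈ s, indOp (S n) v - indOp (⋃ n, S n) v‖
      = √(‖indOp (⋃ n, S n) v‖ ^ 2 - ∑ n ∈ s, ‖indOp (S n) v‖ ^ 2) := by
    intro s
    set A := ⋃ n ∈ s, S n
    have hA : MeasurableSet A := s.measurableSet_biUnion fun n _ => hS n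
    have hAU : A ⊆ ⋃ n, S n := iUnion₂_subset fun n _ => subset_iUnion S n
    have h3 := indOp_union hA (hU.diff hA) disjoint_sdiff_right v
    rw [union_sdiff_cancel hAU] at h3
    have h4 : ∑ n ∈ s, ‖indOp (S n) v‖ ^ 2 = ‖indOp A v‖ ^ 2 := by
      simp only [norm_sq_indOp (hS _), norm_sq_indOp hA, ← Measure.restrict_restrict (hS _),
        ← Measure.restrict_restrict hA]
      exact (integral_biUnion_finset s (fun n _ => hS n) (fun i _ j _ hij => hd hij)
        fun n _ => (integrable_norm_sq v).integrableOn).symm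
    have h5 : ‖indOp (⋃ n, S n) v‖ ^ 2
        = ‖indOp A v‖ ^ 2 + ‖indOp ((⋃ n, S n) \ A) v‖ ^ 2 := by
      rw [norm_sq_indOp hU, norm_sq_indOp hA, norm_sq_indOp (hU.diff hA),
        ← Measure.restrict_restrict hU, ← Measure.restrict_restrict hA,
        ← Measure.restrict_restrict (hU.diff hA), ← setIntegral_union disjoint_sdiff_right
          (hU.diff hA) (integrable_norm_sq v).integrableOn (integrable_norm_sq v).integrableOn,
        union_sdiff_cancel hAU]
    rw [h4, h5, add_sub_cancel_left, Real.sqrt_sq (norm_nonneg _), ← indOp_biUnion hS hd, h3,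
      sub_add_cancel_left, norm_neg]
  simp only [h2]
  have h7 := ((tendsto_const_nhds (x := ‖indOp (⋃ n, S n) v‖ ^ 2)).sub h1).sqrt
  rwa [sub_self, Real.sqrt_zero] at h7

/-! ## The spectral projections of the half-line operator -/

/-- The spectral projection onto frequencies in `S`. -/
noncomputable def robinProj {k : ℝ} (hk : 0 ≤ k) (S : Set ℝ) (v : HalfL2) : HalfL2 :=
  (robinTransform hk).symm (indOp S (robinTransform hk v))

/-- The kernel of the spectral projection onto frequencies in `[0,W]`. -/
noncomputable def robinKernel (k W x y : ℝ) : ℝ :=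
  ∫ w in (0 : ℝ)..W, robinEigen k w x * robinEigen k w y

theorem memLp_indicator_robinEigen (k W x : ℝ) :
    MemLp (fun w => (((Icc (-W) W).indicator (fun w => robinEigen k w x) w : ℝ) : ℂ)) 2
      (volume.restrict (Ioi (0 : ℝ))) := by
  have hc : Continuous fun w => robinEigen k w x :=
    (continuous_robinEigen k).comp (by fun_prop : Continuous fun w : ℝ => (w, x))
  refine memLp_two_ofReal_of_sq (hc.measurable.indicator measurableSet_Icc) ?_
  have h1 : (fun w => ((Icc (-W) W).indicator (fun w => robinEigen k w x) w) ^ 2)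
      = (Icc (-W) W).indicator (fun w => robinEigen k w x ^ 2) := by
    ext w
    by_cases h : w ∈ Icc (-W) W
    · rw [indicator_of_mem h, indicator_of_mem h]
    · rw [indicator_of_notMem h, indicator_of_notMem h]
      simp
  rw [h1]
  exact ((integrable_indicator_iff measurableSet_Icc).2
    ((hc.pow 2).continuousOn.integrableOn_compact isCompact_Icc)).integrableOn

/-- The preimage of `[0, W²]` under squaring is `[-W, W]`; only its positive part meets the
frequency half-line. -/
theorem setIntegral_Ioi_indicator_Icc {E : Type*} [NormedAddCommGroup E] [NormedSpace ℝ E] {W : ℝ}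
    (hW : 0 ≤ W) (f : ℝ → E) :
    ∫ w in Ioi (0 : ℝ), (Icc (-W) W).indicator f w = ∫ w in (0 : ℝ)..W, f w := by
  rw [setIntegral_indicator measurableSet_Icc, intervalIntegral.integral_of_le hW]
  congr 2
  ext w
  simp only [mem_inter_iff, mem_Ioi, mem_Icc, mem_Ioc]
  constructor
  · rintro ⟨h1, _, h3⟩
    exact ⟨h1, h3⟩
  · rintro ⟨h1, h2⟩
    exact ⟨h1, by linarith, h2⟩

/-- A section of the kernel is the inverse transform of a truncated eigenfunction, hence lies in
`L²`. -/
theorem robinTransform_symm_indicator_ae {k : ℝ} (hk : 0 ≤ k) {W : ℝ} (hW : 0 ≤ W) (x : ℝ) :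
    (robinTransform hk).symm ((memLp_indicator_robinEigen k W x).toLp _)
      =ᵐ[volume.restrict (Ioi (0 : ℝ))] fun y => (robinKernel k W x y : ℂ) := by
  have hc : Continuous fun w => robinEigen k w x :=
    (continuous_robinEigen k).comp (by fun_prop : Continuous fun w : ℝ => (w, x))
  have hi : IntegrableOn ((memLp_indicator_robinEigen k W x).toLp _) (Ioi 0) := by
    have h1 : Integrable (fun w => (((Icc (-W) W).indicator (fun w => robinEigen k w x) w : ℝ) : ℂ))
        (volume.restrict (Ioi (0 : ℝ))) :=
      (((integrable_indicator_iff measurableSet_Icc).2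
        (hc.continuousOn.integrableOn_compact isCompact_Icc)).integrableOn).ofReal
    exact h1.congr (memLp_indicator_robinEigen k W x).coeFn_toLp.symm
  refine (robinTransform_symm_ae_eq hk _ hi).trans (ae_of_all _ fun y => ?_)
  simp only
  rw [robinKernel, ← setIntegral_Ioi_indicator_Icc hW, ← integral_complex_ofReal]
  refine integral_congr_ae ?_
  filter_upwards [(memLp_indicator_robinEigen k W x).coeFn_toLp] with w hw
  rw [hw]
  by_cases h : w ∈ Icc (-W) W
  · rw [indicator_of_mem h, indicator_of_mem h]
    push_cast
    ring
  · rw [indicator_of_notMem h, indicator_of_notMem h]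
    simp

theorem memLp_robinKernel {k : ℝ} (hk : 0 ≤ k) {W : ℝ} (hW : 0 ≤ W) (x : ℝ) :
    MemLp (fun y => (robinKernel k W x y : ℂ)) 2 (volume.restrict (Ioi (0 : ℝ))) :=
  (memLp_congr_ae (robinTransform_symm_indicator_ae hk hW x)).1 (Lp.memLp _)

/-- The truncation of `U v` is integrable, so the inversion formula gives its inverse transform at
`x` as the inner product of the truncated eigenfunction with `U v`. Unitarity moves this to the
inner product of the kernel section with `v`. -/
theorem robinProj_ae {k : ℝ} (hk : 0 ≤ k) {W : ℝ} (hW : 0 ≤ W) (v : HalfL2) :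
    robinProj hk (Icc (-W) W) v =ᵐ[volume.restrict (Ioi (0 : ℝ))]
      fun x => ∫ y in Ioi (0 : ℝ), (robinKernel k W x y : ℂ) * v y := by
  set U := robinTransform hk with hU
  have hi : IntegrableOn (indOp (Icc (-W) W) (U v)) (Ioi 0) := by
    have h1 : IntegrableOn ((Icc (-W) W).indicator (U v)) (Ioi 0) := by
      rw [IntegrableOn, integrable_indicator_iff measurableSet_Icc]
      have h2 : MemLp (U v) 2 ((volume.restrict (Ioi (0 : ℝ))).restrict (Icc (-W) W)) :=
        (Lp.memLp (U v)).mono_measure Measure.restrict_le_self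
      have : IsFiniteMeasure ((volume.restrict (Ioi (0 : ℝ))).restrict (Icc (-W) W)) := by
        refine ⟨?_⟩
        rw [Measure.restrict_apply_univ, Measure.restrict_apply measurableSet_Icc]
        exact (measure_mono inter_subset_left).trans_lt measure_Icc_lt_top
      exact h2.integrable (by norm_num)
    exact Integrable.congr h1 (indOp_ae measurableSet_Icc (U v)).symm
  refine (robinTransform_symm_ae_eq hk _ hi).trans (ae_of_all _ fun x => ?_)
  simp only
  have h1 : ∫ w in Ioi (0 : ℝ), (robinEigen k w x : ℂ) * indOp (Icc (-W) W) (U v) w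
      = inner ℂ ((memLp_indicator_robinEigen k W x).toLp _) (U v) := by
    rw [inner_toLp_ofReal]
    refine integral_congr_ae ?_
    filter_upwards [indOp_ae measurableSet_Icc (U v)] with w hw
    rw [hw]
    by_cases h : w ∈ Icc (-W) W
    · rw [indicator_of_mem h, indicator_of_mem h]
    · rw [indicator_of_notMem h, indicator_of_notMem h]
      simp
  rw [h1, ← U.apply_symm_apply ((memLp_indicator_robinEigen k W x).toLp _),
    U.inner_map_map, L2.inner_def]
  refine integral_congr_ae ?_
  filter_upwards [robinTransform_symm_indicator_ae hk hW x] with y hy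
  rw [hy, RCLike.inner_apply, Complex.conj_ofReal, mul_comm]

/-! ## The spectral transform of the star graph -/

section StarTransform

variable {N : ℕ}

/-- The average over the edges. -/
noncomputable def edgeMean (u : StarL2 N) : HalfL2 := (N : ℂ)⁻¹ • ∑ l, u l

theorem edgeMean_add (u v : StarL2 N) : edgeMean (u + v) = edgeMean u + edgeMean v := by
  simp only [edgeMean, PiLp.add_apply, Finset.sum_add_distrib, smul_add]

theorem edgeMean_smul (c : ℂ) (u : StarL2 N) : edgeMean (c • u) = c • edgeMean u := by
  simp only [edgeMean, PiLp.smul_apply, ← Finset.smul_sum]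
  rw [smul_comm]

theorem sum_sub_edgeMean [NeZero N] (u : StarL2 N) : ∑ j, (u j - edgeMean u) = 0 := by
  have hN : (N : ℂ) ≠ 0 := NeZero.ne _
  rw [Finset.sum_sub_distrib, Finset.sum_const, Finset.card_univ, Fintype.card_fin, edgeMean,
    ← Nat.cast_smul_eq_nsmul ℂ, smul_smul, mul_inv_cancel₀ hN, one_smul, sub_self]

theorem edgeMean_eq [NeZero N] (u : StarL2 N) (a : Fin N → HalfL2) (b : HalfL2)
    (ha : ∑ j, a j = 0) (hu : ∀ j, u j = a j + b) : edgeMean u = b := by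
  have hN : (N : ℂ) ≠ 0 := NeZero.ne _
  simp only [edgeMean, hu, Finset.sum_add_distrib, ha, zero_add, Finset.sum_const,
    Finset.card_univ, Fintype.card_fin]
  rw [← Nat.cast_smul_eq_nsmul ℂ, smul_smul, inv_mul_cancel₀ hN, one_smul]

theorem norm_sq_eq_of_split (u : StarL2 N) (a : Fin N → HalfL2) (b : HalfL2)
    (ha : ∑ j, a j = 0) (hu : ∀ j, u j = a j + b) :
    ‖u‖ ^ 2 = ∑ j, ‖a j‖ ^ 2 + N * ‖b‖ ^ 2 := by
  rw [PiLp.norm_sq_eq_of_L2]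
  simp only [hu, norm_add_sq (𝕜 := ℂ), Finset.sum_add_distrib, ← Finset.mul_sum]
  rw [← map_sum, ← sum_inner, ha]
  simp

/-- The operator acting by `T` on functions with vanishing edge average and by `S` on
functions that agree on all edges. -/
noncomputable def starMixLinear (T S : HalfL2 ≃ₗᵢ[ℂ] HalfL2) : StarL2 N →ₗ[ℂ] StarL2 N where
  toFun u := WithLp.toLp 2 fun j => T (u j - edgeMean u) + S (edgeMean u)
  map_add' u v := by
    refine PiLp.ext fun j => ?_
    simp only [PiLp.add_apply, edgeMean_add, map_add, map_sub]
    abel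
  map_smul' c u := by
    refine PiLp.ext fun j => ?_
    simp only [PiLp.smul_apply, edgeMean_smul, map_smul, ← smul_sub, ← smul_add, RingHom.id_apply]

theorem starMixLinear_apply (T S : HalfL2 ≃ₗᵢ[ℂ] HalfL2) (u : StarL2 N) (j : Fin N) :
    starMixLinear T S u j = T (u j - edgeMean u) + S (edgeMean u) := rfl

theorem edgeMean_starMixLinear [NeZero N] (T S : HalfL2 ≃ₗᵢ[ℂ] HalfL2) (u : StarL2 N) :
    edgeMean (starMixLinear T S u) = S (edgeMean u) :=
  edgeMean_eq _ (fun j => T (u j - edgeMean u)) _ (by rw [← map_sum, sum_sub_edgeMean, map_zero])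
    fun j => rfl

theorem starMixLinear_comp [NeZero N] (T S T' S' : HalfL2 ≃ₗᵢ[ℂ] HalfL2) (u : StarL2 N) (j : Fin N) :
    starMixLinear T S (starMixLinear T' S' u) j
      = T (T' (u j - edgeMean u)) + S (S' (edgeMean u)) := by
  rw [starMixLinear_apply, edgeMean_starMixLinear, starMixLinear_apply, add_sub_cancel_right]

/-- `starMixLinear` as a unitary operator. -/
noncomputable def starMix [NeZero N] (T S : HalfL2 ≃ₗᵢ[ℂ] HalfL2) : StarL2 N ≃ₗᵢ[ℂ] StarL2 N where
  toLinearEquiv := LinearEquiv.ofLinearMap (starMixLinear T S) (starMixLinear T.symm S.symm)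
    (by
      ext1 u
      refine PiLp.ext fun j => ?_
      change starMixLinear T S (starMixLinear T.symm S.symm u) j = u j
      rw [starMixLinear_comp]
      simp)
    (by
      ext1 u
      refine PiLp.ext fun j => ?_
      change starMixLinear T.symm S.symm (starMixLinear T S u) j = u j
      rw [starMixLinear_comp]
      simp)
  norm_map' u := by
    change ‖starMixLinear T S u‖ = ‖u‖
    rw [← sq_eq_sq₀ (norm_nonneg _) (norm_nonneg _),
      norm_sq_eq_of_split (starMixLinear T S u) (fun j => T (u j - edgeMean u)) (S (edgeMean u))
        (by rw [← map_sum, sum_sub_edgeMean, map_zero]) (fun j => rfl),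
      norm_sq_eq_of_split u (fun j => u j - edgeMean u) (edgeMean u) (sum_sub_edgeMean u)
        (fun j => by simp)]
    simp only [LinearIsometryEquiv.norm_map]

theorem starMix_symm_apply [NeZero N] (T S : HalfL2 ≃ₗᵢ[ℂ] HalfL2) (u : StarL2 N) (j : Fin N) :
    (starMix T S).symm u j = T.symm (u j - edgeMean u) + S.symm (edgeMean u) := rfl

/-! ## Projection-valued measures from unitary transforms -/

/-- Multiplication by an indicator function on every edge. -/
noncomputable def starInd (S : Set ℝ) : StarL2 N →L[ℂ] StarL2 N :=
  (PiLp.continuousLinearEquiv 2 ℂ (fun _ : Fin N => HalfL2)).symm.toContinuousLinearMap ∘L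
    ContinuousLinearMap.pi fun j => (indOp S) ∘L
      (PiLp.proj 2 (fun _ : Fin N => HalfL2) j)

theorem starInd_apply (S : Set ℝ) (u : StarL2 N) (j : Fin N) :
    starInd S u j = indOp S (u j) := rfl

theorem inner_starInd_left {S : Set ℝ} (hS : MeasurableSet S) (u v : StarL2 N) :
    inner ℂ (starInd S u) v = inner ℂ u (starInd S v) := by
  simp only [PiLp.inner_apply, starInd_apply, inner_indOp_left hS]

theorem norm_sq_starInd {S : Set ℝ} (hS : MeasurableSet S) (u : StarL2 N) :
    ‖starInd S u‖ ^ 2 = ∑ j, ∫ x in S ∩ Ioi (0 : ℝ), ‖u j x‖ ^ 2 := by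
  rw [PiLp.norm_sq_eq_of_L2]
  simp only [starInd_apply, norm_sq_indOp hS]

/-- The projection-valued measure of the operator that `U` turns into multiplication by `w²`. -/
noncomputable def squarePVM (U : StarL2 N ≃ₗᵢ[ℂ] StarL2 N) : PVM (StarL2 N) where
  proj B := U.symm.toContinuousLinearEquiv.toContinuousLinearMap ∘L
    starInd ((fun s : ℝ => s ^ 2) ⁻¹' B) ∘L U.toContinuousLinearEquiv.toContinuousLinearMap
  isProj B hB := by
    have hS : MeasurableSet ((fun s : ℝ => s ^ 2) ⁻¹' B) := (by fun_prop : Measurable fun s : ℝ => s ^ 2) hB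
    refine ⟨?_, ?_⟩
    · ext1 u
      change U.symm (starInd _ (U (U.symm (starInd _ (U u))))) = U.symm (starInd _ (U u))
      rw [U.apply_symm_apply]
      congr 1
      refine PiLp.ext fun j => ?_
      exact indOp_idem hS _
    · rw [ContinuousLinearMap.isSelfAdjoint_iff_isSymmetric]
      intro u v
      change inner ℂ (U.symm (starInd _ (U u))) v = inner ℂ u (U.symm (starInd _ (U v)))
      rw [← U.inner_map_map, U.apply_symm_apply, inner_starInd_left hS, ← U.inner_map_map u,
        U.apply_symm_apply]
  univ' := by
    ext1 u
    change U.symm (starInd _ (U u)) = u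
    rw [preimage_univ, U.symm_apply_eq]
    refine PiLp.ext fun j => ?_
    exact indOp_univ _
  iUnion' B hB hd u := by
    have hm : Measurable fun s : ℝ => s ^ 2 := by fun_prop
    have h1 : HasSum (fun n => starInd ((fun s : ℝ => s ^ 2) ⁻¹' (B n)) (U u))
        (starInd ((fun s : ℝ => s ^ 2) ⁻¹' (⋃ n, B n)) (U u)) := by
      have h2 : HasSum (fun n => fun j => indOp ((fun s : ℝ => s ^ 2) ⁻¹' (B n)) (U u j))
          (fun j => indOp ((fun s : ℝ => s ^ 2) ⁻¹' (⋃ n, B n)) (U u j)) := by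
        rw [Pi.hasSum]
        intro j
        rw [preimage_iUnion]
        exact hasSum_indOp (fun n => hm (hB n)) (fun i j hij => (hd hij).preimage _) _
      exact h2.mapL (PiLp.continuousLinearEquiv 2 ℂ
        (fun _ : Fin N => HalfL2)).symm.toContinuousLinearMap
    exact h1.mapL U.symm.toContinuousLinearEquiv.toContinuousLinearMap

theorem squarePVM_proj (U : StarL2 N ≃ₗᵢ[ℂ] StarL2 N) (B : Set ℝ) (u : StarL2 N) :
    (squarePVM U).proj B u = U.symm (starInd ((fun s : ℝ => s ^ 2) ⁻¹' B) (U u)) := rfl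

theorem squarePVM_scalarMeasure (U : StarL2 N ≃ₗᵢ[ℂ] StarL2 N) (u : StarL2 N) :
    (squarePVM U).scalarMeasure u = ((volume.restrict (Ioi (0 : ℝ))).withDensity
      fun s => ENNReal.ofReal (∑ j, ‖U u j s‖ ^ 2)).map fun s => s ^ 2 := by
  have hm : Measurable fun s : ℝ => s ^ 2 := by fun_prop
  ext B hB
  rw [(squarePVM U).scalarMeasure_apply u hB, Measure.map_apply hm hB,
    withDensity_apply _ (hm hB), squarePVM_proj, LinearIsometryEquiv.norm_map,
    norm_sq_starInd (hm hB), ← Measure.restrict_restrict (hm hB),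
    ← integral_finsetSum _ fun j _ => (integrable_norm_sq _).integrableOn,
    ofReal_integral_eq_lintegral_ofReal]
  · exact integrable_finsetSum _ fun j _ => (integrable_norm_sq _).integrableOn
  · exact ae_of_all _ fun s => Finset.sum_nonneg fun j _ => by positivity

/-- If `U` turns the graph of `A` into the graph of multiplication by `w²`, then `squarePVM U` is
the spectral measure of `A`. -/
theorem squarePVM_isSpectralMeasureOf (U : StarL2 N ≃ₗᵢ[ℂ] StarL2 N) (A : StarL2 N →ₗ.[ℂ] StarL2 N)
    (h : ∀ u w : StarL2 N, (u, w) ∈ A.graph ↔ ∀ j, ∀ᵐ s ∂(volume.restrict (Ioi (0 : ℝ))),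
      U w j s = ((s ^ 2 : ℝ) : ℂ) * U u j s) :
    (squarePVM U).IsSpectralMeasureOf A := by
  have hm : Measurable fun s : ℝ => s ^ 2 := by fun_prop
  have hdm : ∀ u : StarL2 N, AEMeasurable (fun s => ENNReal.ofReal (∑ j, ‖U u j s‖ ^ 2))
      (volume.restrict (Ioi (0 : ℝ))) := by
    intro u
    refine (Finset.aemeasurable_fun_sum _ fun j _ => ?_).ennreal_ofReal
    exact ((Lp.aestronglyMeasurable (U u j)).norm.aemeasurable).pow_const 2
  have htr : ∀ (u : StarL2 N) (s : ℝ), (ENNReal.ofReal (∑ j, ‖U u j s‖ ^ 2)).toReal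
      = ∑ j, ‖U u j s‖ ^ 2 := fun u s =>
    ENNReal.toReal_ofReal (Finset.sum_nonneg fun j _ => by positivity)
  constructor
  · intro u
    have h1 : Integrable (fun s : ℝ => s ^ 2) ((squarePVM U).scalarMeasure u) ↔
        IntegrableOn (fun s => ∑ j, ‖((s ^ 2 : ℝ) : ℂ) * U u j s‖ ^ 2) (Ioi 0) := by
      rw [squarePVM_scalarMeasure, integrable_map_measure (by fun_prop) hm.aemeasurable,
        integrable_withDensity_iff_integrable_smul₀' (hdm u) (ae_of_all _ fun _ => ENNReal.ofReal_lt_top)]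
      refine integrable_congr (ae_of_all _ fun s => ?_)
      simp only [Function.comp, htr, smul_eq_mul, Finset.sum_mul, norm_mul, Complex.norm_real,
        Real.norm_eq_abs, mul_pow, sq_abs]
      refine Finset.sum_congr rfl fun j _ => ?_
      rw [mul_comm]
    have hmj : ∀ j, AEStronglyMeasurable (fun s => ((s ^ 2 : ℝ) : ℂ) * U u j s)
        (volume.restrict (Ioi (0 : ℝ))) := fun j =>
      ((by fun_prop : Measurable fun s : ℝ => ((s ^ 2 : ℝ) : ℂ)).aestronglyMeasurable).mul
        (Lp.aestronglyMeasurable (U u j))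
    have h2 : IntegrableOn (fun s => ∑ j, ‖((s ^ 2 : ℝ) : ℂ) * U u j s‖ ^ 2) (Ioi 0) ↔
        ∀ j, MemLp (fun s => ((s ^ 2 : ℝ) : ℂ) * U u j s) 2 (volume.restrict (Ioi (0 : ℝ))) := by
      constructor
      · intro hi j
        rw [memLp_two_iff_integrable_sq_norm (hmj j)]
        refine Integrable.mono' hi ((hmj j).norm.pow 2) (ae_of_all _ fun s => ?_)
        rw [Real.norm_of_nonneg (by positivity)]
        exact Finset.single_le_sum (f := fun j => ‖((s ^ 2 : ℝ) : ℂ) * U u j s‖ ^ 2)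
          (fun j _ => by positivity) (Finset.mem_univ j)
      · intro hi
        exact integrable_finsetSum _ fun j _ =>
          (memLp_two_iff_integrable_sq_norm (hmj j)).1 (hi j)
    rw [h1, h2]
    constructor
    · intro hu j
      have h3 := (h u (A ⟨u, hu⟩)).1 (A.mem_graph ⟨u, hu⟩) j
      exact (memLp_congr_ae h3).1 (Lp.memLp _)
    · intro hi
      -- Once `s² U u` is in `L²`, its inverse transform is the only candidate for `A u`, and the
      -- graph condition holds by construction.
      have h3 : (u, U.symm (WithLp.toLp 2 fun j => (hi j).toLp _)) ∈ A.graph := by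
        rw [h]
        intro j
        rw [U.apply_symm_apply]
        exact (hi j).coeFn_toLp
      obtain ⟨y, hy, -⟩ := (LinearPMap.mem_graph_iff A).1 h3
      have hy' : (y : StarL2 N) = u := hy
      rw [← hy']
      exact y.2
  · intro u
    have h3 := (h u (A u)).1 (A.mem_graph u)
    rw [squarePVM_scalarMeasure, integral_map hm.aemeasurable (by fun_prop),
      integral_withDensity_eq_integral_toReal_smul₀ (hdm u)
        (ae_of_all _ fun _ => ENNReal.ofReal_lt_top),
      ← U.inner_map_map, PiLp.inner_apply, ← integral_complex_ofReal]
    simp only [L2.inner_def]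
    rw [← integral_finsetSum _ fun j _ => L2.integrable_inner (𝕜 := ℂ) (U (u : StarL2 N) j) (U (A u) j)]
    refine integral_congr_ae ?_
    filter_upwards [ae_all_iff.2 h3] with s hs
    simp only [htr, smul_eq_mul, Finset.sum_mul, hs, Complex.ofReal_sum]
    refine Finset.sum_congr rfl fun j _ => ?_
    rw [RCLike.inner_apply, mul_assoc, RCLike.mul_conj]
    push_cast
    simp only [Complex.coe_algebraMap]
    ring

end StarTransform

/-! ### The spectral resolution of the star graph Hamiltonian -/

section StarHamiltonian

variable {N : ℕ}

/-- Continuity at the vertex means that deviations from the mean vanish there. Averaging the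
derivative condition gives the mean the slope `(α/N) f(0)`, that is `k f'(0) = f(0)` with `k = N/α`.
-/
theorem mem_starGraph_iff [NeZero N] {α : ℝ} (hα : 0 < α) (u w : StarL2 N) :
    (u, w) ∈ starGraph N α ↔
      (∀ j, ∃ f f', IsRobinRep 0 (u j - edgeMean u) (w j - edgeMean w) f f') ∧
      ∃ f f', IsRobinRep (N / α) (edgeMean u) (edgeMean w) f f' := by
  have hN : (N : ℂ) ≠ 0 := NeZero.ne _
  have hα' : (α : ℂ) ≠ 0 := by exact_mod_cast hα.ne'
  constructor
  · rintro ⟨f, f', hf⟩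
    have hr : ∀ j, IsHalfRep (u j) (w j) (f j) (f' j) := fun j =>
      ⟨hf.ae_eq j, (hf.deriv_fst j).1, (hf.deriv_fst j).2, hf.deriv_snd j⟩
    have hm : IsHalfRep (edgeMean u) (edgeMean w) _ _ :=
      (IsHalfRep.sum Finset.univ hr).smul (N : ℂ)⁻¹
    have hm0 : ∀ j, (N : ℂ)⁻¹ * ∑ l, f l 0 = f j 0 := by
      intro j
      simp only [hf.continuity _ j, Finset.sum_const, Finset.card_univ, Fintype.card_fin,
        nsmul_eq_mul]
      rw [← mul_assoc, inv_mul_cancel₀ hN, one_mul]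
    refine ⟨fun j => ⟨_, _, (hr j).sub hm, ?_⟩, _, _, hm, ?_⟩
    · rw [hm0 j]
      simp
    · rw [hf.vertex 0, hm0 0]
      push_cast
      field_simp
  · rintro ⟨h1, g, g', hg⟩
    choose f f' hf using h1
    have hf0 : ∀ j, f j 0 = 0 := fun j => by
      have := (hf j).boundary
      simpa using this.symm
    have hs : IsHalfRep 0 0 (fun x => ∑ j, f j x) (fun x => ∑ j, f' j x) := by
      have h2 := IsHalfRep.sum Finset.univ fun j => (hf j).toIsHalfRep
      rwa [sum_sub_edgeMean, sum_sub_edgeMean] at h2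
    -- The deviations are represented edge by edge; since they add up to zero, so do the derivatives
    -- of their representatives, and the sum of slopes comes from the mean alone.
    have hs0 : ∑ j, f' j 0 = 0 := hs.deriv_zero_eq_zero (by simp [hf0])
    have hr : ∀ j, IsHalfRep (u j) (w j) (fun x => f j x + g x) (fun x => f' j x + g' x) := by
      intro j
      have h2 := (hf j).toIsHalfRep.add hg.toIsHalfRep
      rwa [sub_add_cancel, sub_add_cancel] at h2
    refine ⟨fun j x => f j x + g x, fun j x => f' j x + g' x, fun j => (hr j).ae_eq,
      fun j => ⟨(hr j).continuousOn, (hr j).deriv_fst⟩, fun j => (hr j).deriv_snd,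
      fun i j => by simp [hf0], fun i => ?_⟩
    have h3 := hg.boundary
    rw [Finset.sum_add_distrib, hs0, hf0, zero_add, zero_add, Finset.sum_const, Finset.card_univ,
      Fintype.card_fin, nsmul_eq_mul, ← h3]
    push_cast
    field_simp

theorem div_nonneg_of_pos {α : ℝ} (hα : 0 < α) : 0 ≤ (N : ℝ) / α := by positivity

/-- The unitary transform diagonalizing the star graph Hamiltonian. -/
noncomputable def starTransform (N : ℕ) [NeZero N] {α : ℝ} (hα : 0 < α) :
    StarL2 N ≃ₗᵢ[ℂ] StarL2 N :=
  starMix (robinTransform le_rfl) (robinTransform (div_nonneg_of_pos (N := N) hα))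

theorem mem_starGraph_iff_starTransform [NeZero N] {α : ℝ} (hα : 0 < α) (u w : StarL2 N) :
    (u, w) ∈ starGraph N α ↔ ∀ j, ∀ᵐ s ∂(volume.restrict (Ioi (0 : ℝ))),
      starTransform N hα w j s = ((s ^ 2 : ℝ) : ℂ) * starTransform N hα u j s := by
  rw [mem_starGraph_iff hα]
  have h0 := fun j => exists_isRobinRep_iff (le_refl (0 : ℝ)) (u j - edgeMean u) (w j - edgeMean w)
  have hk := exists_isRobinRep_iff (div_nonneg_of_pos (N := N) hα) (edgeMean u) (edgeMean w)
  rw [hk, forall_congr' h0]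
  set T := robinTransform (le_refl (0 : ℝ))
  set S := robinTransform (div_nonneg_of_pos (N := N) hα)
  have happ : ∀ v j, starTransform N hα v j = T (v j - edgeMean v) + S (edgeMean v) :=
    fun v j => rfl
  have hmean : ∀ v, edgeMean (starTransform N hα v) = S (edgeMean v) :=
    fun v => edgeMean_starMixLinear T S v
  constructor
  · rintro ⟨h1, h2⟩ j
    rw [happ, happ]
    filter_upwards [h1 j, h2, Lp.coeFn_add (T (u j - edgeMean u)) (S (edgeMean u)),
      Lp.coeFn_add (T (w j - edgeMean w)) (S (edgeMean w))] with s h3 h4 h5 h6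
    rw [h5, h6, Pi.add_apply, Pi.add_apply, h3, h4]
    ring
  -- Multiplication by `s²` commutes with averaging over the edges, so the relation passes to the
  -- mean and, by subtraction, to the deviations.
  · intro h
    have hsum : ∀ v : StarL2 N, ∀ᵐ s ∂(volume.restrict (Ioi (0 : ℝ))),
        edgeMean v s = (N : ℂ)⁻¹ * ∑ j, v j s := by
      intro v
      filter_upwards [Lp.coeFn_smul (N : ℂ)⁻¹ (∑ j, v j),
        Lp.coeFn_finsetSum Finset.univ (fun j => v j)] with s h1 h2
      rw [edgeMean, h1, Pi.smul_apply, h2, smul_eq_mul, Finset.sum_apply]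
    have h2 : ∀ᵐ s ∂(volume.restrict (Ioi (0 : ℝ))),
        S (edgeMean w) s = ((s ^ 2 : ℝ) : ℂ) * S (edgeMean u) s := by
      rw [← hmean, ← hmean]
      filter_upwards [hsum (starTransform N hα u), hsum (starTransform N hα w), ae_all_iff.2 h]
        with s h3 h4 h5
      rw [h3, h4]
      simp only [h5]
      rw [← Finset.mul_sum]
      ring
    refine ⟨fun j => ?_, h2⟩
    have h3 := h j
    rw [happ, happ] at h3
    filter_upwards [h3, h2, Lp.coeFn_add (T (u j - edgeMean u)) (S (edgeMean u)),
      Lp.coeFn_add (T (w j - edgeMean w)) (S (edgeMean w))] with s h3 h4 h5 h6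
    rw [h5, h6, Pi.add_apply, Pi.add_apply, h4] at h3
    linear_combination h3

/-- The spectral measure of the star graph Hamiltonian. -/
noncomputable def starPVM (N : ℕ) [NeZero N] {α : ℝ} (hα : 0 < α) : PVM (StarL2 N) :=
  squarePVM (starTransform N hα)

theorem starPVM_isSpectralMeasureOf [NeZero N] {α : ℝ} (hα : 0 < α) :
    (starPVM N hα).IsSpectralMeasureOf (starHamiltonian N α) :=
  squarePVM_isSpectralMeasureOf _ _ fun u w => by
    rw [starHamiltonian_graph]
    exact mem_starGraph_iff_starTransform hα u w

/-- The spectral density of the star graph Hamiltonian. -/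
noncomputable def starDensity (N : ℕ) (k w x y : ℝ) : Matrix (Fin N) (Fin N) ℝ :=
  Matrix.of fun j l => ((if j = l then 1 else 0) - (N : ℝ)⁻¹) *
    (robinEigen 0 w x * robinEigen 0 w y) + (N : ℝ)⁻¹ * (robinEigen k w x * robinEigen k w y)

theorem intervalIntegrable_robinEigen_mul (k a b x y : ℝ) :
    IntervalIntegrable (fun w => robinEigen k w x * robinEigen k w y) volume a b := by
  refine Continuous.intervalIntegrable ?_ _ _
  exact ((continuous_robinEigen k).comp (by fun_prop : Continuous fun w : ℝ => (w, x))).mul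
    ((continuous_robinEigen k).comp (by fun_prop : Continuous fun w : ℝ => (w, y)))

theorem projKernel_starDensity (k Λ x y : ℝ) (j l : Fin N) :
    projKernel (starDensity N k) Λ x y j l = ((if j = l then 1 else 0) - (N : ℝ)⁻¹) *
      robinKernel 0 (√Λ) x y + (N : ℝ)⁻¹ * robinKernel k (√Λ) x y := by
  simp only [projKernel, starDensity, Matrix.of_apply, robinKernel]
  rw [intervalIntegral.integral_add ((intervalIntegrable_robinEigen_mul _ _ _ _ _).const_mul _)
    ((intervalIntegrable_robinEigen_mul _ _ _ _ _).const_mul _),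
    intervalIntegral.integral_const_mul, intervalIntegral.integral_const_mul]

theorem continuous_starDensity (N : ℕ) (k : ℝ) :
    Continuous fun p : ℝ × ℝ × ℝ => starDensity N k p.1 p.2.1 p.2.2 := by
  refine continuous_matrix fun j l => ?_
  simp only [starDensity, Matrix.of_apply]
  have h : ∀ k : ℝ, Continuous fun p : ℝ × ℝ × ℝ => robinEigen k p.1 p.2.1 * robinEigen k p.1 p.2.2 :=
    fun k => ((continuous_robinEigen k).comp
      (by fun_prop : Continuous fun p : ℝ × ℝ × ℝ => (p.1, p.2.1))).mul
      ((continuous_robinEigen k).comp (by fun_prop : Continuous fun p : ℝ × ℝ × ℝ => (p.1, p.2.2)))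
  exact ((h 0).const_mul _).add ((h k).const_mul _)

theorem preimage_sq_Icc {Λ : ℝ} (hΛ : 0 ≤ Λ) :
    (fun s : ℝ => s ^ 2) ⁻¹' (Icc 0 Λ) = Icc (-√Λ) (√Λ) := by
  ext s
  simp only [mem_preimage, mem_Icc, sq_nonneg, true_and]
  rw [← abs_le]
  refine ⟨Real.abs_le_sqrt, fun h => ?_⟩
  rw [← sq_abs, ← Real.sq_sqrt hΛ]
  exact pow_le_pow_left₀ (abs_nonneg s) h 2

/-- The edge matrices `δ_jl - 1/N` and `1/N` project onto deviations and onto the mean; each is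
paired with the kernel of its half-line problem. -/
theorem starPVM_isSpectralDensity [NeZero N] {α : ℝ} (hα : 0 < α) :
    IsSpectralDensity (starPVM N hα) (starDensity N (N / α)) := by
  refine ⟨(continuous_starDensity N _).continuousOn, fun Λ hΛ u _ j => ?_⟩
  have hk := div_nonneg_of_pos (N := N) hα
  have hW := Real.sqrt_nonneg Λ
  set W := √Λ with hWdef
  set T := robinTransform (le_refl (0 : ℝ)) with hT
  set S := robinTransform hk with hS
  have hproj : (starPVM N hα).proj (Icc 0 Λ) u j
      = robinProj le_rfl (Icc (-W) W) (u j - edgeMean u) + robinProj hk (Icc (-W) W) (edgeMean u) := by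
    set v := starInd (Icc (-W) W) (starTransform N hα u) with hv
    have hvj : ∀ j, v j = indOp (Icc (-W) W) (T (u j - edgeMean u))
        + indOp (Icc (-W) W) (S (edgeMean u)) := fun j => by
      rw [hv, starInd_apply, ← map_add]
      rfl
    have hmean : edgeMean v = indOp (Icc (-W) W) (S (edgeMean u)) :=
      edgeMean_eq v _ _ (by rw [← map_sum, ← map_sum, sum_sub_edgeMean, map_zero, map_zero]) hvj
    have h1 : (starPVM N hα).proj (Icc 0 Λ) u = (starTransform N hα).symm v := by
      rw [starPVM, squarePVM_proj, preimage_sq_Icc hΛ]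
    rw [h1, starTransform, starMix_symm_apply, hmean, hvj, add_sub_cancel_right]
    rfl
  have hi : ∀ {k : ℝ} (_ : 0 ≤ k) (x : ℝ) (g : HalfL2),
      IntegrableOn (fun y => (robinKernel k W x y : ℂ) * g y) (Ioi 0) :=
    fun hk x g => MemLp.integrable_mul (memLp_robinKernel hk hW x) (Lp.memLp g)
  have hmul : ∀ (x : ℝ) {k : ℝ} (_ : 0 ≤ k),
      ∫ y in Ioi (0 : ℝ), (robinKernel k W x y : ℂ) * edgeMean u y
        = ∑ l, ((N : ℝ)⁻¹ : ℝ) * ∫ y in Ioi (0 : ℝ), (robinKernel k W x y : ℂ) * u l y := by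
    intro x k hk
    rw [← Finset.mul_sum, ← integral_finsetSum _ fun l _ => hi hk x (u l), ← integral_const_mul]
    refine integral_congr_ae ?_
    filter_upwards [Lp.coeFn_smul (N : ℂ)⁻¹ (∑ j, u j),
      Lp.coeFn_finsetSum Finset.univ (fun j => u j)] with y h1 h2
    rw [edgeMean, h1, Pi.smul_apply, h2, smul_eq_mul, Finset.sum_apply, ← Finset.mul_sum]
    push_cast
    ring
  rw [hproj]
  filter_upwards [Lp.coeFn_add (robinProj le_rfl (Icc (-W) W) (u j - edgeMean u))
    (robinProj hk (Icc (-W) W) (edgeMean u)), robinProj_ae le_rfl hW (u j - edgeMean u),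
    robinProj_ae hk hW (edgeMean u)] with x h1 h2 h3
  rw [h1, Pi.add_apply, h2, h3, hmul x hk]
  have h4 : ∫ y in Ioi (0 : ℝ), (robinKernel 0 W x y : ℂ) * (u j - edgeMean u : HalfL2) y
      = (∫ y in Ioi (0 : ℝ), (robinKernel 0 W x y : ℂ) * u j y)
        - ∫ y in Ioi (0 : ℝ), (robinKernel 0 W x y : ℂ) * edgeMean u y := by
    rw [← integral_sub (hi le_rfl x (u j)) (hi le_rfl x (edgeMean u))]
    refine integral_congr_ae ?_
    filter_upwards [Lp.coeFn_sub (u j) (edgeMean u)] with y hy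
    rw [hy, Pi.sub_apply, mul_sub]
  have h5 : ∫ y in Ioi (0 : ℝ), (robinKernel 0 W x y : ℂ) * u j y
      = ∑ l, ((if j = l then 1 else 0 : ℝ) : ℂ) *
        ∫ y in Ioi (0 : ℝ), (robinKernel 0 W x y : ℂ) * u l y := by
    rw [Finset.sum_eq_single j]
    · simp
    · intro l _ hl
      simp [hl.symm]
    · simp
  rw [h4, h5, hmul x le_rfl, ← Finset.sum_sub_distrib, ← Finset.sum_add_distrib]
  refine Finset.sum_congr rfl fun l _ => ?_
  have h6 : ∫ y in Ioi (0 : ℝ), (projKernel (starDensity N (N / α)) Λ x y j l : ℂ) * u l y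
      = (((if j = l then 1 else 0) - (N : ℝ)⁻¹ : ℝ) : ℂ) *
          (∫ y in Ioi (0 : ℝ), (robinKernel 0 W x y : ℂ) * u l y)
        + ((N : ℝ)⁻¹ : ℝ) * ∫ y in Ioi (0 : ℝ), (robinKernel (N / α) W x y : ℂ) * u l y := by
    rw [← integral_const_mul, ← integral_const_mul,
      ← integral_add ((hi le_rfl x (u l)).const_mul _) ((hi hk x (u l)).const_mul _)]
    refine integral_congr_ae (ae_of_all _ fun y => ?_)
    simp only [projKernel_starDensity, ← hWdef]
    rw [Complex.ofReal_add, Complex.ofReal_mul, Complex.ofReal_mul]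
    ring
  rw [h6]
  push_cast
  ring

end StarHamiltonian

/-! ## Uniqueness of the spectral density -/

theorem eq_zero_of_forall_primitive {f : ℝ → ℝ} (hf : Continuous f)
    (h : ∀ t, 0 < t → ∫ s in (0 : ℝ)..t, f s = 0) {t : ℝ} (ht : 0 < t) : f t = 0 := by
  have h1 : HasDerivAt (fun t => ∫ s in (0 : ℝ)..t, f s) (f t) t :=
    intervalIntegral.integral_hasDerivAt_right (hf.intervalIntegrable _ _)
      hf.aestronglyMeasurable.stronglyMeasurableAtFilter hf.continuousAt
  have h2 : HasDerivAt (fun t => ∫ s in (0 : ℝ)..t, f s) 0 t := by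
    refine (hasDerivAt_const t (0 : ℝ)).congr_of_eventuallyEq ?_
    filter_upwards [Ioi_mem_nhds ht] with s hs
    exact h s hs
  exact h1.unique h2

section Uniqueness

variable {N : ℕ}

/-- The entry `(j,l)` of `σ`, extended continuously from the positive octant. -/
noncomputable def octantEntry (σ : ℝ → ℝ → ℝ → Matrix (Fin N) (Fin N) ℝ) (j l : Fin N)
    (w x y : ℝ) : ℝ :=
  σ (max w 0) (max x 0) (max y 0) j l

theorem octantEntry_eq (σ : ℝ → ℝ → ℝ → Matrix (Fin N) (Fin N) ℝ) (j l : Fin N) {w x y : ℝ}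
    (hw : 0 ≤ w) (hx : 0 ≤ x) (hy : 0 ≤ y) : octantEntry σ j l w x y = σ w x y j l := by
  rw [octantEntry, max_eq_left hw, max_eq_left hx, max_eq_left hy]

theorem continuous_octantEntry {P : PVM (StarL2 N)} {σ : ℝ → ℝ → ℝ → Matrix (Fin N) (Fin N) ℝ}
    (h : IsSpectralDensity P σ) (j l : Fin N) :
    Continuous fun p : ℝ × ℝ × ℝ => octantEntry σ j l p.1 p.2.1 p.2.2 := by
  have h1 : Continuous fun p : ℝ × ℝ × ℝ => σ (max p.1 0) (max p.2.1 0) (max p.2.2 0) :=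
    h.continuousOn.comp_continuous
      (f := fun p : ℝ × ℝ × ℝ => (max p.1 0, max p.2.1 0, max p.2.2 0)) (by fun_prop)
      (fun p => ⟨le_max_right p.1 0, le_max_right p.2.1 0, le_max_right p.2.2 0⟩)
  exact h1.matrix_elem j l

theorem projKernel_eq_octantEntry (σ : ℝ → ℝ → ℝ → Matrix (Fin N) (Fin N) ℝ) (Λ : ℝ)
    (j l : Fin N) {x y : ℝ} (hx : 0 ≤ x) (hy : 0 ≤ y) :
    projKernel σ Λ x y j l = ∫ w in (0 : ℝ)..√Λ, octantEntry σ j l w x y := by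
  rw [projKernel, Matrix.of_apply]
  refine intervalIntegral.integral_congr fun w hw => ?_
  rw [uIcc_of_le (Real.sqrt_nonneg _)] at hw
  exact (octantEntry_eq σ j l hw.1 hx hy).symm

variable {P P' : PVM (StarL2 N)} {σ σ' : ℝ → ℝ → ℝ → Matrix (Fin N) (Fin N) ℝ}

theorem restrict_Ioi_Ioc_ne_top (t : ℝ) : volume.restrict (Ioi (0 : ℝ)) (Ioc (0 : ℝ) t) ≠ ∞ :=
  ((Measure.restrict_apply_le _ _).trans_lt measure_Ioc_lt_top).ne

/-- Testing on the indicator of `(0, t]` on edge `l` isolates one matrix entry and exposes its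
primitive in `y`. -/
theorem IsSpectralDensity.proj_single_ae (h : IsSpectralDensity P σ) {Λ : ℝ} (hΛ : 0 ≤ Λ)
    (j l : Fin N) {t : ℝ} (ht : 0 < t) :
    P.proj (Icc 0 Λ) (WithLp.toLp 2 fun i => if i = l then
      indicatorConstLp 2 (measurableSet_Ioc (a := (0 : ℝ)) (b := t))
        (restrict_Ioi_Ioc_ne_top t) (1 : ℂ) else 0) j
      =ᵐ[volume.restrict (Ioi (0 : ℝ))]
      fun x => ((∫ y in (0 : ℝ)..t, ∫ w in (0 : ℝ)..√Λ, octantEntry σ j l w x y : ℝ) : ℂ) := by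
  have hone := indicatorConstLp_coeFn (p := 2) (hs := measurableSet_Ioc (a := (0 : ℝ)) (b := t))
    (hμs := restrict_Ioi_Ioc_ne_top t) (c := (1 : ℂ))
  have hzero := Lp.coeFn_zero ℂ 2 (volume.restrict (Ioi (0 : ℝ)))
  refine (h.kernel Λ hΛ _ ⟨t, fun i => ?_⟩ j).trans ?_
  · by_cases hi : i = l
    · simp only [hi, if_true]
      filter_upwards [hone] with y hy hty
      rw [hy, indicator_of_notMem]
      exact fun hmem => absurd hmem.2 (not_le.2 hty)
    · simp only [hi, if_false]
      filter_upwards [hzero] with y hy _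
      rw [hy, Pi.zero_apply]
  · filter_upwards [ae_restrict_mem measurableSet_Ioi] with x hx
    have hx0 : 0 ≤ x := le_of_lt hx
    rw [Finset.sum_eq_single l]
    · simp only [if_true]
      rw [intervalIntegral.integral_of_le ht.le, ← integral_complex_ofReal]
      have hI : ∀ f : ℝ → ℂ, ∫ y in Ioc 0 t, f y = ∫ y in Ioi 0, (Ioc 0 t).indicator f y :=
        fun f => by
          rw [setIntegral_indicator measurableSet_Ioc, inter_eq_right.2 Ioc_subset_Ioi_self]
      rw [hI]
      refine integral_congr_ae ?_
      filter_upwards [hone, ae_restrict_mem measurableSet_Ioi] with y hy hy0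
      rw [hy, projKernel_eq_octantEntry σ Λ j l hx0 (le_of_lt hy0)]
      by_cases hyt : y ∈ Ioc 0 t
      · rw [indicator_of_mem hyt, indicator_of_mem hyt, mul_one]
      · rw [indicator_of_notMem hyt, indicator_of_notMem hyt, mul_zero]
    · intro i _ hi
      simp only [hi, if_false]
      refine integral_eq_zero_of_ae ?_
      filter_upwards [hzero] with y hy
      rw [hy]
      simp
    · simp

/-- Almost everywhere equality in `x` is equality everywhere by continuity; differentiating in `t`
then removes the integral in `y`. -/
theorem IsSpectralDensity.projKernel_eq (h : IsSpectralDensity P σ) (h' : IsSpectralDensity P' σ')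
    (hP : ∀ Λ, 0 ≤ Λ → P.proj (Icc 0 Λ) = P'.proj (Icc 0 Λ)) {Λ x y : ℝ} (hΛ : 0 ≤ Λ)
    (hx : 0 < x) (hy : 0 < y) (j l : Fin N) :
    projKernel σ Λ x y j l = projKernel σ' Λ x y j l := by
  have hc : ∀ {P : PVM (StarL2 N)} {σ : ℝ → ℝ → ℝ → Matrix (Fin N) (Fin N) ℝ},
      IsSpectralDensity P σ → Continuous fun p : ℝ × ℝ => ∫ w in (0 : ℝ)..√Λ,
        octantEntry σ j l w p.1 p.2 := by
    intro P σ h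
    refine intervalIntegral.continuous_parametric_intervalIntegral_of_continuous' ?_ _ _
    exact (continuous_octantEntry h j l).comp
      (by fun_prop : Continuous fun q : (ℝ × ℝ) × ℝ => (q.2, q.1.1, q.1.2))
  have hc2 : ∀ {P : PVM (StarL2 N)} {σ : ℝ → ℝ → ℝ → Matrix (Fin N) (Fin N) ℝ},
      IsSpectralDensity P σ → ∀ t, Continuous fun x : ℝ => ∫ y in (0 : ℝ)..t,
        ∫ w in (0 : ℝ)..√Λ, octantEntry σ j l w x y := by
    intro P σ h t
    refine intervalIntegral.continuous_parametric_intervalIntegral_of_continuous' ?_ _ _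
    exact hc h
  have h1 : ∀ t, 0 < t → ∫ y in (0 : ℝ)..t, ((∫ w in (0 : ℝ)..√Λ, octantEntry σ j l w x y)
      - ∫ w in (0 : ℝ)..√Λ, octantEntry σ' j l w x y) = 0 := by
    intro t ht
    have h2 := h.proj_single_ae hΛ j l ht
    rw [hP Λ hΛ] at h2
    have h3 := h2.symm.trans (h'.proj_single_ae hΛ j l ht)
    have h4 := Measure.eqOn_open_of_ae_eq h3 isOpen_Ioi
      (Complex.continuous_ofReal.comp (hc2 h t)).continuousOn
      (Complex.continuous_ofReal.comp (hc2 h' t)).continuousOn hx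
    have h5 := Complex.ofReal_injective h4
    have hi : ∀ {P : PVM (StarL2 N)} {σ : ℝ → ℝ → ℝ → Matrix (Fin N) (Fin N) ℝ},
        IsSpectralDensity P σ → IntervalIntegrable (fun y => ∫ w in (0 : ℝ)..√Λ,
          octantEntry σ j l w x y) volume 0 t := fun h =>
      ((hc h).comp (by fun_prop : Continuous fun y : ℝ => (x, y))).intervalIntegrable _ _
    rw [intervalIntegral.integral_sub (hi h) (hi h'), h5, sub_self]
  have h2 := eq_zero_of_forall_primitive
    (((hc h).comp (by fun_prop : Continuous fun y : ℝ => (x, y))).sub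
      ((hc h').comp (by fun_prop : Continuous fun y : ℝ => (x, y)))) h1 hy
  rw [projKernel_eq_octantEntry σ Λ j l hx.le hy.le, projKernel_eq_octantEntry σ' Λ j l hx.le hy.le]
  exact sub_eq_zero.1 h2

theorem IsSpectralDensity.eq_of_pos (h : IsSpectralDensity P σ) (h' : IsSpectralDensity P' σ')
    (hP : ∀ Λ, 0 ≤ Λ → P.proj (Icc 0 Λ) = P'.proj (Icc 0 Λ)) {w x y : ℝ} (hw : 0 < w)
    (hx : 0 < x) (hy : 0 < y) (j l : Fin N) : σ w x y j l = σ' w x y j l := by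
  have hc : ∀ {P : PVM (StarL2 N)} {σ : ℝ → ℝ → ℝ → Matrix (Fin N) (Fin N) ℝ},
      IsSpectralDensity P σ → Continuous fun w => octantEntry σ j l w x y := fun h =>
    (continuous_octantEntry h j l).comp (by fun_prop : Continuous fun w : ℝ => (w, x, y))
  have h1 := eq_zero_of_forall_primitive ((hc h).sub (hc h')) (fun t ht => by
    have h2 := h.projKernel_eq h' hP (sq_nonneg t) hx hy j l
    rw [projKernel_eq_octantEntry σ _ j l hx.le hy.le, projKernel_eq_octantEntry σ' _ j l hx.le hy.le,
      Real.sqrt_sq ht.le] at h2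
    simp only [Pi.sub_apply]
    rw [intervalIntegral.integral_sub ((hc h).intervalIntegrable _ _)
      ((hc h').intervalIntegrable _ _), h2, sub_self]) hw
  rw [← octantEntry_eq σ j l hw.le hx.le hy.le, ← octantEntry_eq σ' j l hw.le hx.le hy.le]
  exact sub_eq_zero.1 h1

end Uniqueness

/-! ## The trace of the spectral density -/

/-- The Weyl-subtracted trace of the spectral density. -/
noncomputable def weylDefect (N k w x : ℝ) : ℝ :=
  1 / Real.pi * ((-N + 2 * (k ^ 2 * w ^ 2) / (1 + k ^ 2 * w ^ 2)) * Real.cos (2 * w * x)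
    + 2 * k * w / (1 + k ^ 2 * w ^ 2) * Real.sin (2 * w * x))

theorem robinEigen_mul_self (k w x : ℝ) : robinEigen k w x * robinEigen k w x =
    1 / Real.pi * (1 + ((k ^ 2 * w ^ 2 - 1) * Real.cos (2 * w * x)
      + 2 * k * w * Real.sin (2 * w * x)) / (1 + k ^ 2 * w ^ 2)) := by
  have hs : √(1 + k ^ 2 * w ^ 2) ^ 2 = 1 + k ^ 2 * w ^ 2 := Real.sq_sqrt (by positivity)
  have h2 : √(2 / Real.pi) ^ 2 = 2 / Real.pi := Real.sq_sqrt (by positivity)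
  have h3 : robinEigen k w x * robinEigen k w x = √(2 / Real.pi) ^ 2 *
      ((k * w * Real.cos (w * x) + Real.sin (w * x)) ^ 2 / √(1 + k ^ 2 * w ^ 2) ^ 2) := by
    rw [robinEigen]
    ring
  rw [h3, hs, h2, mul_assoc 2 w x, Real.cos_two_mul, Real.sin_two_mul]
  have h4 : 1 + k ^ 2 * w ^ 2 ≠ 0 := by positivity
  have h5 := Real.sin_sq_add_cos_sq (w * x)
  field_simp
  linear_combination 2 * h5

/-- By the double angle formulas, each of the `N - 1` Dirichlet channels contributes `-cos 2wx / π`;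
the mean contributes the Robin term, whose cosine coefficient is `-1 + 2k²w²/(1 + k²w²)`. -/
theorem weylSubtractedDensity_starDensity {N : ℕ} [NeZero N] (k w x : ℝ) :
    weylSubtractedDensity (starDensity N k) w x = weylDefect N k w x := by
  have hN : (N : ℝ) ≠ 0 := NeZero.ne _
  simp only [weylSubtractedDensity, starDensity, Matrix.of_apply, if_true, Finset.sum_const,
    Finset.card_univ, Fintype.card_fin, nsmul_eq_mul, robinEigen_mul_self, weylDefect]
  have h4 : 1 + k ^ 2 * w ^ 2 ≠ 0 := by positivity
  have h5 := Real.sin_sq_add_cos_sq (w * x)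
  field_simp
  ring

/-! ## The sine integral -/

theorem integrable_exp_neg_mul_mul_sin (T : ℝ) :
    Integrable (fun p : ℝ × ℝ => Real.exp (-(p.1 * p.2)) * Real.sin p.1)
      ((volume.restrict (Ioc 0 T)).prod (volume.restrict (Ioi 0))) := by
  rw [integrable_prod_iff (by fun_prop)]
  constructor
  · filter_upwards [ae_restrict_mem measurableSet_Ioc] with x hx
    exact (integrableOn_exp_neg_mul hx.1).mul_const _
  · have h1 : ∀ x ∈ Ioc 0 T, ∫ y in Ioi 0, ‖Real.exp (-(x * y)) * Real.sin x‖
        = |Real.sinc x| := fun x hx => by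
      simp_rw [norm_mul, Real.norm_eq_abs, Real.abs_exp]
      rw [integral_mul_const, integral_exp_neg_mul_Ioi hx.1, Real.sinc_of_ne_zero hx.1.ne', abs_div,
        abs_of_pos hx.1]
      simp
      ring
    exact IntegrableOn.congr_fun (Real.continuous_sinc.abs.integrableOn_Ioc)
      (fun x hx => (h1 x hx).symm) measurableSet_Ioc

theorem integral_exp_neg_mul_mul_sin (t T : ℝ) :
    ∫ x in (0 : ℝ)..T, Real.exp (-(x * t)) * Real.sin x =
      (1 + t ^ 2)⁻¹ - Real.exp (-(T * t)) * ((t * Real.sin T + Real.cos T) / (1 + t ^ 2)) := by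
  have h0 : 1 + t ^ 2 ≠ 0 := by positivity
  have hd : ∀ x : ℝ, HasDerivAt
      (fun x => -(Real.exp (-(x * t)) * ((t * Real.sin x + Real.cos x) / (1 + t ^ 2))))
      (Real.exp (-(x * t)) * Real.sin x) x := fun x => by
    have h1 : HasDerivAt (fun x : ℝ => -(x * t)) (-(1 * t)) x := ((hasDerivAt_id x).mul_const t).neg
    have h2 := (h1.exp.mul ((((Real.hasDerivAt_sin x).const_mul t).add
      (Real.hasDerivAt_cos x)).div_const (1 + t ^ 2))).neg
    refine h2.congr_deriv ?_
    simp only [Pi.add_apply]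
    field_simp
    ring
  rw [intervalIntegral.integral_eq_sub_of_hasDerivAt (fun x _ => hd x)
    (Continuous.intervalIntegrable (by fun_prop) _ _)]
  simp
  ring

/-- Writing `1/x` as the integral of `exp(-xt)` and exchanging the order of integration gives `π/2`,
the integral of `1/(1+t²)`, minus a remainder bounded by `2 exp(-Tt)`. -/
theorem abs_integral_sinc_sub_le {T : ℝ} (hT : 0 < T) :
    |(∫ x in (0 : ℝ)..T, Real.sinc x) - Real.pi / 2| ≤ 2 / T := by
  set r : ℝ → ℝ := fun t => Real.exp (-(T * t)) * ((t * Real.sin T + Real.cos T) / (1 + t ^ 2))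
    with hr
  have hb : ∀ t ∈ Ioi (0 : ℝ), ‖r t‖ ≤ Real.exp (-(T * t)) * 2 := fun t ht => by
    rw [hr, norm_mul, Real.norm_eq_abs, Real.abs_exp]
    gcongr
    rw [Real.norm_eq_abs, abs_div, abs_of_pos (by positivity : 0 < 1 + t ^ 2),
      div_le_iff₀ (by positivity)]
    refine (abs_add_le _ _).trans ?_
    rw [abs_mul, abs_of_pos (mem_Ioi.1 ht)]
    have h1 := mul_le_mul_of_nonneg_left (Real.abs_sin_le_one T) (mem_Ioi.1 ht).le
    have h2 := Real.abs_cos_le_one T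
    nlinarith [sq_nonneg (t - 1)]
  have hri : IntegrableOn r (Ioi 0) := by
    refine Integrable.mono' ((integrableOn_exp_neg_mul hT).mul_const 2) ?_ ?_
    · exact (Continuous.mul (by fun_prop)
        (Continuous.div (by fun_prop) (by fun_prop) fun t => by positivity)).aestronglyMeasurable
    · filter_upwards [ae_restrict_mem measurableSet_Ioi] with t ht using hb t ht
  have h1 : ∫ x in (0 : ℝ)..T, Real.sinc x = Real.pi / 2 - ∫ t in Ioi (0 : ℝ), r t := by
    have h2 : ∫ x in (0 : ℝ)..T, Real.sinc x =
        ∫ x in Ioc 0 T, ∫ t in Ioi (0 : ℝ), Real.exp (-(x * t)) * Real.sin x := by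
      rw [intervalIntegral.integral_of_le hT.le]
      refine setIntegral_congr_fun measurableSet_Ioc fun x hx => ?_
      rw [integral_mul_const, integral_exp_neg_mul_Ioi hx.1, Real.sinc_of_ne_zero hx.1.ne', mul_zero,
        neg_zero, Real.exp_zero]
      ring
    rw [h2, integral_integral_swap (integrable_exp_neg_mul_mul_sin T)]
    simp_rw [← intervalIntegral.integral_of_le hT.le, integral_exp_neg_mul_mul_sin]
    rw [integral_sub integrable_inv_one_add_sq.integrableOn hri, integral_Ioi_inv_one_add_sq]
    simp
  rw [h1, sub_sub_cancel_left, abs_neg]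
  refine (norm_integral_le_of_norm_le ((integrableOn_exp_neg_mul hT).mul_const 2)
    (by filter_upwards [ae_restrict_mem measurableSet_Ioi] with t ht using hb t ht)).trans
    (le_of_eq ?_)
  rw [integral_mul_const, integral_exp_neg_mul_Ioi hT]
  simp
  ring

theorem tendsto_integral_sinc :
    Tendsto (fun T => ∫ x in (0 : ℝ)..T, Real.sinc x) atTop (𝓝 (Real.pi / 2)) := by
  rw [tendsto_iff_norm_sub_tendsto_zero]
  refine squeeze_zero' (Eventually.of_forall fun _ => norm_nonneg _) ?_
    (tendsto_const_nhds.div_atTop tendsto_id : Tendsto (fun T : ℝ => 2 / T) atTop (𝓝 0))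
  filter_upwards [eventually_gt_atTop 0] with T hT using abs_integral_sinc_sub_le hT

/-- The constant is crude; what matters is uniformity in `T`, for the dominated convergence as `R →
∞`. -/
theorem abs_integral_sinc_le {T : ℝ} (hT : 0 ≤ T) : |∫ x in (0 : ℝ)..T, Real.sinc x| ≤ 5 := by
  rcases le_total T 1 with h | h
  · have := intervalIntegral.norm_integral_le_of_norm_le_const (a := 0) (b := T) (C := 1)
      (f := Real.sinc) fun x _ => Real.abs_sinc_le_one x
    rw [Real.norm_eq_abs, sub_zero, abs_of_nonneg hT] at this
    linarith
  · have h1 := abs_integral_sinc_sub_le (by linarith : 0 < T)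
    have h2 : 2 / T ≤ 2 := div_le_self (by norm_num) h
    have h3 := abs_le.1 (h1.trans h2)
    rw [abs_le]
    constructor <;> linarith [Real.pi_pos, Real.pi_lt_four, h3.1, h3.2]

/-! ## The counting function -/

theorem tendsto_integral_mul_exp_atTop (f : ℝ → ℝ) (b : ℝ) :
    Tendsto (fun R : ℝ => ∫ s in (0 : ℝ)..b, Complex.exp (((2 * (s * R) : ℝ) : ℂ) * Complex.I) * f s)
      atTop (𝓝 0) := by
  have h1 : ∀ S : Set ℝ, MeasurableSet S → Tendsto (fun R : ℝ =>
      ∫ s in S, Complex.exp (((2 * (s * R) : ℝ) : ℂ) * Complex.I) * f s) atTop (𝓝 0) := fun S hS => by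
    -- Riemann–Lebesgue at frequency `-R/π`, which turns the Fourier character into `exp(2isR)`.
    have h2 := (Real.tendsto_integral_exp_smul_cocompact (S.indicator fun s => (f s : ℂ))).comp
      (tendsto_neg_atTop_atBot.comp (tendsto_id.atTop_div_const Real.pi_pos) |>.mono_right
        atBot_le_cocompact)
    refine h2.congr fun R => ?_
    rw [← integral_indicator hS]
    refine integral_congr_ae (Eventually.of_forall fun s => ?_)
    by_cases hs : s ∈ S
    · simp only [Function.comp_apply, id_eq, indicator_of_mem hs, Circle.smul_def,
        Real.fourierChar_apply, smul_eq_mul]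
      congr 3
      push_cast
      field_simp
    · simp [indicator_of_notMem hs]
  simp only [intervalIntegral]
  simpa using (h1 _ measurableSet_Ioc).sub (h1 (Ioc b 0) measurableSet_Ioc)

theorem tendsto_integral_mul_cos_atTop {f : ℝ → ℝ} (hf : Continuous f) (b : ℝ) :
    Tendsto (fun R : ℝ => ∫ s in (0 : ℝ)..b, f s * Real.cos (2 * s * R)) atTop (𝓝 0) := by
  have h := Complex.continuous_re.continuousAt.tendsto.comp (tendsto_integral_mul_exp_atTop f b)
  refine (h.congr fun R => ?_)
  have h1 := Complex.reCLM.intervalIntegral_comp_comm (μ := volume) (a := 0) (b := b)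
    (f := fun s : ℝ => Complex.exp (((2 * (s * R) : ℝ) : ℂ) * Complex.I) * f s)
    (Continuous.intervalIntegrable (by fun_prop) _ _)
  rw [Function.comp_apply, ← Complex.reCLM_apply, ← h1]
  refine intervalIntegral.integral_congr fun s _ => ?_
  simp only [Complex.reCLM_apply]
  rw [Complex.re_mul_ofReal, Complex.exp_ofReal_mul_I_re, mul_comm, mul_assoc 2 s R]

theorem tendsto_integral_mul_sin_atTop {f : ℝ → ℝ} (hf : Continuous f) (b : ℝ) :
    Tendsto (fun R : ℝ => ∫ s in (0 : ℝ)..b, f s * Real.sin (2 * s * R)) atTop (𝓝 0) := by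
  have h := Complex.continuous_im.continuousAt.tendsto.comp (tendsto_integral_mul_exp_atTop f b)
  refine (h.congr fun R => ?_)
  have h1 := Complex.imCLM.intervalIntegral_comp_comm (μ := volume) (a := 0) (b := b)
    (f := fun s : ℝ => Complex.exp (((2 * (s * R) : ℝ) : ℂ) * Complex.I) * f s)
    (Continuous.intervalIntegrable (by fun_prop) _ _)
  rw [Function.comp_apply, ← Complex.imCLM_apply, ← h1]
  refine intervalIntegral.integral_congr fun s _ => ?_
  simp only [Complex.imCLM_apply]
  rw [Complex.im_mul_ofReal, Complex.exp_ofReal_mul_I_im, mul_comm, mul_assoc 2 s R]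

theorem continuous_weylDefect (N k : ℝ) : Continuous fun p : ℝ × ℝ => weylDefect N k p.1 p.2 := by
  have h : ∀ p : ℝ × ℝ, 1 + k ^ 2 * p.1 ^ 2 ≠ 0 := fun p => by positivity
  unfold weylDefect
  refine continuous_const.mul (((continuous_const.add (Continuous.div (by fun_prop) (by fun_prop) h)).mul
    (by fun_prop)).add ((Continuous.div (by fun_prop) (by fun_prop) h).mul (by fun_prop)))

theorem continuous_div_one_add_sq {g : ℝ → ℝ} (hg : Continuous g) (k : ℝ) :
    Continuous fun s => g s / (1 + k ^ 2 * s ^ 2) :=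
  hg.div (by fun_prop) fun s => by positivity

/-- The quotient `sin(2sR)/(2s)` is written as `R sinc(2Rs)`, so that the formula also holds at `s =
0`. In the other terms the factor `s` in the coefficients cancels the denominator. -/
theorem integral_weylDefect (N k s R : ℝ) :
    ∫ x in (0 : ℝ)..R, weylDefect N k s x = 1 / Real.pi * (-N * (R * Real.sinc (2 * R * s))
      + k ^ 2 * s / (1 + k ^ 2 * s ^ 2) * Real.sin (2 * s * R)
      + (k / (1 + k ^ 2 * s ^ 2) - k / (1 + k ^ 2 * s ^ 2) * Real.cos (2 * s * R))) := by
  rcases eq_or_ne s 0 with rfl | hs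
  · simp [weylDefect]
    ring
  have hd : ∀ x, HasDerivAt (fun x => 1 / Real.pi * ((-N + 2 * (k ^ 2 * s ^ 2) / (1 + k ^ 2 * s ^ 2))
      * (Real.sin (2 * s * x) / (2 * s)) + 2 * k * s / (1 + k ^ 2 * s ^ 2)
      * (-Real.cos (2 * s * x) / (2 * s)))) (weylDefect N k s x) x := fun x => by
    have h1 : HasDerivAt (fun x => 2 * s * x) (2 * s * 1) x := (hasDerivAt_id x).const_mul _
    have h2 := (((h1.sin.div_const (2 * s)).const_mul
      (-N + 2 * (k ^ 2 * s ^ 2) / (1 + k ^ 2 * s ^ 2))).add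
      ((h1.cos.neg.div_const (2 * s)).const_mul (2 * k * s / (1 + k ^ 2 * s ^ 2)))).const_mul
      (1 / Real.pi)
    refine h2.congr_deriv ?_
    rw [weylDefect]
    field_simp
  have h4 : 1 + k ^ 2 * s ^ 2 ≠ 0 := by positivity
  rw [intervalIntegral.integral_eq_sub_of_hasDerivAt (fun x _ => hd x)
    (((continuous_weylDefect N k).comp
      (by fun_prop : Continuous fun x : ℝ => (s, x))).intervalIntegrable _ _)]
  have h5 : R * Real.sinc (2 * R * s) = Real.sin (2 * s * R) / (2 * s) := by
    rcases eq_or_ne R 0 with rfl | hR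
    · simp
    rw [Real.sinc_of_ne_zero (by positivity), mul_right_comm 2 R s]
    field_simp
  rw [h5]
  simp only [mul_zero, Real.sin_zero, Real.cos_zero]
  field_simp
  ring

theorem integral_integral_weylDefect (N k w R : ℝ) :
    ∫ s in (0 : ℝ)..w, ∫ x in (0 : ℝ)..R, weylDefect N k s x =
      1 / Real.pi * (-N / 2 * (∫ y in (0 : ℝ)..2 * R * w, Real.sinc y)
      + (∫ s in (0 : ℝ)..w, k ^ 2 * s / (1 + k ^ 2 * s ^ 2) * Real.sin (2 * s * R))
      + (Real.arctan (k * w)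
        - ∫ s in (0 : ℝ)..w, k / (1 + k ^ 2 * s ^ 2) * Real.cos (2 * s * R))) := by
  have c1 := continuous_div_one_add_sq (by fun_prop : Continuous fun s => k ^ 2 * s) k
  have c2 := continuous_div_one_add_sq (continuous_const : Continuous fun _ : ℝ => k) k
  have c3 : Continuous fun s : ℝ => Real.sinc (2 * R * s) :=
    Real.continuous_sinc.comp (by fun_prop)
  simp_rw [integral_weylDefect]
  rw [intervalIntegral.integral_const_mul, intervalIntegral.integral_add,
    intervalIntegral.integral_add, intervalIntegral.integral_sub,
    intervalIntegral.integral_const_mul, intervalIntegral.integral_const_mul]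
  · congr 3
    · have h := intervalIntegral.smul_integral_comp_mul_left (a := 0) (b := w) Real.sinc (2 * R)
      rw [mul_zero, smul_eq_mul] at h
      rw [← h]
      ring
    · rw [intervalIntegral.integral_eq_sub_of_hasDerivAt
        (fun s _ => hasDerivAt_arctan_mul k s) (c2.intervalIntegrable _ _)]
      simp
  all_goals exact Continuous.intervalIntegrable (by fun_prop) _ _

/-- The sine integral contributes `(1/π)(-N/2)(π/2) = -N/4`. The two oscillating integrals vanish in
the limit, leaving the arctangent. -/
theorem tendsto_integral_integral_weylDefect (N k : ℝ) {w : ℝ} (hw : 0 < w) :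
    Tendsto (fun R : ℝ => ∫ s in (0 : ℝ)..w, ∫ x in (0 : ℝ)..R, weylDefect N k s x) atTop
      (𝓝 (-N / 4 + 1 / Real.pi * Real.arctan (k * w))) := by
  simp_rw [integral_integral_weylDefect]
  have c1 := continuous_div_one_add_sq (by fun_prop : Continuous fun s => k ^ 2 * s) k
  have c2 := continuous_div_one_add_sq (continuous_const : Continuous fun _ : ℝ => k) k
  have h1 : Tendsto (fun R : ℝ => 2 * R * w) atTop atTop :=
    (tendsto_id.const_mul_atTop two_pos).atTop_mul_const hw
  have h := ((((tendsto_integral_sinc.comp h1).const_mul (-N / 2)).add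
    (tendsto_integral_mul_sin_atTop c1 w)).add
    ((tendsto_integral_mul_cos_atTop c2 w).const_sub (Real.arctan (k * w)))).const_mul (1 / Real.pi)
  have e : 1 / Real.pi * (-N / 2 * (Real.pi / 2) + 0 + (Real.arctan (k * w) - 0)) =
      -N / 4 + 1 / Real.pi * Real.arctan (k * w) := by
    field_simp
    ring
  rwa [e] at h

theorem abs_integral_integral_weylDefect_le (N k : ℝ) {w R : ℝ} (hw : 0 ≤ w) (hR : 0 ≤ R) :
    |∫ s in (0 : ℝ)..w, ∫ x in (0 : ℝ)..R, weylDefect N k s x| ≤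
      |1 / Real.pi| * (|-N / 2| * 5 + k ^ 2 * w * w + (Real.pi / 2 + |k| * w)) := by
  have hb : ∀ {f g : ℝ → ℝ} {C : ℝ}, (∀ s ∈ Ioc 0 w, |f s| ≤ C) → (∀ s, |g s| ≤ 1) →
      |∫ s in (0 : ℝ)..w, f s * g s| ≤ C * w := fun {f g C} hf hg => by
    have h := intervalIntegral.norm_integral_le_of_norm_le_const (a := 0) (b := w) (C := C)
      (f := fun s => f s * g s) fun s hs => by
        rw [uIoc_of_le hw] at hs
        rw [norm_mul]
        exact (mul_le_of_le_one_right (norm_nonneg _) (hg s)).trans (hf s hs)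
    rwa [sub_zero, abs_of_nonneg hw] at h
  have hq : ∀ s : ℝ, 1 ≤ 1 + k ^ 2 * s ^ 2 := fun s => by nlinarith [sq_nonneg (k * s)]
  rw [integral_integral_weylDefect, abs_mul]
  refine mul_le_mul_of_nonneg_left ((abs_add_three _ _ _).trans (add_le_add_three ?_ ?_ ?_))
    (abs_nonneg _)
  · rw [abs_mul]
    exact mul_le_mul_of_nonneg_left (abs_integral_sinc_le (by positivity)) (abs_nonneg _)
  · refine hb (fun s hs => ?_) fun s => Real.abs_sin_le_one _
    rw [abs_div, abs_of_pos (by positivity : 0 < 1 + k ^ 2 * s ^ 2),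
      abs_of_nonneg (mul_nonneg (sq_nonneg k) hs.1.le)]
    exact (div_le_self (mul_nonneg (sq_nonneg k) hs.1.le) (hq s)).trans
      (mul_le_mul_of_nonneg_left hs.2 (sq_nonneg k))
  · refine (abs_sub _ _).trans (add_le_add ?_ (hb (fun s hs => ?_) fun s => Real.abs_cos_le_one _))
    · exact abs_le.2 ⟨(Real.neg_pi_div_two_lt_arctan _).le, (Real.arctan_lt_pi_div_two _).le⟩
    · rw [abs_div, abs_of_pos (by positivity : 0 < 1 + k ^ 2 * s ^ 2)]
      exact div_le_self (abs_nonneg _) (hq s)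

/-! ## The global density -/

theorem integral_Ioi_eq_intervalIntegral {f : ℝ → ℝ} {b : ℝ} (hb : 0 ≤ b)
    (h : ∀ w, b ≤ w → f w = 0) : ∫ w in Ioi (0 : ℝ), f w = ∫ w in (0 : ℝ)..b, f w := by
  rw [intervalIntegral.integral_of_le hb]
  refine (setIntegral_eq_of_subset_of_forall_sdiff_eq_zero measurableSet_Ioi Ioc_subset_Ioi_self
    fun w hw => h w ?_)
  by_contra hlt
  exact hw.2 ⟨hw.1, (not_le.1 hlt).le⟩

theorem HasCompactSupport.exists_pos_eq_zero {f : ℝ → ℝ} (hf : HasCompactSupport f) :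
    ∃ b, 0 < b ∧ ∀ w, b ≤ w → f w = 0 := by
  obtain ⟨b, hb, h⟩ := hf.exists_pos_le_norm
  exact ⟨b, hb, fun w hw => h w (hw.trans (le_abs_self w))⟩

/-- Two integrations by parts condensed into one primitive: the terms in `g'` and `h'` cancel and
only second derivatives over `4x²` remain. -/
theorem hasDerivAt_oscillatory_primitive {g g₁ g₂ h h₁ h₂ x w : ℝ} {G G' H H' : ℝ → ℝ} (hx : x ≠ 0)
    (hG : HasDerivAt G g₁ w) (hG' : HasDerivAt G' g₂ w) (hH : HasDerivAt H h₁ w)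
    (hH' : HasDerivAt H' h₂ w) (eG : G w = g) (eG' : G' w = g₁) (eH : H w = h) (eH' : H' w = h₁) :
    HasDerivAt (fun w => (G w * Real.sin (2 * w * x) - H w * Real.cos (2 * w * x)) / (2 * x)
      + (G' w * Real.cos (2 * w * x) + H' w * Real.sin (2 * w * x)) / (4 * x ^ 2))
      (g * Real.cos (2 * w * x) + h * Real.sin (2 * w * x)
        + (g₂ * Real.cos (2 * w * x) + h₂ * Real.sin (2 * w * x)) / (4 * x ^ 2)) w := by
  have h1 : HasDerivAt (fun w => 2 * w * x) (2 * 1 * x) w :=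
    ((hasDerivAt_id w).const_mul 2).mul_const x
  have h3 := ((hG.mul h1.sin).sub (hH.mul h1.cos)).div_const (2 * x)
  have h4 := ((hG'.mul h1.cos).add (hH'.mul h1.sin)).div_const (4 * x ^ 2)
  refine (h3.add h4).congr_deriv ?_
  rw [eG, eG', eH, eH']
  field_simp
  ring

/-- The boundary term of order `1/x` is proportional to `h 0`. Since it vanishes, the boundary and
integral terms left are of order `x^(-2)`, which is integrable at infinity. -/
theorem exists_abs_integral_oscillatory_le {g h : ℝ → ℝ} (hg : ContDiff ℝ 2 g) (hh : ContDiff ℝ 2 h)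
    (hgs : HasCompactSupport g) (hhs : HasCompactSupport h) (h0 : h 0 = 0) :
    ∃ C, ∀ x, 0 < x → |∫ w in Ioi (0 : ℝ), (g w * Real.cos (2 * w * x) + h w * Real.sin (2 * w * x))|
      ≤ C * x ^ (-2 : ℝ) := by
  have hg' : ContDiff ℝ 1 (deriv g) := hg.deriv'
  have hh' : ContDiff ℝ 1 (deriv h) := hh.deriv'
  have hg'' : Continuous (deriv (deriv g)) := hg'.continuous_deriv le_rfl
  have hh'' : Continuous (deriv (deriv h)) := hh'.continuous_deriv le_rfl
  have ig : Integrable (deriv (deriv g)) := hg''.integrable_of_hasCompactSupport hgs.deriv.deriv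
  have ih : Integrable (deriv (deriv h)) := hh''.integrable_of_hasCompactSupport hhs.deriv.deriv
  refine ⟨(|deriv g 0| + ∫ w in Ioi (0 : ℝ), (|deriv (deriv g) w| + |deriv (deriv h) w|)) / 4,
    fun x hx => ?_⟩
  set F : ℝ → ℝ := fun w => (g w * Real.sin (2 * w * x) - h w * Real.cos (2 * w * x)) / (2 * x)
      + (deriv g w * Real.cos (2 * w * x) + deriv h w * Real.sin (2 * w * x)) / (4 * x ^ 2) with hF
  have hg1 : ContDiff ℝ 1 g := hg.of_le (by norm_num)
  have hh1 : ContDiff ℝ 1 h := hh.of_le (by norm_num)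
  have hs : ContDiff ℝ 1 fun w : ℝ => Real.sin (2 * w * x) :=
    Real.contDiff_sin.comp ((contDiff_const.mul contDiff_id).mul contDiff_const)
  have hc : ContDiff ℝ 1 fun w : ℝ => Real.cos (2 * w * x) :=
    Real.contDiff_cos.comp ((contDiff_const.mul contDiff_id).mul contDiff_const)
  have hFc : ContDiff ℝ 1 F := (((hg1.mul hs).sub (hh1.mul hc)).div_const _).add
    (((hg'.mul hc).add (hh'.mul hs)).div_const _)
  have hFs : HasCompactSupport F := by
    simp only [hF, div_eq_mul_inv]
    exact ((hgs.mul_right.sub hhs.mul_right).mul_right).add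
      ((hgs.deriv.mul_right.add hhs.deriv.mul_right).mul_right)
  have hd : deriv F = fun w => (g w * Real.cos (2 * w * x) + h w * Real.sin (2 * w * x)) +
      (deriv (deriv g) w * Real.cos (2 * w * x) + deriv (deriv h) w * Real.sin (2 * w * x))
        / (4 * x ^ 2) := by
    ext w
    have hda : ∀ {f : ℝ → ℝ}, ContDiff ℝ 1 f → HasDerivAt f (deriv f w) w := fun hf =>
      (hf.differentiable one_ne_zero w).hasDerivAt
    exact (hasDerivAt_oscillatory_primitive hx.ne' (hda hg1) (hda hg') (hda hh1) (hda hh')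
      rfl rfl rfl rfl).deriv
  have i1 : Integrable fun w => g w * Real.cos (2 * w * x) + h w * Real.sin (2 * w * x) :=
    ((hg1.continuous.mul hc.continuous).add
      (hh1.continuous.mul hs.continuous)).integrable_of_hasCompactSupport
      (hgs.mul_right.add hhs.mul_right)
  have i2 : Integrable fun w => (deriv (deriv g) w * Real.cos (2 * w * x)
      + deriv (deriv h) w * Real.sin (2 * w * x)) / (4 * x ^ 2) :=
    (((hg''.mul hc.continuous).add
      (hh''.mul hs.continuous)).integrable_of_hasCompactSupport
      (hgs.deriv.deriv.mul_right.add hhs.deriv.deriv.mul_right)).div_const _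
  have hI := hFs.integral_Ioi_deriv_eq hFc 0
  rw [hd, integral_add i1.integrableOn i2.integrableOn, integral_div] at hI
  have hF0 : F 0 = deriv g 0 / (4 * x ^ 2) := by
    simp [hF, h0]
  have hB : |∫ w in Ioi (0 : ℝ), (deriv (deriv g) w * Real.cos (2 * w * x)
      + deriv (deriv h) w * Real.sin (2 * w * x))| ≤
      ∫ w in Ioi (0 : ℝ), (|deriv (deriv g) w| + |deriv (deriv h) w|) := by
    rw [← Real.norm_eq_abs]
    refine norm_integral_le_of_norm_le
      (g := fun w => |deriv (deriv g) w| + |deriv (deriv h) w|)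
      (ig.norm.add ih.norm).integrableOn (Eventually.of_forall fun w => ?_)
    refine (norm_add_le _ _).trans (add_le_add ?_ ?_)
    · rw [norm_mul]
      exact mul_le_of_le_one_right (norm_nonneg _) (Real.abs_cos_le_one _)
    · rw [norm_mul]
      exact mul_le_of_le_one_right (norm_nonneg _) (Real.abs_sin_le_one _)
  have e : x ^ (-2 : ℝ) = (x ^ 2)⁻¹ := by
    rw [Real.rpow_neg hx.le]
    norm_num
  rw [eq_sub_of_add_eq hI, hF0, e]
  refine (abs_sub _ _).trans ?_
  rw [abs_neg, abs_div, abs_div, abs_of_pos (by positivity : 0 < 4 * x ^ 2), ← add_div,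
    ← div_eq_mul_inv, div_div]
  gcongr

/-! ### Pairing the Weyl-subtracted trace with test functions -/

section Pairing

variable (N k : ℝ) {φ : ℝ → ℝ}

theorem integrableOn_weylDefect_mul (hφ : Continuous φ) (hs : HasCompactSupport φ) (x : ℝ) :
    IntegrableOn (fun w => weylDefect N k w x * φ w) (Ioi 0) :=
  ((((continuous_weylDefect N k).comp
    (by fun_prop : Continuous fun w : ℝ => (w, x))).mul hφ).integrable_of_hasCompactSupport
    hs.mul_left).integrableOn

theorem continuous_integral_weylDefect_mul (hφ : Continuous φ) (hs : HasCompactSupport φ) :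
    Continuous fun x => ∫ w in Ioi (0 : ℝ), weylDefect N k w x * φ w := by
  obtain ⟨b, hb, h⟩ := hs.exists_pos_eq_zero
  simp_rw [fun x => integral_Ioi_eq_intervalIntegral (f := fun w => weylDefect N k w x * φ w) hb.le
    fun w hw => by rw [h w hw, mul_zero]]
  refine intervalIntegral.continuous_parametric_intervalIntegral_of_continuous' ?_ 0 b
  exact ((continuous_weylDefect N k).comp (by fun_prop : Continuous fun p : ℝ × ℝ => (p.2, p.1))).mul
    (by fun_prop)

theorem contDiff_div_one_add_sq {g : ℝ → ℝ} (hg : ContDiff ℝ 2 g) :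
    ContDiff ℝ 2 fun w => g w / (1 + k ^ 2 * w ^ 2) :=
  hg.div (contDiff_const.add (contDiff_const.mul (contDiff_id.pow 2))) fun w => by positivity

theorem integrableOn_integral_weylDefect_mul (hφ : ContDiff ℝ 2 φ) (hs : HasCompactSupport φ) :
    IntegrableOn (fun x => ∫ w in Ioi (0 : ℝ), weylDefect N k w x * φ w) (Ioi 0) := by
  have hc := continuous_integral_weylDefect_mul N k hφ.continuous hs
  have c1 : ContDiff ℝ 2 fun w : ℝ => 1 / Real.pi * (-N + 2 * (k ^ 2 * w ^ 2) / (1 + k ^ 2 * w ^ 2)) :=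
    contDiff_const.mul (contDiff_const.add (contDiff_div_one_add_sq k
      (contDiff_const.mul (contDiff_const.mul (contDiff_id.pow 2)))))
  have c2 : ContDiff ℝ 2 fun w : ℝ => 1 / Real.pi * (2 * k * w / (1 + k ^ 2 * w ^ 2)) :=
    contDiff_const.mul (contDiff_div_one_add_sq k (contDiff_const.mul contDiff_id))
  -- The sine coefficient carries a factor `w`, hence vanishes at `0` as required. Near `x = 0`,
  -- continuity in `x` suffices.
  obtain ⟨C, hC⟩ := exists_abs_integral_oscillatory_le (c1.mul hφ) (c2.mul hφ) hs.mul_left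
    hs.mul_left (by simp)
  set L : ℝ → ℝ := fun x => ∫ w in Ioi (0 : ℝ), weylDefect N k w x * φ w
  rw [← Ioc_union_Ioi_eq_Ioi zero_le_one]
  refine IntegrableOn.union hc.integrableOn_Ioc ?_
  refine Integrable.mono' ((integrableOn_Ioi_rpow_of_lt (by norm_num : (-2 : ℝ) < -1)
    one_pos).const_mul C) hc.aestronglyMeasurable ?_
  filter_upwards [ae_restrict_mem measurableSet_Ioi] with x hx
  refine le_trans (le_of_eq ?_) (hC x (one_pos.trans hx))
  rw [Real.norm_eq_abs]
  refine congrArg _ (integral_congr_ae (Eventually.of_forall fun w => ?_))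
  simp only [weylDefect]
  ring

theorem hasDerivAt_arctan_step (w : ℝ) :
    HasDerivAt (fun w => -N / 4 + 1 / Real.pi * Real.arctan (k * w))
      (1 / Real.pi * (k / (1 + k ^ 2 * w ^ 2))) w :=
  ((hasDerivAt_arctan_mul k w).const_mul _).const_add _

/-- Integration by parts: as `arctan 0 = 0`, the boundary term at `0` is the jump `-N/4` times `φ
0`, which is the `δ` contribution. -/
theorem neg_integral_arctan_step_mul_deriv (hφ : ContDiff ℝ 1 φ) (hs : HasCompactSupport φ) :
    -∫ w in Ioi (0 : ℝ), (-N / 4 + 1 / Real.pi * Real.arctan (k * w)) * deriv φ w =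
      -(N / 4) * φ 0 + ∫ w in Ioi (0 : ℝ), 1 / Real.pi * (k / (1 + k ^ 2 * w ^ 2)) * φ w := by
  obtain ⟨b, hb, h⟩ := hs.exists_pos_eq_zero
  obtain ⟨b', hb', h'⟩ := hs.deriv.exists_pos_eq_zero
  have hm : 0 < max b b' := lt_max_of_lt_left hb
  have c2 := continuous_div_one_add_sq (continuous_const : Continuous fun _ : ℝ => k) k
  rw [integral_Ioi_eq_intervalIntegral hm.le fun w hw => by
      rw [h' w ((le_max_right _ _).trans hw), mul_zero],
    integral_Ioi_eq_intervalIntegral hm.le fun w hw => by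
      rw [h w ((le_max_left _ _).trans hw), mul_zero],
    intervalIntegral.integral_mul_deriv_eq_deriv_mul (fun w _ => hasDerivAt_arctan_step N k w)
      (fun w _ => (hφ.differentiable one_ne_zero w).hasDerivAt)
      ((continuous_const.mul c2).intervalIntegrable _ _)
      ((hφ.continuous_deriv le_rfl).intervalIntegrable _ _), h _ (le_max_left _ _)]
  simp
  ring

theorem intervalIntegral_weylDefect_swap (w R : ℝ) (hφ : Continuous φ) :
    ∫ x in (0 : ℝ)..R, ∫ s in (0 : ℝ)..w, weylDefect N k s x * φ s =
      ∫ s in (0 : ℝ)..w, (∫ x in (0 : ℝ)..R, weylDefect N k s x) * φ s := by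
  rw [intervalIntegral_intervalIntegral_swap]
  · simp_rw [intervalIntegral.integral_mul_const]
  · have hc : Continuous (Function.uncurry fun x s => weylDefect N k s x * φ s) :=
      ((continuous_weylDefect N k).comp
        (by fun_prop : Continuous fun p : ℝ × ℝ => (p.2, p.1))).mul (by fun_prop)
    exact (hc.continuousOn.integrableOn_compact (isCompact_uIcc.prod isCompact_uIcc)).mono_set
      (prod_mono uIoc_subset_uIcc uIoc_subset_uIcc)

/-- The order of integration may be exchanged only for `x ≤ R`. After the exchange, integration by
parts in the frequency produces the truncated counting function, which converges pointwise and
boundedly as `R → ∞`. -/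
theorem integral_integral_weylDefect_mul (hφ : ContDiff ℝ 2 φ) (hs : HasCompactSupport φ) :
    ∫ x in Ioi (0 : ℝ), ∫ w in Ioi (0 : ℝ), weylDefect N k w x * φ w =
      -∫ w in Ioi (0 : ℝ), (-N / 4 + 1 / Real.pi * Real.arctan (k * w)) * deriv φ w := by
  obtain ⟨b, hb, h⟩ := hs.exists_pos_eq_zero
  obtain ⟨b', hb', h'⟩ := hs.deriv.exists_pos_eq_zero
  set B := max b b' with hB
  have hm : 0 < B := lt_max_of_lt_left hb
  have hφ1 : ContDiff ℝ 1 φ := hφ.of_le (by norm_num)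
  have hd : Continuous (deriv φ) := hφ1.continuous_deriv le_rfl
  have hcR : ∀ R, Continuous fun s => ∫ x in (0 : ℝ)..R, weylDefect N k s x := fun R =>
    intervalIntegral.continuous_parametric_intervalIntegral_of_continuous'
      (f := fun s x => weylDefect N k s x) (continuous_weylDefect N k) 0 R
  have hpc : ∀ R, Continuous fun w => ∫ s in (0 : ℝ)..w, ∫ x in (0 : ℝ)..R, weylDefect N k s x :=
    fun R => intervalIntegral.continuous_primitive (fun _ _ => (hcR R).intervalIntegrable _ _) 0
  have h1 := intervalIntegral_tendsto_integral_Ioi 0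
    (integrableOn_integral_weylDefect_mul N k hφ hs) tendsto_id
  refine tendsto_nhds_unique h1 ?_
  have h2 : ∀ R, ∫ x in (0 : ℝ)..R, ∫ w in Ioi (0 : ℝ), weylDefect N k w x * φ w =
      -∫ w in (0 : ℝ)..B, (∫ s in (0 : ℝ)..w, ∫ x in (0 : ℝ)..R, weylDefect N k s x) * deriv φ w :=
    fun R => by
    simp_rw [fun x => integral_Ioi_eq_intervalIntegral (f := fun w => weylDefect N k w x * φ w) hm.le
      fun w hw => by rw [h w ((le_max_left _ _).trans hw), mul_zero]]
    rw [intervalIntegral_weylDefect_swap N k B R hφ.continuous,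
      intervalIntegral.integral_mul_deriv_eq_deriv_mul
        (fun w _ => intervalIntegral.integral_hasDerivAt_right ((hcR R).intervalIntegrable _ _)
          (hcR R).aestronglyMeasurable.stronglyMeasurableAtFilter (hcR R).continuousAt)
        (fun w _ => (hφ1.differentiable one_ne_zero w).hasDerivAt)
        ((hcR R).intervalIntegrable _ _) (hd.intervalIntegrable _ _), h _ (le_max_left _ _)]
    simp
  simp_rw [id, h2]
  rw [integral_Ioi_eq_intervalIntegral hm.le fun w hw => by
      rw [h' w ((le_max_right _ _).trans hw), mul_zero]]
  refine Tendsto.neg ?_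
  refine intervalIntegral.tendsto_integral_filter_of_dominated_convergence
    -- The uniform bound is increasing in `w`, so its value at `B` dominates on the whole interval.
    (fun w => (|1 / Real.pi| * (|-N / 2| * 5 + k ^ 2 * B * B + (Real.pi / 2 + |k| * B))) * |deriv φ w|)
    ?_ ?_ ?_ ?_
  · exact Eventually.of_forall fun R => ((hpc R).mul hd).aestronglyMeasurable
  · filter_upwards [eventually_ge_atTop 0] with R hR
    refine Eventually.of_forall fun w hw => ?_
    rw [uIoc_of_le hm.le] at hw
    rw [norm_mul]
    refine mul_le_mul_of_nonneg_right
      ((abs_integral_integral_weylDefect_le N k hw.1.le hR).trans ?_) (norm_nonneg _)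
    have hw1 := hw.1.le
    have hw2 := hw.2
    gcongr
  · exact (continuous_const.mul hd.abs).intervalIntegrable _ _
  · refine Eventually.of_forall fun w hw => ?_
    rw [uIoc_of_le hm.le] at hw
    exact (tendsto_integral_integral_weylDefect N k hw.1).mul_const _

end Pairing

/-! ## The main theorem -/

theorem staircase_of_pos (N : ℕ) (α : ℝ) {w : ℝ} (hw : 0 < w) :
    staircase N α w = -(N : ℝ) / 4 + 1 / Real.pi * Real.arctan (N / α * w) := by
  rw [staircase, if_pos hw, mul_one, mul_div_right_comm]

theorem integral_staircase_mul (N : ℕ) (α : ℝ) (f : ℝ → ℝ) :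
    ∫ w, staircase N α w * f w =
      ∫ w in Ioi (0 : ℝ), (-(N : ℝ) / 4 + 1 / Real.pi * Real.arctan (N / α * w)) * f w := by
  rw [← setIntegral_eq_integral_of_forall_compl_eq_zero (s := Ioi (0 : ℝ)) fun w hw => by
    rw [staircase, if_neg (mt mem_Ioi.2 hw), mul_zero, zero_mul]]
  exact setIntegral_congr_fun measurableSet_Ioi fun w hw => by
    rw [staircase_of_pos N α hw]

theorem inv_pi_mul_lorentzian (N : ℕ) {α : ℝ} (hα : 0 < α) (w : ℝ) :
    1 / Real.pi * (N / α / (1 + (N / α) ^ 2 * w ^ 2)) =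
      (N * α / Real.pi) / (α ^ 2 + (N : ℝ) ^ 2 * w ^ 2) := by
  have h1 : α ^ 2 + (N : ℝ) ^ 2 * w ^ 2 ≠ 0 := by positivity
  have h2 : 1 + ((N : ℝ) / α) ^ 2 * w ^ 2 = (α ^ 2 + (N : ℝ) ^ 2 * w ^ 2) / α ^ 2 := by
    field_simp
  rw [h2]
  field_simp

/-! ### Transfer to an arbitrary spectral resolution and density -/

section Transfer

variable {N : ℕ} [NeZero N] {α : ℝ} {P : PVM (StarL2 N)} {σ : ℝ → ℝ → ℝ → Matrix (Fin N) (Fin N) ℝ}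

theorem proj_Icc_eq_starPVM (hα : 0 < α) (hP : P.IsSpectralMeasureOf (starHamiltonian N α))
    (Λ : ℝ) (hΛ : 0 ≤ Λ) :
    P.proj (Icc 0 Λ) = (starPVM N hα).proj (Icc 0 Λ) :=
  PVM.IsSpectralMeasureOf.proj_Icc_eq hP (starPVM_isSpectralMeasureOf hα) hΛ

theorem weylSubtractedDensity_eq_weylDefect
    (hα : 0 < α) (hP : P.IsSpectralMeasureOf (starHamiltonian N α))
    (hσ : IsSpectralDensity P σ) {w x : ℝ} (hw : 0 < w) (hx : 0 < x) :
    weylSubtractedDensity σ w x = weylDefect N (N / α) w x := by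
  rw [← weylSubtractedDensity_starDensity]
  exact Finset.sum_congr rfl fun j _ => by
    rw [hσ.eq_of_pos (starPVM_isSpectralDensity hα) (proj_Icc_eq_starPVM hα hP) hw hx hx]

theorem weylSubtractedCounting_eq_integral
    (hα : 0 < α) (hP : P.IsSpectralMeasureOf (starHamiltonian N α))
    (hσ : IsSpectralDensity P σ) {w x : ℝ} (hw : 0 ≤ w) (hx : 0 < x) :
    weylSubtractedCounting σ w x = ∫ s in (0 : ℝ)..w, weylDefect N (N / α) s x := by
  have hc : ∀ j, Continuous fun s => starDensity N ((N : ℝ) / α) s x x j j := fun j =>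
    ((continuous_starDensity N (N / α)).comp
      (by fun_prop : Continuous fun s : ℝ => (s, x, x))).matrix_elem j j
  simp_rw [← weylSubtractedDensity_starDensity, weylSubtractedDensity]
  rw [weylSubtractedCounting, if_pos hw, intervalIntegral.integral_finsetSum
    (f := fun j s => starDensity N ((N : ℝ) / α) s x x j j - 1 / Real.pi) fun j _ =>
      ((hc j).sub continuous_const).intervalIntegrable _ _]
  refine Finset.sum_congr rfl fun j _ => ?_
  rw [hσ.projKernel_eq (starPVM_isSpectralDensity hα) (proj_Icc_eq_starPVM hα hP) (sq_nonneg w) hx hx,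
    intervalIntegral.integral_sub ((hc j).intervalIntegrable _ _)
      (continuous_const.intervalIntegrable _ _), projKernel, Matrix.of_apply, Real.sqrt_sq hw]
  simp
  ring

theorem localDensityPairing_eq
    (hα : 0 < α) (hP : P.IsSpectralMeasureOf (starHamiltonian N α))
    (hσ : IsSpectralDensity P σ) (φ : ℝ → ℝ) {x : ℝ} (hx : 0 < x) :
    localDensityPairing σ x φ = ∫ w in Ioi (0 : ℝ), weylDefect N (N / α) w x * φ w :=
  setIntegral_congr_fun measurableSet_Ioi fun w hw => by
    simp only [weylSubtractedDensity_eq_weylDefect hα hP hσ hw hx]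

theorem globalDensity_eq
    (hα : 0 < α) (hP : P.IsSpectralMeasureOf (starHamiltonian N α))
    (hσ : IsSpectralDensity P σ) (φ : ℝ → ℝ) :
    globalDensity σ φ =
      ∫ x in Ioi (0 : ℝ), ∫ w in Ioi (0 : ℝ), weylDefect N (N / α) w x * φ w :=
  setIntegral_congr_fun measurableSet_Ioi fun _ hx => localDensityPairing_eq hα hP hσ φ hx

theorem tendsto_integral_weylSubtractedCounting
    (hα : 0 < α) (hP : P.IsSpectralMeasureOf (starHamiltonian N α))
    (hσ : IsSpectralDensity P σ) (w : ℝ) :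
    Tendsto (fun R : ℝ => ∫ x in (0 : ℝ)..R, weylSubtractedCounting σ w x) atTop
      (𝓝 (staircase N α w)) := by
  rcases lt_trichotomy w 0 with hw | rfl | hw
  -- For `w < 0` both sides vanish by definition. At `w = 0` the frequency interval is empty of mass
  -- and the step function takes the value `0`, so the jump does not show.
  · simp [weylSubtractedCounting, staircase, hw.not_ge, hw.le.not_gt]
  · simp [weylSubtractedCounting, staircase, projKernel]
  rw [staircase_of_pos N α hw]
  refine (tendsto_integral_integral_weylDefect N (N / α) hw).congr' ?_
  filter_upwards [eventually_ge_atTop 0] with R hR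
  have h := intervalIntegral_weylDefect_swap (φ := fun _ => 1) N (N / α) w R continuous_const
  simp only [mul_one] at h
  rw [← h, intervalIntegral.integral_of_le hR, intervalIntegral.integral_of_le hR]
  exact setIntegral_congr_fun measurableSet_Ioc fun x hx =>
    (weylSubtractedCounting_eq_integral hα hP hσ hw.le hx.1).symm

end Transfer

theorem mainTheorem6 (N : ℕ) (hN : 1 ≤ N) (α : ℝ) (hα : 0 < α) :
    (∃ (P : PVM (StarL2 N)) (σ : ℝ → ℝ → ℝ → Matrix (Fin N) (Fin N) ℝ),
      P.IsSpectralMeasureOf (starHamiltonian N α) ∧ IsSpectralDensity P σ) ∧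
    ∀ (P : PVM (StarL2 N)) (σ : ℝ → ℝ → ℝ → Matrix (Fin N) (Fin N) ℝ),
      P.IsSpectralMeasureOf (starHamiltonian N α) → IsSpectralDensity P σ →
      (∀ φ : 𝓓((⊤ : TopologicalSpace.Opens ℝ), ℝ),
        (∀ x, 0 < x →
          IntegrableOn (fun ω => weylSubtractedDensity σ ω x * φ ω) (Ioi 0)) ∧
        IntegrableOn (fun x => localDensityPairing σ x φ) (Ioi 0) ∧
        globalDensity σ φ = (1 / 2 - (N : ℝ) / 4) * φ 0 +
          ((∫ ω in Ioi (0 : ℝ), (N * α / Real.pi) / (α ^ 2 + (N : ℝ) ^ 2 * ω ^ 2) * φ ω)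
            - 1 / 2 * φ 0) ∧
        globalDensity σ φ = -((N : ℝ) / 4) * φ 0 +
          ∫ ω in Ioi (0 : ℝ), (N * α / Real.pi) / (α ^ 2 + (N : ℝ) ^ 2 * ω ^ 2) * φ ω) ∧
      (∀ ω : ℝ, Tendsto (fun R : ℝ => ∫ x in (0 : ℝ)..R, weylSubtractedCounting σ ω x) atTop
        (𝓝 (staircase N α ω))) ∧
      (∀ φ : 𝓓((⊤ : TopologicalSpace.Opens ℝ), ℝ),
        globalDensity σ φ = - ∫ ω, staircase N α ω * deriv φ ω) := by

  have : NeZero N := ⟨by omega⟩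
  refine ⟨⟨starPVM N hα, starDensity N (N / α), starPVM_isSpectralMeasureOf hα,
    starPVM_isSpectralDensity hα⟩, fun P σ hP hσ => ?_⟩
  have hφ2 : ∀ φ : 𝓓((⊤ : TopologicalSpace.Opens ℝ), ℝ), ContDiff ℝ 2 φ := fun φ =>
    φ.contDiff.of_le (by
      have : ((2 : ℕ∞) : WithTop ℕ∞) ≤ ((⊤ : ℕ∞) : WithTop ℕ∞) := WithTop.coe_le_coe.2 le_top
      exact this)
  have hg : ∀ φ : 𝓓((⊤ : TopologicalSpace.Opens ℝ), ℝ),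
      globalDensity σ φ = -∫ w, staircase N α w * deriv φ w := fun φ => by
    rw [globalDensity_eq hα hP hσ, integral_staircase_mul,
      integral_integral_weylDefect_mul N (N / α) (hφ2 φ) φ.hasCompactSupport]
  have hv : ∀ φ : 𝓓((⊤ : TopologicalSpace.Opens ℝ), ℝ),
      globalDensity σ φ = -((N : ℝ) / 4) * φ 0 +
        ∫ ω in Ioi (0 : ℝ), (N * α / Real.pi) / (α ^ 2 + (N : ℝ) ^ 2 * ω ^ 2) * φ ω := fun φ => by
    rw [hg, integral_staircase_mul, neg_integral_arctan_step_mul_deriv N (N / α)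
      ((hφ2 φ).of_le (by norm_num)) φ.hasCompactSupport]
    simp_rw [inv_pi_mul_lorentzian N hα]
  refine ⟨fun φ => ⟨fun x hx => ?_, ?_, ?_, hv φ⟩,
    tendsto_integral_weylSubtractedCounting hα hP hσ, hg⟩
  · exact (integrableOn_weylDefect_mul N (N / α) φ.continuous φ.hasCompactSupport x).congr_fun
      (fun w hw => by rw [weylSubtractedDensity_eq_weylDefect hα hP hσ hw hx]) measurableSet_Ioi
  · exact (integrableOn_integral_weylDefect_mul N (N / α) (hφ2 φ) φ.hasCompactSupport).congr_fun
      (fun x hx => (localDensityPairing_eq hα hP hσ φ hx).symm) measurableSet_Ioi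
  -- The two halves of `δ` cancel, so the split form is the same distribution as the reduced one.
  · rw [hv φ]
    ring
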